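/- Let $k$ be a field and let $k[s,t]$ be $\mathbb{N}^2$-graded with $|s|=(1,0)$, $|t|=(0,1)$. Let $\mathcal{Q}$ be the Serre quotient of the abelian category of finitely generated $\mathbb{N}^2$-graded $k[s,t]$-modules (with degree-preserving maps) by the Serre subcategory of finite modules, i.e. those that are nonzero in only finitely many degrees. Let $\mathcal{D}(K_2)$ be the category whose objects consist of a finitely generated $\mathbb{Z}\times\mathbb{N}$-graded $k[s^{\pm1},t]$-module $M_{\{1\}}$, a finitely generated $\mathbb{N}\times\mathbb{Z}$-graded $k[s,t^{\pm1}]$-module $M_{\{2\}}$, a finitely generated $\mathbb{Z}^2$-graded $k[s^{\pm1},t^{\pm1}]$-module $M_{\{1,2\}}$, and graded maps $M_{\{1\}}\to M_{\{1,2\}}\leftarrow M_{\{2\}}$ (linear over $k[s^{\pm1},t]$ and $k[s,t^{\pm1}]$ respectively) that induce isomorphisms after extension of scalars to $k[s^{\pm1},t^{\pm1}]$; morphisms are compatible families of graded module maps. (1) The functor sending a module $M$ to its localizations $M[s^{-1}]\to M[s^{-1},t^{-1}]\leftarrow M[t^{-1}]$ induces an equivalence of categories $\mathcal{Q}\simeq\mathcal{D}(K_2)$.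 (2) The following objects are indecomposable in $\mathcal{Q}$: the vertical strips $[a,b)_1 = s^a k[s,t]/s^b k[s,t]$ and the horizontal strips $[a,b)_2 = t^a k[s,t]/t^b k[s,t]$, for natural numbers $a<b$, and the quadrants $[(a_1,a_2),\infty)=s^{a_1}t^{a_2}k[s,t]$, for $a_1,a_2\in\mathbb{N}$. (3) Every object of $\mathcal{Q}$ is isomorphic to a finite direct sum of objects from the list in (2), and the decomposition is unique: in any two such decompositions of the same object, the same members of the list (same type and same parameters) occur with the same multiplicities. -/

import Mathlib

open CategoryTheory CategoryTheory.Limits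

universe u

namespace PersistenceModule

open ZeroObject

/-! An `ℕ^m`-graded module over `k[t_1, …, t_m]` is a functor from the poset `ℕ^m` to `k`-vector
spaces: `M.obj d` is the part of degree `d`, and `M.map` of `d ≤ e` is multiplication by the
monomial `t^(e - d)`. Maps of graded modules (of degree zero) are natural transformations. More
generally, a functor out of a preorder `P` is regarded as a `P`-graded module. -/

section Generation

variable {k : Type u} [Field k] {P : Type} [Preorder P]

/-- For a family `S` of homogeneous elements of `M`, the part in degree `d` of the graded
submodule of `M` generated by `S`. -/
def genSpan (M : P ⥤ ModuleCat.{u} k) (S : Set (Σ d : P, M.obj d)) (d : P) :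
    Submodule k (M.obj d) :=
  Submodule.span k {y | ∃ g ∈ S, ∃ h : g.1 ≤ d, y = (M.map (homOfLE h)).hom g.2}

/-- A graded module is finitely generated if it is generated by finitely many homogeneous
elements. -/
def IsFG (k : Type u) [Field k] (P : Type) [Preorder P] :
    ObjectProperty (P ⥤ ModuleCat.{u} k) :=
  fun M => ∃ S : Set (Σ d : P, M.obj d), S.Finite ∧ ∀ d, genSpan M S d = ⊤

theorem map_mem_genSpan (M : P ⥤ ModuleCat.{u} k) (S : Set (Σ d : P, M.obj d)) {d e : P}
    (f : d ⟶ e) {x : M.obj d} (hx : x ∈ genSpan M S d) : (M.map f).hom x ∈ genSpan M S e := by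
  have : genSpan M S d ≤ (genSpan M S e).comap (M.map f).hom := by
    refine Submodule.span_le.2 ?_
    rintro y ⟨g, hg, h, rfl⟩
    refine Submodule.subset_span ⟨g, hg, h.trans (leOfHom f), ?_⟩
    rw [← LinearMap.comp_apply, ← ModuleCat.hom_comp, ← M.map_comp]
    rfl
  exact this hx

theorem mem_genSpan_self (M : P ⥤ ModuleCat.{u} k) (S : Set (Σ d : P, M.obj d)) 
    {g : Σ d : P, M.obj d} (hg : g ∈ S) : g.2 ∈ genSpan M S g.1 := by
  refine Submodule.subset_span ⟨g, hg, le_rfl, ?_⟩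
  have : homOfLE (le_refl g.1) = 𝟙 _ := rfl
  rw [this, M.map_id]; rfl

theorem genSpan_mono (M : P ⥤ ModuleCat.{u} k) {S T : Set (Σ d : P, M.obj d)} (h : S ⊆ T) (d : P) :
    genSpan M S d ≤ genSpan M T d :=
  Submodule.span_mono fun _ ⟨g, hg, h'⟩ => ⟨g, h hg, h'⟩

theorem genSpan_le (M : P ⥤ ModuleCat.{u} k) {S : Set (Σ d : P, M.obj d)}
    (N : ∀ d, Submodule k (M.obj d))
    (hN : ∀ {d e : P} (f : d ⟶ e) (x : M.obj d), x ∈ N d → (M.map f).hom x ∈ N e)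
    (hS : ∀ g ∈ S, g.2 ∈ N g.1) (d : P) : genSpan M S d ≤ N d := by
  refine Submodule.span_le.2 ?_
  rintro y ⟨g, hg, h, rfl⟩
  exact hN _ _ (hS g hg)

/-- Graded submodules of a finitely generated graded module are finitely generated, when the
grading poset is well-quasi-ordered. -/
theorem exists_finite_generators_of_le_genSpan {P : Type} [PartialOrder P] [WellQuasiOrderedLE P]
    (M : P ⥤ ModuleCat.{u} k) (S : Set (Σ d : P, M.obj d)) (hS : S.Finite)
    (N : ∀ d, Submodule k (M.obj d))
    (hN : ∀ {d e : P} (f : d ⟶ e) (x : M.obj d), x ∈ N d → (M.map f).hom x ∈ N e)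
    (hNS : ∀ d, N d ≤ genSpan M S d) :
    ∃ T : Set (Σ d : P, M.obj d), T.Finite ∧ ∀ d, genSpan M T d = N d := by
  induction S, hS using Set.Finite.induction_on generalizing N with
  | empty =>
    refine ⟨∅, Set.finite_empty, fun d => ?_⟩
    have h0 : genSpan M ∅ d = ⊥ := by simp [genSpan]
    rw [h0]
    have := hNS d
    rw [h0] at this
    exact (le_bot_iff.1 this).symm
  | @insert g S _ hS ih =>
    obtain ⟨T, hT, hTN⟩ := ih (fun d => N d ⊓ genSpan M S d)
      (fun f x hx => ⟨hN f x hx.1, map_mem_genSpan M S f hx.2⟩) (fun d => inf_le_right)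
    let U : Set P := {d | ∃ (h : g.1 ≤ d) (y : M.obj d), y ∈ N d ∧
      y - (M.map (homOfLE h)).hom g.2 ∈ genSpan M S d}
    have hpwo : U.IsPWO := Set.isPWO_of_wellQuasiOrderedLE U
    let V : Set P := {d | Minimal (· ∈ U) d}
    have hV : V.Finite :=
      WellQuasiOrderedLE.finite_of_isAntichain (setOfPred_minimal_antichain (· ∈ U))
    choose! hle y hyN hyS using fun d (hd : d ∈ U) => hd
    let W : Set (Σ d : P, M.obj d) := (fun d => ⟨d, y d⟩) '' V
    have hWN : ∀ q ∈ W, q.2 ∈ N q.1 := by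
      rintro _ ⟨d, hd, rfl⟩
      exact hyN d hd.prop
    have hTN' : ∀ q ∈ T, q.2 ∈ N q.1 := fun q hq => by
      have := mem_genSpan_self M T hq
      rw [hTN] at this
      exact this.1
    refine ⟨T ∪ W, hT.union (hV.image _), fun d => le_antisymm
      (genSpan_le M N hN (fun q hq => hq.elim (hTN' q) (hWN q)) d) fun z hz => ?_⟩
    have hz' := hNS d hz
    have key : genSpan M (insert g S) d = Submodule.span k
        {w | ∃ h : g.1 ≤ d, w = (M.map (homOfLE h)).hom g.2} ⊔ genSpan M S d := by
      rw [genSpan, genSpan, ← Submodule.span_union]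
      congr 1
      ext w
      constructor
      · rintro ⟨q, rfl | hq, h⟩
        · exact Or.inl h
        · exact Or.inr ⟨q, hq, h⟩
      · rintro (h | ⟨q, hq, h⟩)
        · exact ⟨g, Or.inl rfl, h⟩
        · exact ⟨q, Or.inr hq, h⟩
    have hsmall : ∀ w ∈ N d, w ∈ genSpan M S d → w ∈ genSpan M (T ∪ W) d := fun w h1 h2 => by
      have : w ∈ genSpan M T d := by rw [hTN]; exact ⟨h1, h2⟩
      exact genSpan_mono M Set.subset_union_left d this
    rw [key] at hz'
    obtain ⟨a, ha, b, hb, rfl⟩ := Submodule.mem_sup.1 hz'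
    by_cases hgd : g.1 ≤ d
    · have : {w | ∃ h : g.1 ≤ d, w = (M.map (homOfLE h)).hom g.2} =
          {(M.map (homOfLE hgd)).hom g.2} := by
        ext w
        simp [hgd]
      rw [this] at ha
      obtain ⟨c, rfl⟩ := Submodule.mem_span_singleton.1 ha
      by_cases hc : c = 0
      · subst hc
        apply hsmall _ hz
        simpa using hb
      · have hdU : d ∈ U := by
          refine ⟨hgd, c⁻¹ • (c • (M.map (homOfLE hgd)).hom g.2 + b), Submodule.smul_mem _ _ hz, ?_⟩
          rw [smul_add, smul_smul, inv_mul_cancel₀ hc, one_smul, add_sub_cancel_left]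
          exact Submodule.smul_mem _ _ hb
        obtain ⟨e, hed, he⟩ := hpwo.exists_le_minimal hdU
        have h1 : (M.map (homOfLE hed)).hom (y e) ∈ genSpan M (T ∪ W) d := by
          apply map_mem_genSpan
          exact mem_genSpan_self M (T ∪ W) (g := ⟨e, y e⟩) (Or.inr ⟨e, he, rfl⟩)
        have h2 : (M.map (homOfLE hed)).hom (y e) - (M.map (homOfLE hgd)).hom g.2 ∈
            genSpan M S d := by
          have := map_mem_genSpan M S (homOfLE hed) (hyS e he.prop)
          rw [map_sub, ← LinearMap.comp_apply, ← ModuleCat.hom_comp, ← M.map_comp] at this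
          exact this
        have h3 : c • (M.map (homOfLE hgd)).hom g.2 + b =
            c • (M.map (homOfLE hed)).hom (y e) + ((c • (M.map (homOfLE hgd)).hom g.2 + b) -
              c • (M.map (homOfLE hed)).hom (y e)) := by abel
        rw [h3]
        refine add_mem (Submodule.smul_mem _ _ h1) (hsmall _ (sub_mem hz
          (Submodule.smul_mem _ _ (hN _ _ (hyN e he.prop)))) ?_)
        have h4 : c • (M.map (homOfLE hgd)).hom g.2 + b - c • (M.map (homOfLE hed)).hom (y e) =
          b - c • ((M.map (homOfLE hed)).hom (y e) - (M.map (homOfLE hgd)).hom g.2) := by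
          rw [smul_sub]; abel
        rw [h4]
        exact sub_mem hb (Submodule.smul_mem _ _ h2)
    · have : {w | ∃ h : g.1 ≤ d, w = (M.map (homOfLE h)).hom g.2} = ∅ := by
        ext w
        simp [hgd]
      rw [this, Submodule.span_empty, Submodule.mem_bot] at ha
      subst ha
      apply hsmall _ hz
      simpa using hb

theorem isFG_of_epi {M N : P ⥤ ModuleCat.{u} k} (f : M ⟶ N)
    (hf : ∀ d, Function.Surjective (f.app d).hom) (hM : IsFG k P M) : IsFG k P N := by
  obtain ⟨S, hS, h⟩ := hM
  refine ⟨(fun g => ⟨g.1, (f.app g.1).hom g.2⟩) '' S, hS.image _, fun d => ?_⟩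
  rw [eq_top_iff]
  rintro z -
  obtain ⟨y, rfl⟩ := hf d z
  have : genSpan M S d ≤ (genSpan N ((fun g => ⟨g.1, (f.app g.1).hom g.2⟩) '' S) d).comap
      (f.app d).hom := by
    refine Submodule.span_le.2 ?_
    rintro _ ⟨g, hg, h, rfl⟩
    refine Submodule.subset_span ⟨_, ⟨g, hg, rfl⟩, h, ?_⟩
    exact LinearMap.congr_fun (congrArg ModuleCat.Hom.hom (f.naturality (homOfLE h))) g.2
  exact this (by rw [h d]; trivial)

theorem isFG_of_mono {P : Type} [PartialOrder P] [WellQuasiOrderedLE P]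
    {M N : P ⥤ ModuleCat.{u} k} (f : M ⟶ N)
    (hf : ∀ d, Function.Injective (f.app d).hom) (hN : IsFG k P N) : IsFG k P M := by
  have nat : ∀ {d e : P} (φ : d ⟶ e) (x : M.obj d),
      (f.app e).hom ((M.map φ).hom x) = (N.map φ).hom ((f.app d).hom x) := fun φ x =>
    LinearMap.congr_fun (congrArg ModuleCat.Hom.hom (f.naturality φ)) x
  obtain ⟨S, hS, h⟩ := hN
  obtain ⟨T, hT, hTN⟩ := exists_finite_generators_of_le_genSpan N S hS
    (fun d => LinearMap.range (f.app d).hom)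
    (by rintro d e φ _ ⟨y, rfl⟩; exact ⟨(M.map φ).hom y, nat φ y⟩)
    (fun d => by rw [h]; exact le_top)
  have hT' : ∀ q ∈ T, ∃ x, (f.app q.1).hom x = q.2 := fun q hq => by
    have := mem_genSpan_self N T hq
    rw [hTN] at this
    exact this
  choose! x hx using hT'
  refine ⟨(fun q => ⟨q.1, x q⟩) '' T, hT.image _, fun d => ?_⟩
  have hmap : (genSpan N T d) ≤ (genSpan M ((fun q => ⟨q.1, x q⟩) '' T) d).map (f.app d).hom := by
    refine Submodule.span_le.2 ?_
    rintro _ ⟨q, hq, hqd, rfl⟩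
    refine ⟨(M.map (homOfLE hqd)).hom (x q), ?_, ?_⟩
    · exact Submodule.subset_span ⟨_, ⟨q, hq, rfl⟩, hqd, rfl⟩
    · rw [nat, hx q hq]
  rw [eq_top_iff]
  rintro z -
  obtain ⟨w, hw, hwz⟩ := hmap (by rw [hTN]; exact ⟨z, rfl⟩ : (f.app d).hom z ∈ genSpan N T d)
  rwa [← hf d hwz]

theorem isFG_of_exact {M N Q : P ⥤ ModuleCat.{u} k} (f : M ⟶ N) (g : N ⟶ Q)
    (hfg : ∀ d (y : N.obj d), (g.app d).hom y = 0 → ∃ x, (f.app d).hom x = y)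
    (hg : ∀ d, Function.Surjective (g.app d).hom) (hM : IsFG k P M) (hQ : IsFG k P Q) :
    IsFG k P N := by
  obtain ⟨S, hS, hS'⟩ := hM
  obtain ⟨T, hT, hT'⟩ := hQ
  choose s hs using hg
  let A : Set (Σ d : P, N.obj d) := (fun q => ⟨q.1, (f.app q.1).hom q.2⟩) '' S
  let B : Set (Σ d : P, N.obj d) := (fun q => ⟨q.1, s q.1 q.2⟩) '' T
  refine ⟨A ∪ B, (hS.image _).union (hT.image _), fun d => ?_⟩
  have h1 : genSpan M S d ≤ (genSpan N (A ∪ B) d).comap (f.app d).hom := by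
    refine Submodule.span_le.2 ?_
    rintro _ ⟨q, hq, h, rfl⟩
    refine Submodule.subset_span ⟨_, Or.inl ⟨q, hq, rfl⟩, h, ?_⟩
    exact LinearMap.congr_fun (congrArg ModuleCat.Hom.hom (f.naturality (homOfLE h))) q.2
  have h2 : genSpan Q T d ≤ (genSpan N (A ∪ B) d).map (g.app d).hom := by
    refine Submodule.span_le.2 ?_
    rintro _ ⟨q, hq, h, rfl⟩
    refine ⟨(N.map (homOfLE h)).hom (s q.1 q.2), Submodule.subset_span
      ⟨_, Or.inr ⟨q, hq, rfl⟩, h, rfl⟩, ?_⟩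
    refine (LinearMap.congr_fun (congrArg ModuleCat.Hom.hom (g.naturality (homOfLE h))) _).trans ?_
    exact congrArg (Q.map (homOfLE h)).hom (hs q.1 q.2)
  rw [hS'] at h1
  rw [hT'] at h2
  rw [eq_top_iff]
  rintro z -
  obtain ⟨w, hw, hwz⟩ := h2 (Submodule.mem_top (x := (g.app d).hom z))
  obtain ⟨x, hx⟩ := hfg d (z - w) (by rw [map_sub, hwz, sub_self])
  have : z = w + (f.app d).hom x := by rw [hx]; abel
  rw [this]
  exact add_mem hw (h1 (Submodule.mem_top (x := x)))


theorem app_injective_of_mono {M N : P ⥤ ModuleCat.{u} k} (f : M ⟶ N) [Mono f] (d : P) :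
    Function.Injective (f.app d).hom :=
  (ModuleCat.mono_iff_injective (f.app d)).1 inferInstance

theorem app_surjective_of_epi {M N : P ⥤ ModuleCat.{u} k} (f : M ⟶ N) [Epi f] (d : P) :
    Function.Surjective (f.app d).hom :=
  (ModuleCat.epi_iff_surjective (f.app d)).1 inferInstance

theorem app_exact_of_shortExact {S : ShortComplex (P ⥤ ModuleCat.{u} k)} (hS : S.ShortExact)
    (d : P) (y : S.X₂.obj d) (hy : (S.g.app d).hom y = 0) : ∃ x, (S.f.app d).hom x = y := by
  have h := hS.exact.map ((evaluation P (ModuleCat.{u} k)).obj d)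
  exact (ShortComplex.moduleCat_exact_iff _).1 h y hy

instance (k : Type u) [Field k] (P : Type) [PartialOrder P] [WellQuasiOrderedLE P] :
    (IsFG k P).IsSerreClass where
  exists_zero := ⟨_, isZero_zero _, ∅, Set.finite_empty, fun d => by
    have : Subsingleton ((0 : P ⥤ ModuleCat.{u} k).obj d) :=
      ModuleCat.subsingleton_of_isZero
        (((evaluation P (ModuleCat.{u} k)).obj d).map_isZero (isZero_zero _))
    exact Subsingleton.elim _ _⟩
  prop_of_mono f _ h := isFG_of_mono f (app_injective_of_mono f) h
  prop_of_epi f _ h := isFG_of_epi f (app_surjective_of_epi f) h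
  prop_X₂_of_shortExact hS h₁ h₃ := by
    have := hS.epi_g
    exact isFG_of_exact _ _ (app_exact_of_shortExact hS) (app_surjective_of_epi _) h₁ h₃

/-- A graded module is finite if it is nonzero in only finitely many degrees. -/
def HasFiniteSupport (k : Type u) [Field k] (P : Type) [Preorder P] :
    ObjectProperty (P ⥤ ModuleCat.{u} k) :=
  fun M => {d | Nontrivial (M.obj d)}.Finite

instance (k : Type u) [Field k] (P : Type) [Preorder P] :
    (HasFiniteSupport k P).IsSerreClass where
  exists_zero := ⟨_, isZero_zero _, by
    refine (Set.finite_empty (α := P)).subset fun d (hd : Nontrivial _) => ?_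
    have : Subsingleton ((0 : P ⥤ ModuleCat.{u} k).obj d) :=
      ModuleCat.subsingleton_of_isZero
        (((evaluation P (ModuleCat.{u} k)).obj d).map_isZero (isZero_zero _))
    exact (not_nontrivial_iff_subsingleton.2 this hd).elim⟩
  prop_of_mono f _ h := h.subset fun d (hd : Nontrivial _) =>
    (app_injective_of_mono f d).nontrivial
  prop_of_epi f _ h := h.subset fun d (hd : Nontrivial _) =>
    (app_surjective_of_epi f d).nontrivial
  prop_X₂_of_shortExact {S} hS h₁ h₃ := (h₁.union h₃).subset fun d (hd : Nontrivial _) => by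
    by_contra hcon
    simp only [Set.mem_union, Set.mem_ofPred_eq, not_or, not_nontrivial_iff_subsingleton] at hcon
    obtain ⟨_, _⟩ := hcon
    obtain ⟨y, hy⟩ := exists_ne (0 : S.X₂.obj d)
    obtain ⟨x, hx⟩ := app_exact_of_shortExact hS d y (Subsingleton.elim _ _)
    rw [Subsingleton.elim x 0, map_zero] at hx
    exact hy hx.symm

end Generation

/-- The category of finitely generated `ℕ^m`-graded modules over `k[t_1, …, t_m]`. -/
abbrev FGMod (k : Type u) [Field k] (m : ℕ) := (IsFG k (Fin m →₀ ℕ)).FullSubcategory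

instance (k : Type u) [Field k] (m : ℕ) :
    (IsFG k (Fin m →₀ ℕ)).IsClosedUnderFiniteProducts :=
  have : (IsFG k (Fin m →₀ ℕ)).IsClosedUnderBinaryProducts := ⟨by
    rintro X ⟨p⟩
    have e : X ≅ p.diag.obj ⟨.left⟩ ⊞ p.diag.obj ⟨.right⟩ :=
      (p.isLimit.conePointsIsoOfNatIso (limit.isLimit _) (diagramIsoPair p.diag)) ≪≫
        (biprod.isoProd _ _).symm
    exact ObjectProperty.prop_of_iso _ e.symm
      (ObjectProperty.prop_biprod _ (p.prop_diag_obj _) (p.prop_diag_obj _))⟩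
  .mk'


/-- The finite modules: finitely generated graded modules that are nonzero in only finitely many
degrees. -/
def finiteModules (k : Type u) [Field k] (m : ℕ) : ObjectProperty (FGMod k m) :=
  (HasFiniteSupport k (Fin m →₀ ℕ)).inverseImage (IsFG k (Fin m →₀ ℕ)).ι

instance (k : Type u) [Field k] (m : ℕ) : (finiteModules k m).IsSerreClass := by
  have h₁ : PreservesFiniteLimits (IsFG k (Fin m →₀ ℕ)).ι :=
    have := (IsFG k (Fin m →₀ ℕ)).preservesKernels_ι
    Functor.preservesFiniteLimits_of_preservesKernels _
  have h₂ : PreservesFiniteColimits (IsFG k (Fin m →₀ ℕ)).ι :=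
    have := (IsFG k (Fin m →₀ ℕ)).preservesCokernels_ι
    Functor.preservesFiniteColimits_of_preservesCokernels _
  unfold finiteModules
  infer_instance


/-- The category of finitely generated `ℕ^m`-graded modules up to finite modules, that is, the
Serre quotient: the localization at the maps whose kernel and cokernel are finite modules. -/
def QuotMod (k : Type u) [Field k] (m : ℕ) := (finiteModules k m).isoModSerre.Localization

noncomputable instance (k : Type u) [Field k] (m : ℕ) : Category (QuotMod k m) :=
  inferInstanceAs (Category (finiteModules k m).isoModSerre.Localization)

/-- The quotient functor to the Serre quotient. -/
def quotFunctor (k : Type u) [Field k] (m : ℕ) : FGMod k m ⥤ QuotMod k m :=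
  (finiteModules k m).isoModSerre.Q

noncomputable instance (k : Type u) [Field k] (m : ℕ) :
    Abelian (finiteModules k m).isoModSerre.Localization :=
  ObjectProperty.SerreClassLocalization.abelian (finiteModules k m).isoModSerre.Q
    (finiteModules k m)

noncomputable instance (k : Type u) [Field k] (m : ℕ) : Abelian (QuotMod k m) :=
  inferInstanceAs (Abelian (finiteModules k m).isoModSerre.Localization)

instance (k : Type u) [Field k] (m : ℕ) : HasFiniteBiproducts (QuotMod k m) :=
  Abelian.hasFiniteBiproducts

section Objects

variable (k : Type u) [Field k] {m : ℕ}

open Classical in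
/-- The degree `d` part of the monomial ideal `t^a k[t_1, …, t_m]`: the line spanned by `t^d`
(identified with `k`) if `a ≤ d`, and zero otherwise. -/
noncomputable def monomialIdealPart (a d : Fin m →₀ ℕ) : Submodule k k := if a ≤ d then ⊤ else ⊥

theorem monomialIdealPart_mono (a : Fin m →₀ ℕ) {d e : Fin m →₀ ℕ} (h : d ≤ e) :
    monomialIdealPart k a d ≤ monomialIdealPart k a e := by
  unfold monomialIdealPart
  split_ifs with h₁ h₂
  · exact le_rfl
  · exact absurd (h₁.trans h) h₂
  · exact bot_le
  · exact bot_le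

theorem monomialIdealPart_anti {a b : Fin m →₀ ℕ} (h : a ≤ b) (d : Fin m →₀ ℕ) :
    monomialIdealPart k b d ≤ monomialIdealPart k a d := by
  unfold monomialIdealPart
  split_ifs with h₁ h₂
  · exact le_rfl
  · exact absurd (h.trans h₁) h₂
  · exact bot_le
  · exact bot_le

/-- The monomial ideal `t^a k[t_1, …, t_m]` as a graded module. Multiplication by `t^{e-d}` sends
`t^d` to `t^e`, so it is the inclusion of subspaces of `k`. -/
noncomputable def monomialIdealFunctor (a : Fin m →₀ ℕ) : (Fin m →₀ ℕ) ⥤ ModuleCat.{u} k where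
  obj d := ModuleCat.of k (monomialIdealPart k a d)
  map f := ModuleCat.ofHom (Submodule.inclusion (monomialIdealPart_mono k a (leOfHom f)))

theorem isFG_monomialIdealFunctor (a : Fin m →₀ ℕ) :
    IsFG k (Fin m →₀ ℕ) (monomialIdealFunctor k a) := by
  have h1 : (1 : k) ∈ monomialIdealPart k a a := by simp [monomialIdealPart]
  refine ⟨{⟨a, ⟨1, h1⟩⟩}, Set.finite_singleton _, fun d => ?_⟩
  rw [eq_top_iff]
  rintro ⟨x, hx⟩ -
  by_cases h : a ≤ d
  · have : (⟨x, hx⟩ : monomialIdealPart k a d) =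
        x • (⟨1, monomialIdealPart_mono k a h h1⟩ : monomialIdealPart k a d) := by
      ext; simp
    rw [this]
    exact Submodule.smul_mem _ _ (Submodule.subset_span ⟨_, rfl, h, rfl⟩)
  · have hx0 : x = 0 := by simpa [monomialIdealPart, h] using hx
    subst hx0
    exact Submodule.zero_mem _

/-- The monomial ideal `t^a k[t_1, …, t_m]` as a finitely generated graded module. -/
noncomputable def monomialIdeal (a : Fin m →₀ ℕ) : FGMod k m :=
  ⟨monomialIdealFunctor k a, isFG_monomialIdealFunctor k a⟩

/-- The inclusion of ideals `t^b k[t_1, …, t_m] ⊆ t^a k[t_1, …, t_m]` for `a ≤ b`. -/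
noncomputable def monomialIdealInclusion {a b : Fin m →₀ ℕ} (h : a ≤ b) :
    monomialIdeal k b ⟶ monomialIdeal k a :=
  ObjectProperty.homMk
    { app := fun d => ModuleCat.ofHom (Submodule.inclusion (monomialIdealPart_anti k h d)) }

/-- The module `t_i^a k[t_1, …, t_m] / t_i^b k[t_1, …, t_m]` for `a ≤ b`. -/
noncomputable def stripModule (i : Fin m) {a b : ℕ} (h : a ≤ b) : FGMod k m :=
  cokernel (monomialIdealInclusion k
    (show Finsupp.single i a ≤ Finsupp.single i b from Finsupp.single_le_single.2 h))

end Objects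

/-- The labels of the indecomposables for `m = 2`, with `s = t_0` and `t = t_1`. -/
inductive IndecLabel : Type
  | verticalStrip (a b : ℕ) (h : a < b)
  | horizontalStrip (a b : ℕ) (h : a < b)
  | quadrant (a₁ a₂ : ℕ)

/-- The graded module with a given label: the vertical strip `s^a k[s,t] / s^b k[s,t]`, the
horizontal strip `t^a k[s,t] / t^b k[s,t]`, or the quadrant `s^(a₁) t^(a₂) k[s,t]`. -/
noncomputable def IndecLabel.module (k : Type u) [Field k] : IndecLabel → FGMod k 2
  | verticalStrip _ _ h => stripModule k 0 h.le
  | horizontalStrip _ _ h => stripModule k 1 h.le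
  | quadrant a₁ a₂ => monomialIdeal k (Finsupp.single 0 a₁ + Finsupp.single 1 a₂)


section Localized

variable {m : ℕ}

/-- The monoid `σ⁻¹ℕ^m`: vectors of integers whose coordinates outside `σ` are nonnegative. -/
@[ext]
structure LocDeg (σ : Finset (Fin m)) where
  /-- the underlying vector of integers -/
  val : Fin m → ℤ
  nonneg : ∀ i ∉ σ, 0 ≤ val i

/-- `d ≤ e` if `e - d` lies in `σ⁻¹ℕ^m`, that is, if there is a (unique) Laurent monomial of
degree `e - d` in `R_σ`. Each variable `t_i` with `i ∈ σ` acts invertibly on a functor out of this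
preorder, so that such functors to vector spaces are the `σ⁻¹ℕ^m`-graded `R_σ`-modules. -/
instance (σ : Finset (Fin m)) : Preorder (LocDeg σ) where
  le d e := ∀ i ∉ σ, d.val i ≤ e.val i
  le_refl _ _ _ := le_rfl
  le_trans _ _ _ h h' i hi := (h i hi).trans (h' i hi)

/-- The inclusion `ℕ^m → σ⁻¹ℕ^m`. -/
def natIncl (σ : Finset (Fin m)) : (Fin m →₀ ℕ) ⥤ LocDeg σ :=
  Monotone.functor (f := fun d => ⟨fun i => (d i : ℤ), fun i _ => Int.natCast_nonneg (d i)⟩)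
    fun _ _ h i _ => Int.ofNat_le.2 (h i)

/-- The inclusion `σ⁻¹ℕ^m → τ⁻¹ℕ^m` for `σ ⊆ τ`. -/
def locIncl {σ τ : Finset (Fin m)} (h : σ ⊆ τ) : LocDeg σ ⥤ LocDeg τ :=
  Monotone.functor (f := fun d => ⟨d.val, fun i hi => d.nonneg i fun h' => hi (h h')⟩)
    fun _ _ hd i hi => hd i fun h' => hi (h h')

variable (k : Type u) [Field k]

/-- `K`-localized persistence modules, for a simplicial complex `K` on `m` vertices, possibly with
ghost vertices. -/
structure LocalizedModule (K : LowerSet (Finset (Fin m))) where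
  /-- the `R_σ`-module `M_σ` -/
  obj (σ : Finset (Fin m)) (hσ : σ ∉ K) : LocDeg σ ⥤ ModuleCat.{u} k
  isFG (σ : Finset (Fin m)) (hσ : σ ∉ K) : IsFG k (LocDeg σ) (obj σ hσ)
  /-- the transition map `φ_{σ,τ} : M_σ ⟶ M_τ`, a degree-preserving map of `R_σ`-modules -/
  φ {σ τ : Finset (Fin m)} (hσ : σ ∉ K) (hτ : τ ∉ K) (h : σ ⊆ τ) :
    obj σ hσ ⟶ locIncl h ⋙ obj τ hτ
  φ_refl {σ : Finset (Fin m)} (hσ : σ ∉ K) (d : LocDeg σ) :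
    (φ hσ hσ (Finset.Subset.refl σ)).app d = 𝟙 ((obj σ hσ).obj d)
  φ_trans {σ τ υ : Finset (Fin m)} (hσ : σ ∉ K) (hτ : τ ∉ K) (hυ : υ ∉ K) (h : σ ⊆ τ)
    (h' : τ ⊆ υ) (d : LocDeg σ) :
    (φ hσ hτ h).app d ≫ (φ hτ hυ h').app ((locIncl h).obj d) = (φ hσ hυ (h.trans h')).app d
  /-- `φ_{σ,τ}` exhibits `M_τ` as the extension of scalars `R_τ ⊗_{R_σ} M_σ`: it is universal among
  the maps of `R_σ`-modules from `M_σ` to `R_τ`-modules -/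
  isLeftKanExtension {σ τ : Finset (Fin m)} (hσ : σ ∉ K) (hτ : τ ∉ K) (h : σ ⊆ τ) :
    (obj τ hτ).IsLeftKanExtension (φ hσ hτ h)

namespace LocalizedModule

variable {k} {K : LowerSet (Finset (Fin m))}

/-- Morphisms: families of degree-preserving maps of `R_σ`-modules that are compatible with the
transition maps. -/
@[ext]
structure Hom (M N : LocalizedModule k K) where
  app (σ : Finset (Fin m)) (hσ : σ ∉ K) : M.obj σ hσ ⟶ N.obj σ hσ
  comm {σ τ : Finset (Fin m)} (hσ : σ ∉ K) (hτ : τ ∉ K) (h : σ ⊆ τ) :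
    M.φ hσ hτ h ≫ (locIncl h).whiskerLeft (app τ hτ) = app σ hσ ≫ N.φ hσ hτ h

instance : Category (LocalizedModule k K) where
  Hom := Hom
  id M := ⟨fun σ hσ => 𝟙 (M.obj σ hσ), fun hσ hτ h => by simp⟩
  comp f g := ⟨fun σ hσ => f.app σ hσ ≫ g.app σ hσ, fun hσ hτ h => by
    rw [Functor.whiskerLeft_comp, ← Category.assoc, f.comm, Category.assoc, g.comm,
      Category.assoc]⟩
  id_comp f := by apply Hom.ext; funext; exact Category.id_comp _
  comp_id f := by apply Hom.ext; funext; exact Category.comp_id _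
  assoc f g h := by apply Hom.ext; funext; exact Category.assoc _ _ _

end LocalizedModule

/-- The localization `R_σ ⊗_R M`, as a left Kan extension along `ℕ^m → σ⁻¹ℕ^m`. -/
noncomputable abbrev locObj (σ : Finset (Fin m)) (M : (Fin m →₀ ℕ) ⥤ ModuleCat.{u} k) :
    LocDeg σ ⥤ ModuleCat.{u} k := (natIncl σ).leftKanExtension M

/-- The canonical map `M ⟶ R_σ ⊗_R M`. -/
noncomputable abbrev locUnit (σ : Finset (Fin m)) (M : (Fin m →₀ ℕ) ⥤ ModuleCat.{u} k) :
    M ⟶ natIncl σ ⋙ locObj k σ M := (natIncl σ).leftKanExtensionUnit M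


/-- The canonical map `R_σ ⊗_R M ⟶ R_τ ⊗_R M`. -/
noncomputable def locTrans {σ τ : Finset (Fin m)} (h : σ ⊆ τ)
    (M : (Fin m →₀ ℕ) ⥤ ModuleCat.{u} k) : locObj k σ M ⟶ locIncl h ⋙ locObj k τ M :=
  (locObj k σ M).descOfIsLeftKanExtension (locUnit k σ M) (locIncl h ⋙ locObj k τ M)
    { app := (locUnit k τ M).app, naturality := fun _ _ f => (locUnit k τ M).naturality f }

theorem locUnit_locTrans {σ τ : Finset (Fin m)} (h : σ ⊆ τ)
    (M : (Fin m →₀ ℕ) ⥤ ModuleCat.{u} k) (d : Fin m →₀ ℕ) :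
    (locUnit k σ M).app d ≫ (locTrans k h M).app ((natIncl σ).obj d) = (locUnit k τ M).app d :=
  (locObj k σ M).descOfIsLeftKanExtension_fac_app (locUnit k σ M) _ _ d

theorem isLeftKanExtension_locTrans {σ τ : Finset (Fin m)} (h : σ ⊆ τ)
    (M : (Fin m →₀ ℕ) ⥤ ModuleCat.{u} k) :
    (locObj k τ M).IsLeftKanExtension (locTrans k h M) := by
  refine (Functor.isLeftKanExtension_iff_postcompose (locUnit k σ M) (natIncl τ) (Iso.refl _)
    (locTrans k h M) (locUnit k τ M) ?_).2 inferInstance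
  ext1
  funext d
  refine Eq.trans ?_ (locUnit_locTrans k h M d)
  refine congrArg (fun f => (locUnit k σ M).app d ≫ f) ?_
  refine (congrArg (fun f => (locTrans k h M).app ((natIncl σ).obj d) ≫ f)
    ((Category.id_comp _).trans ((locObj k τ M).map_id _))).trans (Category.comp_id _)

theorem isFG_locObj (σ : Finset (Fin m)) (M : (Fin m →₀ ℕ) ⥤ ModuleCat.{u} k)
    (hM : IsFG k _ M) : IsFG k _ (locObj k σ M) := by
  obtain ⟨S, hS, hST⟩ := hM
  let η : (Σ d : Fin m →₀ ℕ, M.obj d) → Σ d : LocDeg σ, (locObj k σ M).obj d := fun g =>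
    ⟨(natIncl σ).obj g.1, (((locUnit k σ M).app g.1).hom g.2 : (natIncl σ ⋙ locObj k σ M).obj g.1)⟩
  let T : Set (Σ d : LocDeg σ, (locObj k σ M).obj d) := η '' S
  refine ⟨T, hS.image _, ?_⟩
  let Q : LocDeg σ ⥤ ModuleCat.{u} k :=
    { obj := fun d => ModuleCat.of k ((locObj k σ M).obj d ⧸ genSpan (locObj k σ M) T d)
      map := fun f => ModuleCat.ofHom (Submodule.mapQ _ _ ((locObj k σ M).map f).hom
        fun x hx => map_mem_genSpan _ T f hx)
      map_id := fun d => by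
        ext x
        simp
      map_comp := fun f g => by
        ext x
        simp }
  let π : locObj k σ M ⟶ Q :=
    { app := fun d => ModuleCat.ofHom (Submodule.mkQ _) }
  have hπ : π = 0 := by
    refine Functor.hom_ext_of_isLeftKanExtension _ (locUnit k σ M) _ _ ?_
    ext d x
    have hx : x ∈ genSpan M S d := by rw [hST]; trivial
    have hle : genSpan M S d ≤
        (genSpan (locObj k σ M) T ((natIncl σ).obj d)).comap ((locUnit k σ M).app d).hom := by
      refine Submodule.span_le.2 ?_
      rintro _ ⟨g, hg, h, rfl⟩
      have := map_mem_genSpan _ T ((natIncl σ).map (homOfLE h))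
        (mem_genSpan_self (locObj k σ M) T (g := η g) ⟨g, hg, rfl⟩)
      have nat := LinearMap.congr_fun (congrArg ModuleCat.Hom.hom
        ((locUnit k σ M).naturality (homOfLE h))) g.2
      exact Eq.mpr (congrArg (· ∈ genSpan (locObj k σ M) T ((natIncl σ).obj d)) nat) this
    have := hle hx
    exact (Submodule.Quotient.mk_eq_zero _).2 this
  intro d
  rw [eq_top_iff]
  intro x _
  have : (π.app d).hom x = 0 := by rw [hπ]; rfl
  exact (Submodule.Quotient.mk_eq_zero _).1 this

/-- The map `R_σ ⊗_R M ⟶ R_σ ⊗_R N` induced by `M ⟶ N`. -/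
noncomputable abbrev locMap (σ : Finset (Fin m)) {M N : (Fin m →₀ ℕ) ⥤ ModuleCat.{u} k}
    (f : M ⟶ N) : locObj k σ M ⟶ locObj k σ N :=
  (locObj k σ M).descOfIsLeftKanExtension (locUnit k σ M) (locObj k σ N) (f ≫ locUnit k σ N)

theorem locObj_hom_ext {σ : Finset (Fin m)} {M : (Fin m →₀ ℕ) ⥤ ModuleCat.{u} k}
    {G : LocDeg σ ⥤ ModuleCat.{u} k} {f g : locObj k σ M ⟶ G}
    (h : ∀ d, (locUnit k σ M).app d ≫ f.app ((natIncl σ).obj d) =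
      (locUnit k σ M).app d ≫ g.app ((natIncl σ).obj d)) : f = g := by
  refine Functor.hom_ext_of_isLeftKanExtension _ (locUnit k σ M) _ _ ?_
  ext1
  funext d
  exact h d

theorem locUnit_locMap (σ : Finset (Fin m)) {M N : (Fin m →₀ ℕ) ⥤ ModuleCat.{u} k}
    (f : M ⟶ N) (d : Fin m →₀ ℕ) :
    (locUnit k σ M).app d ≫ (locMap k σ f).app ((natIncl σ).obj d) =
      f.app d ≫ (locUnit k σ N).app d :=
  (locObj k σ M).descOfIsLeftKanExtension_fac_app (locUnit k σ M) _ _ d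

/-- The `K`-localization functor, sending `M` to the family of the `R_σ ⊗_R M`. -/
noncomputable def localizationFunctor (K : LowerSet (Finset (Fin m))) :
    FGMod k m ⥤ LocalizedModule k K where
  obj M :=
    { obj := fun σ _ => locObj k σ M.obj
      isFG := fun σ _ => isFG_locObj k σ M.obj M.property
      φ := fun _ _ h => locTrans k h M.obj
      φ_refl := fun {σ} _ d => by
        have : locTrans k (Finset.Subset.refl σ) M.obj = 𝟙 (locObj k σ M.obj) :=
          locObj_hom_ext k fun d => (locUnit_locTrans k _ M.obj d).trans (Category.comp_id _).symm
        exact congrArg (fun f : locObj k σ M.obj ⟶ locObj k σ M.obj => f.app d) this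
      φ_trans := fun {σ τ υ} _ _ _ h h' d => by
        have : locTrans k h M.obj ≫ (locIncl h).whiskerLeft (locTrans k h' M.obj) =
            locTrans k (h.trans h') M.obj := by
          refine locObj_hom_ext k fun d => ?_
          refine Eq.trans ?_ (locUnit_locTrans k _ M.obj d).symm
          refine Eq.trans ?_ (locUnit_locTrans k h' M.obj d)
          refine (Category.assoc _ _ _).symm.trans ?_
          exact congrArg (· ≫ (locTrans k h' M.obj).app ((natIncl τ).obj d))
            (locUnit_locTrans k h M.obj d)
        exact NatTrans.congr_app this d
      isLeftKanExtension := fun _ _ h => isLeftKanExtension_locTrans k h M.obj }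
  map {M N} f :=
    { app := fun σ _ => locMap k σ f.hom
      comm := fun {σ τ} _ _ h => by
        refine locObj_hom_ext k fun d => ?_
        refine Eq.trans (b := f.hom.app d ≫ (locUnit k τ N.obj).app d) ?_ ?_
        · rw [NatTrans.comp_app, ← Category.assoc, locUnit_locTrans k h M.obj d]
          exact locUnit_locMap k τ f.hom d
        · rw [NatTrans.comp_app, ← Category.assoc, locUnit_locMap k σ f.hom d, Category.assoc,
            locUnit_locTrans k h N.obj d]; rfl }
  map_id M := by
    apply LocalizedModule.Hom.ext
    funext σ _
    refine locObj_hom_ext k fun d => ?_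
    refine (locUnit_locMap k σ (𝟙 M.obj) d).trans ?_
    exact (Category.id_comp _).trans (Category.comp_id _).symm
  map_comp {M N Q} f g := by
    apply LocalizedModule.Hom.ext
    funext σ _
    refine locObj_hom_ext k fun d => ?_
    refine (locUnit_locMap k σ (f.hom ≫ g.hom) d).trans ?_
    refine Eq.trans ?_ (Category.assoc _ _ _)
    refine Eq.trans ?_ (congrArg (· ≫ (locMap k σ g.hom).app ((natIncl σ).obj d))
      (locUnit_locMap k σ f.hom d)).symm
    refine Eq.trans ?_ (Category.assoc _ _ _).symm
    refine Eq.trans ?_ (congrArg (f.hom.app d ≫ ·) (locUnit_locMap k σ g.hom d)).symm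
    exact Category.assoc _ _ _

end Localized

/-- The codimension 2 skeleton `K_m = sk_{m-3} Δ^{m-1}` of the simplex on `m` vertices. -/
def codimTwoSkeleton (m : ℕ) : LowerSet (Finset (Fin m)) where
  carrier := {σ | σ.card + 2 ≤ m}
  lower' _ _ h hσ := (Nat.add_le_add_right (Finset.card_le_card h) 2).trans hσ

end PersistenceModule

open PersistenceModule

/-!
The theorem rests on the adjunction between localization and sections. The sections of an object
of `D(K_2)` form the graded module `M_{1} ×_{M_{1,2}} M_{2}`, and taking sections is right adjoint
to localization (`localizationAdjunction`). The counit is invertible: an element of `M_{1}`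
becomes, after multiplication by a power of `s`, part of a compatible pair, since its image in
`M_{1,2}` comes from `M_{2}` up to a power of `s`. The unit is an isomorphism up to finite
modules: its kernel and cokernel are killed by powers of both `s` and `t` on each of finitely many
generators, hence live in finitely many degrees. So localization is a reflective localization at
exactly the maps that become invertible in the Serre quotient
(`isLocalization_localizationFunctor`), which is the equivalence.

Consequently every object of the quotient is represented by a saturated module, one that is its
own module of sections, and maps to a saturated module are the same before and after passing to
the quotient (`bijective_quotFunctor_map`). Strips and quadrants are saturated, and are interval
modules: one-dimensional in the degrees of an interval with a least element, and zero elsewhere.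
An endomorphism of such a module is determined by the scalar by which it acts on the generator,
and an endomorphism that factors through the interval module on a different interval vanishes
(`comp_eq_zero_of_ne`). The first fact gives indecomposability, because the only idempotents are
the trivial ones. Both facts together give uniqueness: for every label, an isomorphism of two
direct sums restricts to an invertible matrix over `k` between the summands with that label
(`exists_equiv_of_biproduct_iso`).

For existence, a nonzero saturated module `M` always has a strip or a quadrant as a direct summand
(`IsSaturated.exists_retract`). If some nonzero element is annihilated by a power of `s`, take
such an element in the least possible degree; saturation moves it down to `t`-degree zero, where
it generates a strip, and a linear form on `M[t⁻¹]` that takes the value one on its last nonzero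
multiple and vanishes on what comes from smaller degrees defines the projection. The same works
with `s` and `t` exchanged. If there is no torsion, `M` embeds into the constant vector space
`M[s⁻¹, t⁻¹]`, and a nonzero element of lexicographically least degree generates a quadrant that
splits off in the same way. The complement is again saturated, and the dimensions in the degrees
of a set of generators drop (`IsSaturated.exists_iso_biproduct`).
-/

namespace PersistenceModule

/-! ### Elements of graded modules -/

section Elements

variable {k : Type u} [Field k] {P P' : Type} [Preorder P] [Preorder P']

/-- Multiplication by the monomial of degree `e - d` on a graded module. -/
def act (M : P ⥤ ModuleCat.{u} k) {d e : P} (h : d ≤ e) : M.obj d →ₗ[k] M.obj e :=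
  (M.map (homOfLE h)).hom

theorem map_eq_act (M : P ⥤ ModuleCat.{u} k) {d e : P} (f : d ⟶ e) :
    (M.map f).hom = act M (leOfHom f) := rfl

@[simp]
theorem act_self (M : P ⥤ ModuleCat.{u} k) {d : P} (h : d ≤ d) (x : M.obj d) : act M h x = x :=
  LinearMap.congr_fun (congrArg ModuleCat.Hom.hom (M.map_id d)) x

@[simp]
theorem act_act (M : P ⥤ ModuleCat.{u} k) {d e f : P} (h : d ≤ e) (h' : e ≤ f) (x : M.obj d) :
    act M h' (act M h x) = act M (h.trans h') x :=
  (LinearMap.congr_fun (congrArg ModuleCat.Hom.hom (M.map_comp (homOfLE h) (homOfLE h'))) x).symm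

theorem act_injective_of_le (M : P ⥤ ModuleCat.{u} k) {d e : P} (h : d ≤ e) (h' : e ≤ d) :
    Function.Injective (act M h) := fun x y hxy => by
  have := congrArg (act M h') hxy
  simpa using this

/-- The degree `d` part of a map of graded modules. -/
def ap {M N : P ⥤ ModuleCat.{u} k} (f : M ⟶ N) (d : P) : M.obj d →ₗ[k] N.obj d := (f.app d).hom

theorem ap_act {M N : P ⥤ ModuleCat.{u} k} (f : M ⟶ N) {d e : P} (h : d ≤ e) (x : M.obj d) :
    ap f e (act M h x) = act N h (ap f d x) :=
  LinearMap.congr_fun (congrArg ModuleCat.Hom.hom (f.naturality (homOfLE h))) x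

@[simp]
theorem ap_comp {M N Q : P ⥤ ModuleCat.{u} k} (f : M ⟶ N) (g : N ⟶ Q) (d : P) (x : M.obj d) :
    ap (f ≫ g) d x = ap g d (ap f d x) := rfl

@[simp]
theorem ap_id {M : P ⥤ ModuleCat.{u} k} (d : P) (x : M.obj d) : ap (𝟙 M) d x = x := rfl

theorem hom_ext_ap {M N : P ⥤ ModuleCat.{u} k} {f g : M ⟶ N} (h : ∀ d x, ap f d x = ap g d x) :
    f = g := by
  ext d x
  exact h d x

theorem isIso_of_bijective {M N : P ⥤ ModuleCat.{u} k} (f : M ⟶ N)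
    (h : ∀ d, Function.Bijective (ap f d)) : IsIso f := by
  have (d : P) : IsIso (f.app d) := (ConcreteCategory.isIso_iff_bijective (f.app d)).2 (h d)
  exact NatIso.isIso_of_isIso_app f

/-- A map of graded modules from a family of linear maps commuting with multiplication by
monomials. -/
def homOfAct {M N : P ⥤ ModuleCat.{u} k} (f : ∀ d, M.obj d →ₗ[k] N.obj d)
    (hf : ∀ {d e : P} (h : d ≤ e) (x : M.obj d), f e (act M h x) = act N h (f d x)) : M ⟶ N where
  app d := ModuleCat.ofHom (f d)
  naturality d e φ := by
    ext x
    exact hf (leOfHom φ) x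

/-- The degree `p` part of a map from a `P`-graded module to the restriction of a `P'`-graded
module. -/
def toLoc {L : P ⥤ P'} {M : P ⥤ ModuleCat.{u} k} {F : P' ⥤ ModuleCat.{u} k} (α : M ⟶ L ⋙ F)
    (p : P) : M.obj p →ₗ[k] F.obj (L.obj p) := (α.app p).hom

theorem toLoc_act {L : P ⥤ P'} {M : P ⥤ ModuleCat.{u} k} {F : P' ⥤ ModuleCat.{u} k}
    (α : M ⟶ L ⋙ F) {p q : P} (h : p ≤ q) (x : M.obj p) :
    toLoc α q (act M h x) = act F (L.monotone h) (toLoc α p x) :=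
  LinearMap.congr_fun (congrArg ModuleCat.Hom.hom (α.naturality (homOfLE h))) x

/-- The degrees of `P` that map below a given degree of `P'` form a nonempty directed set. -/
def IsDirectedOver (L : P ⥤ P') : Prop :=
  ∀ v, (∃ p, L.obj p ≤ v) ∧
    ∀ p q, L.obj p ≤ v → L.obj q ≤ v → ∃ r, p ≤ r ∧ q ≤ r ∧ L.obj r ≤ v

theorem IsDirectedOver.isFiltered {L : P ⥤ P'} (hL : IsDirectedOver L) (v : P') :
    IsFiltered (CostructuredArrow L v) where
  nonempty := by
    obtain ⟨p, hp⟩ := (hL v).1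
    exact ⟨CostructuredArrow.mk (homOfLE hp)⟩
  cocone_objs X Y := by
    obtain ⟨r, h₁, h₂, hr⟩ := (hL v).2 _ _ (leOfHom X.hom) (leOfHom Y.hom)
    exact ⟨CostructuredArrow.mk (homOfLE hr), CostructuredArrow.homMk (homOfLE h₁),
      CostructuredArrow.homMk (homOfLE h₂), trivial⟩
  cocone_maps X Y f g := ⟨Y, 𝟙 _, by
    ext
    exact Subsingleton.elim _ _⟩

section Criterion

instance preservesFilteredColimits_forget_moduleCat :
    PreservesFilteredColimitsOfSize.{0, 0} (forget (ModuleCat.{u} k)) :=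
  preservesFilteredColimitsOfSize_shrink.{0, u, 0, u} _

variable {L : P ⥤ P'} {M : P ⥤ ModuleCat.{u} k} {F : P' ⥤ ModuleCat.{u} k} (α : M ⟶ L ⋙ F)

theorem exists_toLoc_eq (hL : IsDirectedOver L) [F.IsLeftKanExtension α] (v : P') (y : F.obj v) :
    ∃ (p : P) (h : L.obj p ≤ v) (x : M.obj p), act F h (toLoc α p x) = y := by
  have := hL.isFiltered v
  obtain ⟨j, x, hx⟩ := Concrete.isColimit_exists_rep _
    (Functor.isPointwiseLeftKanExtensionOfIsLeftKanExtension F α v) y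
  exact ⟨j.left, leOfHom j.hom, x, hx⟩

theorem exists_act_eq_zero (hL : IsDirectedOver L) [F.IsLeftKanExtension α] {p : P} {v : P'}
    (h : L.obj p ≤ v) (x : M.obj p) (hx : act F h (toLoc α p x) = 0) :
    ∃ (q : P) (hpq : p ≤ q), L.obj q ≤ v ∧ act M hpq x = 0 := by
  have := hL.isFiltered v
  have hc := Functor.isPointwiseLeftKanExtensionOfIsLeftKanExtension F α v
  let j : CostructuredArrow L v := CostructuredArrow.mk (homOfLE h)
  obtain ⟨l, f, g, hfg⟩ := Concrete.isColimit_exists_of_rep_eq (i := j) (j := j) _ hc x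
    (0 : M.obj p) (hx.trans (map_zero _).symm)
  refine ⟨l.left, leOfHom f.left, leOfHom l.hom, hfg.trans (map_zero _)⟩

/-- A graded module is the extension of scalars of `M` if each of its elements comes from `M`, and
each element of `M` that maps to zero is already annihilated by a monomial that becomes
invertible. -/
theorem isLeftKanExtension_of_elements (hL : IsDirectedOver L)
    (hsurj : ∀ v (y : F.obj v), ∃ (p : P) (h : L.obj p ≤ v) (x : M.obj p),
      act F h (toLoc α p x) = y)
    (hinj : ∀ {p : P} {v : P'} (h : L.obj p ≤ v) (x : M.obj p), act F h (toLoc α p x) = 0 →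
      ∃ (q : P) (hpq : p ≤ q), L.obj q ≤ v ∧ act M hpq x = 0) :
    F.IsLeftKanExtension α := by
  refine Functor.LeftExtension.IsPointwiseLeftKanExtension.isLeftKanExtension
    (E := Functor.LeftExtension.mk F α) fun v => ?_
  have := hL.isFiltered v
  let c := (Functor.LeftExtension.mk F α).coconeAt v
  suffices h : IsIso (colimit.desc _ c) from
    have : IsIso ((colimit.isColimit (CostructuredArrow.proj L v ⋙ M)).desc c) := h
    IsColimit.ofPointIso (colimit.isColimit _)
  refine (ConcreteCategory.isIso_iff_bijective _).2 ?_
  have hι (j : CostructuredArrow L v) (x : M.obj j.left) :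
      (colimit.desc _ c).hom ((colimit.ι (CostructuredArrow.proj L v ⋙ M) j).hom x) =
        act F (leOfHom j.hom) (toLoc α j.left x) :=
    LinearMap.congr_fun (congrArg ModuleCat.Hom.hom (colimit.ι_desc c j)) x
  refine ⟨?_, fun y => ?_⟩
  · change Function.Injective (colimit.desc _ c).hom
    rw [injective_iff_map_eq_zero]
    intro z hz
    obtain ⟨j, x, rfl⟩ := Concrete.colimit_exists_rep _ z
    obtain ⟨q, hpq, hq, hx⟩ := hinj _ x ((hι j x).symm.trans hz)
    let l : CostructuredArrow L v := CostructuredArrow.mk (homOfLE hq)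
    let f : j ⟶ l := CostructuredArrow.homMk (homOfLE hpq)
    have hw := LinearMap.congr_fun (congrArg ModuleCat.Hom.hom
      (colimit.w (CostructuredArrow.proj L v ⋙ M) f)) x
    refine hw.symm.trans ?_
    exact (congrArg (colimit.ι (CostructuredArrow.proj L v ⋙ M) l).hom hx).trans (map_zero _)
  · obtain ⟨p, h, x, hx⟩ := hsurj v y
    let j : CostructuredArrow L v := CostructuredArrow.mk (homOfLE h)
    exact ⟨(colimit.ι (CostructuredArrow.proj L v ⋙ M) j).hom x, (hι j x).trans hx⟩

end Criterion

end Elements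

section Localization

variable {m : ℕ}

theorem natIncl_le_iff {σ : Finset (Fin m)} {d : Fin m →₀ ℕ} {v : LocDeg σ} :
    (natIncl σ).obj d ≤ v ↔ ∀ i ∉ σ, (d i : ℤ) ≤ v.val i := Iff.rfl

theorem le_natIncl_iff {σ : Finset (Fin m)} {d : Fin m →₀ ℕ} {v : LocDeg σ} :
    v ≤ (natIncl σ).obj d ↔ ∀ i ∉ σ, v.val i ≤ (d i : ℤ) := Iff.rfl

theorem natIncl_le_natIncl_iff {σ : Finset (Fin m)} {d e : Fin m →₀ ℕ} :
    (natIncl σ).obj d ≤ (natIncl σ).obj e ↔ ∀ i ∉ σ, d i ≤ e i := by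
  simp only [natIncl_le_iff]
  exact forall₂_congr fun i _ => Int.ofNat_le

theorem isDirectedOver_natIncl (σ : Finset (Fin m)) : IsDirectedOver (natIncl σ) := fun v =>
  ⟨⟨0, fun i hi => v.nonneg i hi⟩, fun p q hp hq => ⟨p ⊔ q, le_sup_left, le_sup_right,
    fun i hi => by
      change ((max (p i) (q i) : ℕ) : ℤ) ≤ _
      rw [Nat.cast_max]
      exact max_le (hp i hi) (hq i hi)⟩⟩

theorem isDirectedOver_locIncl {σ τ : Finset (Fin m)} (h : σ ⊆ τ) :
    IsDirectedOver (locIncl h) := fun v =>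
  ⟨⟨⟨fun i => max (v.val i) 0, fun _ _ => le_max_right _ _⟩,
    fun i hi => max_le le_rfl (v.nonneg i hi)⟩, fun p q hp hq =>
    ⟨⟨fun i => max (p.val i) (q.val i), fun i hi => le_max_of_le_left (p.nonneg i hi)⟩,
      fun _ _ => le_max_left _ _, fun _ _ => le_max_right _ _,
      fun i hi => max_le (hp i hi) (hq i hi)⟩⟩

/-- Every degree of `σ⁻¹ℕ^m` is isomorphic, in the preorder, to one that comes from `ℕ^m`, which
can be chosen above a given one. -/
theorem exists_natIncl_equiv {σ : Finset (Fin m)} {d : Fin m →₀ ℕ} {v : LocDeg σ}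
    (h : (natIncl σ).obj d ≤ v) :
    ∃ e, d ≤ e ∧ (natIncl σ).obj e ≤ v ∧ v ≤ (natIncl σ).obj e := by
  refine ⟨Finsupp.equivFunOnFinite.symm fun i => max (d i) (v.val i).toNat,
    fun i => le_max_left _ _, natIncl_le_iff.2 fun i hi => ?_, le_natIncl_iff.2 fun i hi => ?_⟩
  · have h1 := natIncl_le_iff.1 h i hi
    have h2 := v.nonneg i hi
    simp only [Finsupp.equivFunOnFinite_symm_apply_apply]
    omega
  · simp only [Finsupp.equivFunOnFinite_symm_apply_apply]
    omega

variable {k : Type u} [Field k]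

/-- For extension of scalars along `k[t_1, …, t_m] → R_σ`, it is enough to check the elements in
degrees that come from `ℕ^m`. -/
theorem isLeftKanExtension_natIncl {σ : Finset (Fin m)} {M : (Fin m →₀ ℕ) ⥤ ModuleCat.{u} k}
    {F : LocDeg σ ⥤ ModuleCat.{u} k} (α : M ⟶ natIncl σ ⋙ F)
    (hsurj : ∀ d (y : F.obj ((natIncl σ).obj d)), ∃ (e : Fin m →₀ ℕ)
      (h : (natIncl σ).obj e ≤ (natIncl σ).obj d) (x : M.obj e), act F h (toLoc α e x) = y)
    (hinj : ∀ {d : Fin m →₀ ℕ} (x : M.obj d), toLoc α d x = 0 →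
      ∃ (e : Fin m →₀ ℕ) (h : d ≤ e), (natIncl σ).obj e ≤ (natIncl σ).obj d ∧ act M h x = 0) :
    F.IsLeftKanExtension α := by
  refine isLeftKanExtension_of_elements α (isDirectedOver_natIncl σ) (fun v y => ?_) ?_
  · obtain ⟨d, -, hd, hd'⟩ := exists_natIncl_equiv (((isDirectedOver_natIncl σ) v).1.choose_spec)
    obtain ⟨e, h, x, hx⟩ := hsurj d (act F hd' y)
    refine ⟨e, h.trans hd, x, ?_⟩
    rw [← act_act F h hd, hx]
    simp
  · intro d v h x hx
    obtain ⟨e, hde, he, he'⟩ := exists_natIncl_equiv h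
    obtain ⟨f, hef, hf, hx'⟩ := hinj (act M hde x) (by
      rw [toLoc_act]
      apply act_injective_of_le F he he'
      rw [act_act, map_zero]
      exact hx)
    exact ⟨f, hde.trans hef, hf.trans he, by rw [← act_act M hde hef, hx']⟩

/-- Restriction of scalars along `k[t_1, …, t_m] → R_σ`, cut down to the degrees in `ℕ^m`,
preserves finite generation. -/
theorem isFG_natIncl_comp {σ : Finset (Fin m)} {F : LocDeg σ ⥤ ModuleCat.{u} k}
    (hF : IsFG k _ F) : IsFG k _ (natIncl σ ⋙ F) := by
  classical
  obtain ⟨S, hS, hST⟩ := hF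
  let ν : LocDeg σ → (Fin m →₀ ℕ) := fun v =>
    Finsupp.equivFunOnFinite.symm fun i => if i ∈ σ then 0 else (v.val i).toNat
  have hν : ∀ v, v ≤ (natIncl σ).obj (ν v) := fun v => le_natIncl_iff.2 fun i hi => by
    simp only [ν, Finsupp.equivFunOnFinite_symm_apply_apply, if_neg hi]
    omega
  let η : (Σ v : LocDeg σ, F.obj v) → Σ d : Fin m →₀ ℕ, (natIncl σ ⋙ F).obj d :=
    fun g => ⟨ν g.1, (act F (hν g.1) g.2 : F.obj _)⟩
  refine ⟨η '' S, hS.image _, fun d => ?_⟩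
  rw [eq_top_iff]
  intro z _
  have hz : z ∈ genSpan F S ((natIncl σ).obj d) := by
    rw [hST]
    trivial
  refine Submodule.span_le (p := genSpan (natIncl σ ⋙ F) (η '' S) d).2 ?_ hz
  rintro _ ⟨g, hg, h, rfl⟩
  have hd : ν g.1 ≤ d := fun i => by
    simp only [ν, Finsupp.equivFunOnFinite_symm_apply_apply]
    split_ifs with hi
    · exact Nat.zero_le _
    · have h1 : g.1.val i ≤ (d i : ℤ) := h i hi
      omega
  exact Submodule.subset_span ⟨η g, ⟨g, hg, rfl⟩, hd,
    (act_act F (hν g.1) ((natIncl σ).monotone hd) g.2).symm⟩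

end Localization

/-! ### Isomorphisms modulo finite modules -/

section IsoModSerre

variable {k : Type u} [Field k] {m : ℕ}

/-- If each of finitely many generators is moved into a graded submodule `R` by a power of every
variable, then `R` contains the module they generate in all but finitely many degrees. -/
theorem finite_not_le_of_generators {M : (Fin m →₀ ℕ) ⥤ ModuleCat.{u} k}
    {T : Set (Σ d, M.obj d)} (hT : T.Finite) (R : ∀ d, Submodule k (M.obj d))
    (hR : ∀ {d e : Fin m →₀ ℕ} (h : d ≤ e) (x : M.obj d), x ∈ R d → act M h x ∈ R e)
    (hTR : ∀ g ∈ T, ∀ i, ∃ (e : Fin m →₀ ℕ) (h : g.1 ≤ e),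
      (natIncl {i}).obj e ≤ (natIncl {i}).obj g.1 ∧ act M h g.2 ∈ R e) :
    {d | ¬ genSpan M T d ≤ R d}.Finite := by
  choose! e hle hnat hmem using hTR
  refine (hT.biUnion fun g _ => Set.finite_Icc (0 : Fin m →₀ ℕ)
    (Finsupp.equivFunOnFinite.symm fun i => e g i i)).subset fun d hd => ?_
  obtain ⟨y, hy, hyR⟩ : ∃ y, (∃ g ∈ T, ∃ h : g.1 ≤ d, y = act M h g.2) ∧ y ∉ R d := by
    by_contra! hcon
    exact hd (Submodule.span_le.2 hcon)
  obtain ⟨g, hg, h, rfl⟩ := hy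
  refine Set.mem_biUnion hg ⟨zero_le, fun i => ?_⟩
  rw [Finsupp.equivFunOnFinite_symm_apply_apply]
  by_contra! hlt
  have hed : e g i ≤ d := fun j => by
    by_cases hj : j = i
    · subst hj
      exact hlt.le
    · exact (natIncl_le_natIncl_iff.1 (hnat g hg i) j (by simpa using hj)).trans (h j)
  apply hyR
  rw [← act_act M (hle g hg i) hed]
  exact hR _ _ (hmem g hg i)

/-- The part of degree `d` of a finitely generated graded module, as a functor. -/
abbrev degreePart (k : Type u) [Field k] {m : ℕ} (d : Fin m →₀ ℕ) : FGMod k m ⥤ ModuleCat.{u} k :=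
  (IsFG k (Fin m →₀ ℕ)).ι ⋙ (evaluation _ _).obj d

instance preservesFiniteLimits_degreePart (d : Fin m →₀ ℕ) :
    PreservesFiniteLimits (degreePart k d) :=
  have : PreservesFiniteLimits (IsFG k (Fin m →₀ ℕ)).ι :=
    have := (IsFG k (Fin m →₀ ℕ)).preservesKernels_ι
    Functor.preservesFiniteLimits_of_preservesKernels _
  comp_preservesFiniteLimits _ _

instance preservesFiniteColimits_degreePart (d : Fin m →₀ ℕ) :
    PreservesFiniteColimits (degreePart k d) :=
  have : PreservesFiniteColimits (IsFG k (Fin m →₀ ℕ)).ι :=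
    have := (IsFG k (Fin m →₀ ℕ)).preservesCokernels_ι
    Functor.preservesFiniteColimits_of_preservesCokernels _
  comp_preservesFiniteColimits _ _

theorem nontrivial_kernel_iff {M N : FGMod k m} (f : M ⟶ N) (d : Fin m →₀ ℕ) :
    Nontrivial ((kernel f).obj.obj d) ↔ ¬ Function.Injective (ap f.hom d) := by
  rw [← not_iff_not, not_not, not_nontrivial_iff_subsingleton]
  refine (ModuleCat.isZero_iff_subsingleton (M := (degreePart k d).obj (kernel f))).symm.trans ?_
  refine ((PreservesKernel.iso (degreePart k d) f).isZero_iff).trans ?_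
  refine (Preadditive.mono_iff_isZero_kernel _).symm.trans ?_
  exact ModuleCat.mono_iff_injective _

theorem nontrivial_cokernel_iff {M N : FGMod k m} (f : M ⟶ N) (d : Fin m →₀ ℕ) :
    Nontrivial ((cokernel f).obj.obj d) ↔ ¬ Function.Surjective (ap f.hom d) := by
  rw [← not_iff_not, not_not, not_nontrivial_iff_subsingleton]
  refine (ModuleCat.isZero_iff_subsingleton (M := (degreePart k d).obj (cokernel f))).symm.trans ?_
  refine ((PreservesCokernel.iso (degreePart k d) f).isZero_iff).trans ?_
  refine (Preadditive.epi_iff_isZero_cokernel _).symm.trans ?_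
  exact ModuleCat.epi_iff_surjective _

/-- A map becomes invertible in the Serre quotient if and only if it is bijective in all but
finitely many degrees. -/
theorem isoModSerre_iff_finite {M N : FGMod k m} (f : M ⟶ N) :
    (finiteModules k m).isoModSerre f ↔
      {d | ¬ Function.Injective (ap f.hom d)}.Finite ∧
        {d | ¬ Function.Surjective (ap f.hom d)}.Finite := by
  have h₁ : {d | ¬ Function.Injective (ap f.hom d)} = {d | Nontrivial ((kernel f).obj.obj d)} :=
    Set.ext fun d => (nontrivial_kernel_iff f d).symm
  have h₂ : {d | ¬ Function.Surjective (ap f.hom d)} = {d | Nontrivial ((cokernel f).obj.obj d)} :=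
    Set.ext fun d => (nontrivial_cokernel_iff f d).symm
  rw [h₁, h₂]
  exact Iff.rfl

/-- A map is an isomorphism modulo finite modules if each element of its kernel is annihilated by a
power of every variable, and each element of its target is moved into the image by a power of every
variable. -/
theorem isoModSerre_of_torsion {M N : FGMod k m} (f : M ⟶ N)
    (hinj : ∀ (d : Fin m →₀ ℕ) (x : M.obj.obj d), ap f.hom d x = 0 → ∀ i,
      ∃ (e : Fin m →₀ ℕ) (h : d ≤ e), (natIncl {i}).obj e ≤ (natIncl {i}).obj d ∧
        act M.obj h x = 0)
    (hsurj : ∀ (d : Fin m →₀ ℕ) (y : N.obj.obj d) (i), ∃ (e : Fin m →₀ ℕ) (h : d ≤ e),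
      (natIncl {i}).obj e ≤ (natIncl {i}).obj d ∧ ∃ x, ap f.hom e x = act N.obj h y) :
    (finiteModules k m).isoModSerre f := by
  refine (isoModSerre_iff_finite f).2 ⟨?_, ?_⟩
  · obtain ⟨S, hS, hST⟩ := M.property
    obtain ⟨T, hT, hTK⟩ := exists_finite_generators_of_le_genSpan M.obj S hS
      (fun d => LinearMap.ker (ap f.hom d))
      (fun φ x hx => by
        rw [LinearMap.mem_ker] at hx ⊢
        rw [map_eq_act, ap_act, hx, map_zero])
      (fun d => by rw [hST]; exact le_top)
    refine (finite_not_le_of_generators hT (fun d => ⊥) (fun h x hx => ?_) fun g hg i => ?_).subset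
      fun d hd => ?_
    · rw [Submodule.mem_bot] at hx ⊢
      rw [hx, map_zero]
    · have hg' := mem_genSpan_self M.obj T hg
      rw [hTK] at hg'
      exact hinj g.1 g.2 hg' i
    · intro hle
      rw [hTK] at hle
      exact hd (LinearMap.ker_eq_bot.1 (le_bot_iff.1 hle))
  · obtain ⟨T, hT, hTK⟩ := N.property
    refine (finite_not_le_of_generators hT (fun d => LinearMap.range (ap f.hom d)) ?_
      fun g _ i => hsurj g.1 g.2 i).subset fun d hd => ?_
    · rintro d e h _ ⟨x, rfl⟩
      exact ⟨act M.obj h x, ap_act f.hom h x⟩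
    · intro hle
      rw [hTK, top_le_iff] at hle
      exact hd (LinearMap.range_eq_top.1 hle)

theorem exists_le_notMem_of_finite {S : Set (Fin m →₀ ℕ)} (hS : S.Finite) (d : Fin m →₀ ℕ)
    {σ : Finset (Fin m)} (hσ : σ.Nonempty) :
    ∃ e, d ≤ e ∧ (natIncl σ).obj e ≤ (natIncl σ).obj d ∧ e ∉ S := by
  obtain ⟨i, hi⟩ := hσ
  have hinf : (Set.range fun n : ℕ => d + Finsupp.single i n).Infinite :=
    Set.infinite_range_of_injective fun a b hab =>
      Finsupp.single_injective i (add_left_cancel hab)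
  obtain ⟨_, ⟨n, rfl⟩, he⟩ := hinf.exists_notMem_finite hS
  refine ⟨_, le_self_add, natIncl_le_natIncl_iff.2 fun j hj => ?_, he⟩
  have : i ≠ j := fun h => hj (h ▸ hi)
  simp [this]

/-- Localization at a nonempty set of variables inverts the isomorphisms modulo finite modules. -/
theorem isIso_locMap {M N : FGMod k m} (f : M ⟶ N) (hf : (finiteModules k m).isoModSerre f)
    {σ : Finset (Fin m)} (hσ : σ.Nonempty) : IsIso (locMap k σ f.hom) := by
  obtain ⟨hinj, hsurj⟩ := (isoModSerre_iff_finite f).1 hf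
  refine (Functor.isLeftKanExtension_iff_isIso (locMap k σ f.hom) (locUnit k σ M.obj)
    (f.hom ≫ locUnit k σ N.obj) ?_).1 ?_
  · ext1
    funext d
    exact locUnit_locMap k σ f.hom d
  · refine isLeftKanExtension_natIncl _ (fun d y => ?_) fun {d} x hx => ?_
    · obtain ⟨e, he, x, rfl⟩ := exists_toLoc_eq (locUnit k σ N.obj) (isDirectedOver_natIncl σ) _ y
      obtain ⟨e', hee', he', hmem⟩ := exists_le_notMem_of_finite hsurj e hσ
      obtain ⟨z, hz⟩ := not_not.1 hmem (act N.obj hee' x)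
      refine ⟨e', he'.trans he, z, ?_⟩
      have h1 : toLoc (f.hom ≫ locUnit k σ N.obj) e' z =
        toLoc (locUnit k σ N.obj) e' (ap f.hom e' z) := rfl
      rw [h1, hz, toLoc_act, act_act]
    · have h1 : toLoc (locUnit k σ N.obj) d (ap f.hom d x) = 0 := hx
      obtain ⟨e, hde, he, hx'⟩ := exists_act_eq_zero (locUnit k σ N.obj)
        (isDirectedOver_natIncl σ) le_rfl _ ((act_self _ _ _).trans h1)
      obtain ⟨e', hee', he', hmem⟩ := exists_le_notMem_of_finite hinj e hσ
      refine ⟨e', hde.trans hee', he'.trans he, ?_⟩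
      apply not_not.1 hmem
      rw [map_zero, ap_act, ← act_act N.obj hde hee', hx', map_zero]

end IsoModSerre

/-! ### Sections of a localized module -/

section Sections

variable {k : Type u} [Field k]

theorem LocalizedModule.isIso_of_app {m : ℕ} {K : LowerSet (Finset (Fin m))}
    {M N : LocalizedModule k K} (f : M ⟶ N) (h : ∀ σ hσ, IsIso (LocalizedModule.Hom.app f σ hσ)) :
    IsIso f := by
  let g : N ⟶ M :=
    { app := fun σ hσ => inv (LocalizedModule.Hom.app f σ hσ)
      comm := fun {σ τ} hσ hτ hστ => by
        rw [← cancel_epi (LocalizedModule.Hom.app f σ hσ), IsIso.hom_inv_id_assoc,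
          ← Category.assoc, ← LocalizedModule.Hom.comm f, Category.assoc,
          ← Functor.whiskerLeft_comp, IsIso.hom_inv_id]
        exact Category.comp_id _ }
  refine ⟨g, ?_, ?_⟩
  · apply LocalizedModule.Hom.ext
    funext σ hσ
    exact IsIso.hom_inv_id (LocalizedModule.Hom.app f σ hσ)
  · apply LocalizedModule.Hom.ext
    funext σ hσ
    exact IsIso.inv_hom_id (LocalizedModule.Hom.app f σ hσ)

theorem notMem_codimTwoSkeleton_iff {σ : Finset (Fin 2)} :
    σ ∉ codimTwoSkeleton 2 ↔ σ.Nonempty := by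
  change ¬ (σ.card + 2 ≤ 2) ↔ _
  rw [← Finset.card_pos]
  omega

theorem singleton_notMem (i : Fin 2) : ({i} : Finset (Fin 2)) ∉ codimTwoSkeleton 2 :=
  notMem_codimTwoSkeleton_iff.2 (Finset.singleton_nonempty i)

theorem univ_notMem : (Finset.univ : Finset (Fin 2)) ∉ codimTwoSkeleton 2 :=
  notMem_codimTwoSkeleton_iff.2 Finset.univ_nonempty

theorem eq_of_ne_of_ne {i j l : Fin 2} (hij : i ≠ j) (hl : l ≠ i) : l = j := by
  omega

variable (N : LocalizedModule k (codimTwoSkeleton 2))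

/-- The module `M_{i}` of a localized module for `m = 2`, restricted to `ℕ²`. -/
abbrev chart (i : Fin 2) : (Fin 2 →₀ ℕ) ⥤ ModuleCat.{u} k :=
  natIncl {i} ⋙ N.obj {i} (singleton_notMem i)

/-- The map `M_{i} ⟶ M_{1,2}` on elements of a degree in `ℕ²`. -/
def restr (i : Fin 2) (d : Fin 2 →₀ ℕ) :
    (chart N i).obj d →ₗ[k] (N.obj Finset.univ univ_notMem).obj ((natIncl Finset.univ).obj d) :=
  toLoc (N.φ (singleton_notMem i) univ_notMem (Finset.subset_univ _)) ((natIncl {i}).obj d)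

theorem restr_act (i : Fin 2) {d e : Fin 2 →₀ ℕ} (h : d ≤ e) (y : (chart N i).obj d) :
    restr N i e (act (chart N i) h y) =
      act (N.obj Finset.univ univ_notMem) ((natIncl Finset.univ).monotone h) (restr N i d y) :=
  toLoc_act (N.φ (singleton_notMem i) univ_notMem (Finset.subset_univ _))
    ((natIncl {i}).monotone h) y

/-- The pairs of elements of degree `d` of `M_{1}` and `M_{2}` with the same image in `M_{1,2}`. -/
def sectionPart (d : Fin 2 →₀ ℕ) : Submodule k (∀ i, (chart N i).obj d) where
  carrier := {p | ∀ i j, restr N i d (p i) = restr N j d (p j)}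
  add_mem' hp hq i j := by
    rw [Pi.add_apply, Pi.add_apply, map_add, map_add, hp i j, hq i j]
  zero_mem' i j := by
    rw [Pi.zero_apply, Pi.zero_apply, map_zero, map_zero]
  smul_mem' c p hp i j := by
    rw [Pi.smul_apply, Pi.smul_apply, map_smul, map_smul, hp i j]

/-- The graded module of sections `M_{1} ×_{M_{1,2}} M_{2}` of a localized module. -/
def sectionFunctor : (Fin 2 →₀ ℕ) ⥤ ModuleCat.{u} k where
  obj d := ModuleCat.of k (sectionPart N d)
  map {d e} f := ModuleCat.ofHom (LinearMap.restrict
    (LinearMap.pi fun i => act (chart N i) (leOfHom f) ∘ₗ LinearMap.proj i)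
    fun p hp i j => by
      simp only [LinearMap.pi_apply, LinearMap.comp_apply, LinearMap.proj_apply, restr_act]
      rw [hp i j])
  map_id d := by
    ext p : 3
    funext i
    exact act_self _ _ _
  map_comp f g := by
    ext p : 3
    funext i
    exact (act_act _ _ _ _).symm

/-- The projection from the sections to `M_{i}`. -/
def sectionProj (i : Fin 2) : sectionFunctor N ⟶ chart N i :=
  homOfAct (fun d => LinearMap.proj i ∘ₗ (sectionPart N d).subtype) fun _ _ => rfl

variable {N}

theorem restr_sectionProj {d : Fin 2 →₀ ℕ} (p : (sectionFunctor N).obj d) (i j : Fin 2) :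
    restr N i d (ap (sectionProj N i) d p) = restr N j d (ap (sectionProj N j) d p) :=
  Subtype.prop (p : sectionPart N d) i j

theorem section_ext {i j : Fin 2} (hij : i ≠ j) {d : Fin 2 →₀ ℕ} {p q : (sectionFunctor N).obj d}
    (hi : ap (sectionProj N i) d p = ap (sectionProj N i) d q)
    (hj : ap (sectionProj N j) d p = ap (sectionProj N j) d q) : p = q := by
  refine Subtype.ext (funext fun l => ?_)
  by_cases hl : l = i
  · subst hl
    exact hi
  · obtain rfl := eq_of_ne_of_ne hij hl
    exact hj

theorem exists_section {i j : Fin 2} (hij : i ≠ j) {d : Fin 2 →₀ ℕ} (y : (chart N i).obj d)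
    (z : (chart N j).obj d) (h : restr N i d y = restr N j d z) :
    ∃ p : (sectionFunctor N).obj d,
      ap (sectionProj N i) d p = y ∧ ap (sectionProj N j) d p = z := by
  classical
  let p : ∀ l, (chart N l).obj d := Function.update (Function.update 0 i y) j z
  have hi : p i = y := by simp [p, hij]
  have hj : p j = z := by simp [p]
  have hp : ∀ l, restr N l d (p l) = restr N i d y := fun l => by
    by_cases hl : l = i
    · subst hl
      rw [hi]
    · obtain rfl := eq_of_ne_of_ne hij hl
      rw [hj, h]
  exact ⟨(⟨p, fun l l' => (hp l).trans (hp l').symm⟩ : sectionPart N d), hi, hj⟩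

variable (N)

theorem isFG_sectionFunctor : IsFG k _ (sectionFunctor N) := by
  refine isFG_of_mono (biprod.lift (sectionProj N 0) (sectionProj N 1)) (fun d p q hpq => ?_)
    (ObjectProperty.prop_biprod _ (isFG_natIncl_comp (N.isFG _ (singleton_notMem 0)))
      (isFG_natIncl_comp (N.isFG _ (singleton_notMem 1))))
  refine section_ext (i := 0) (j := 1) (by decide) ?_ ?_
  · have := congrArg (ap (biprod.fst : chart N 0 ⊞ chart N 1 ⟶ _) d) hpq
    change ap (biprod.lift (sectionProj N 0) (sectionProj N 1) ≫ biprod.fst) d p =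
      ap (biprod.lift (sectionProj N 0) (sectionProj N 1) ≫ biprod.fst) d q at this
    rwa [biprod.lift_fst] at this
  · have := congrArg (ap (biprod.snd : chart N 0 ⊞ chart N 1 ⟶ _) d) hpq
    change ap (biprod.lift (sectionProj N 0) (sectionProj N 1) ≫ biprod.snd) d p =
      ap (biprod.lift (sectionProj N 0) (sectionProj N 1) ≫ biprod.snd) d q at this
    rwa [biprod.lift_snd] at this

/-- The sections of a localized module, as a finitely generated graded module. -/
abbrev sectionModule : FGMod k 2 := ⟨sectionFunctor N, isFG_sectionFunctor N⟩

end Sections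

/-! ### The Serre quotient as a category of localized modules -/

section Adjunction

variable {k : Type u} [Field k] (N : LocalizedModule k (codimTwoSkeleton 2))

/-- Elements of the two charts with the same restriction have the same image in every `M_σ`. -/
theorem toLoc_eq_of_restr_eq {i j : Fin 2} {σ : Finset (Fin 2)} (hσ : σ ∉ codimTwoSkeleton 2)
    (hi : {i} ⊆ σ) (hj : {j} ⊆ σ) (d : Fin 2 →₀ ℕ) (p : ∀ l, (chart N l).obj d)
    (h : restr N i d (p i) = restr N j d (p j)) :
    toLoc (N.φ (singleton_notMem i) hσ hi) ((natIncl {i}).obj d) (p i) =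
      toLoc (N.φ (singleton_notMem j) hσ hj) ((natIncl {j}).obj d) (p j) := by
  by_cases hij : i = j
  · subst hij
    rfl
  · obtain rfl : σ = Finset.univ := by
      refine Finset.eq_univ_iff_forall.2 fun l => ?_
      by_cases hl : l = i
      · exact hi (Finset.mem_singleton.2 hl)
      · exact hj (Finset.mem_singleton.2 (eq_of_ne_of_ne hij hl))
    exact h

variable {σ : Finset (Fin 2)} (hσ : σ ∉ codimTwoSkeleton 2)

/-- The map from a graded module to `M_σ` obtained from a map to the sections, through the chart of
some element `i` of `σ`. -/
def chartTo {i : Fin 2} (hi : {i} ⊆ σ) {M : (Fin 2 →₀ ℕ) ⥤ ModuleCat.{u} k}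
    (g : M ⟶ sectionFunctor N) : M ⟶ natIncl σ ⋙ N.obj σ hσ :=
  homOfAct (fun d => toLoc (N.φ (singleton_notMem i) hσ hi) ((natIncl {i}).obj d) ∘ₗ
      ap (g ≫ sectionProj N i) d) fun {d e} h x => by
    refine (congrArg (toLoc (N.φ (singleton_notMem i) hσ hi) ((natIncl {i}).obj e))
      (ap_act (g ≫ sectionProj N i) h x)).trans ?_
    exact toLoc_act (N.φ (singleton_notMem i) hσ hi) ((natIncl {i}).monotone h) _

theorem chartTo_eq {i j : Fin 2} (hi : {i} ⊆ σ) (hj : {j} ⊆ σ)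
    {M : (Fin 2 →₀ ℕ) ⥤ ModuleCat.{u} k} (g : M ⟶ sectionFunctor N) :
    chartTo N hσ hi g = chartTo N hσ hj g := by
  refine hom_ext_ap fun d x => ?_
  exact toLoc_eq_of_restr_eq N hσ hi hj d (fun l => ap (sectionProj N l) d (ap g d x))
    (restr_sectionProj _ i j)

/-- `M_{i}` is the localization of the sections at `t_i`: the image in `M_{1,2}` of an element of
`M_{i}` comes from the other chart after multiplication by a power of `t_i`. -/
theorem isLeftKanExtension_sectionProj (i : Fin 2) :
    (N.obj {i} (singleton_notMem i)).IsLeftKanExtension (sectionProj N i) := by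
  obtain ⟨j, hij⟩ : ∃ j, i ≠ j := ⟨i + 1, by revert i; decide⟩
  have := N.isLeftKanExtension (singleton_notMem j) univ_notMem (Finset.subset_univ _)
  have key (d : Fin 2 →₀ ℕ) (v : LocDeg ({j} : Finset (Fin 2))) :
      ∃ e, d ≤ e ∧ (natIncl {i}).obj e ≤ (natIncl {i}).obj d ∧ v ≤ (natIncl {j}).obj e := by
    refine ⟨d + Finsupp.single i (v.val i).toNat, le_self_add,
      natIncl_le_natIncl_iff.2 fun l hl => ?_, le_natIncl_iff.2 fun l hl => ?_⟩
    · simp [Ne.symm (Finset.notMem_singleton.1 hl)]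
    · obtain rfl := eq_of_ne_of_ne hij.symm (Finset.notMem_singleton.1 hl)
      simp only [Finsupp.add_apply, Finsupp.single_eq_same]
      omega
  have hu (v w : LocDeg (Finset.univ : Finset (Fin 2))) : v ≤ w :=
    fun l hl => absurd (Finset.mem_univ l) hl
  refine isLeftKanExtension_natIncl _ (fun d y => ?_) fun {d} p hp => ?_
  · obtain ⟨v, hv, z, hz⟩ := exists_toLoc_eq
      (N.φ (singleton_notMem j) univ_notMem (Finset.subset_univ _)) (isDirectedOver_locIncl _)
      ((natIncl Finset.univ).obj d) (restr N i d y)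
    obtain ⟨e, hde, he, hve⟩ := key d v
    obtain ⟨p, hp, -⟩ := exists_section hij (act (chart N i) hde y)
      (act (N.obj {j} (singleton_notMem j)) hve z) (by
        rw [restr_act, ← hz, act_act]
        exact (toLoc_act (N.φ (singleton_notMem j) univ_notMem (Finset.subset_univ _)) hve z).symm)
    refine ⟨e, he, p, ?_⟩
    have h1 : toLoc (sectionProj N i) e p = act (N.obj {i} (singleton_notMem i))
      ((natIncl {i}).monotone hde) y := hp
    rw [h1, act_act, act_self]
  · have hi0 : ap (sectionProj N i) d p = 0 := hp
    have hj0 : restr N j d (ap (sectionProj N j) d p) = 0 := by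
      rw [← restr_sectionProj p i j, hi0, map_zero]
    obtain ⟨v, hdv, -, hv⟩ := exists_act_eq_zero
      (N.φ (singleton_notMem j) univ_notMem (Finset.subset_univ _)) (isDirectedOver_locIncl _)
      (hu _ _) _ ((congrArg _ hj0).trans (map_zero (act _ (le_refl _))))
    obtain ⟨e, hde, he, hve⟩ := key d v
    refine ⟨e, hde, he, section_ext hij ?_ ?_⟩
    · rw [ap_act, hi0, map_zero, map_zero]
    · rw [ap_act, map_zero]
      refine (act_act (N.obj {j} (singleton_notMem j)) hdv hve _).symm.trans ?_
      rw [hv, map_zero]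

theorem isLeftKanExtension_chartTo {i : Fin 2} (hi : {i} ⊆ σ) :
    (N.obj σ hσ).IsLeftKanExtension (chartTo N hσ hi (𝟙 (sectionFunctor N))) := by
  have h₁ := isLeftKanExtension_sectionProj N i
  have h₂ := N.isLeftKanExtension (singleton_notMem i) hσ hi
  refine isLeftKanExtension_of_elements _ (isDirectedOver_natIncl σ) (fun v y => ?_)
    fun {d v} h x hx => ?_
  · obtain ⟨w, hw, z, rfl⟩ := exists_toLoc_eq (N.φ (singleton_notMem i) hσ hi)
      (isDirectedOver_locIncl _) v y
    obtain ⟨d, hd, p, rfl⟩ := exists_toLoc_eq (sectionProj N i) (isDirectedOver_natIncl _) w z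
    refine ⟨d, ((locIncl hi).monotone hd).trans hw, p, ?_⟩
    rw [toLoc_act, act_act]
    rfl
  · obtain ⟨w, hdw, hw, hw'⟩ := exists_act_eq_zero (N.φ (singleton_notMem i) hσ hi)
      (isDirectedOver_locIncl _) h (toLoc (sectionProj N i) d x) hx
    obtain ⟨e, hde, he, he'⟩ := exists_act_eq_zero (sectionProj N i) (isDirectedOver_natIncl _)
      hdw x hw'
    exact ⟨e, hde, ((locIncl hi).monotone he).trans hw, he'⟩

variable {N} in
/-- The map to the sections that corresponds to a map out of the localizations of `M`. -/
noncomputable def toSections {M : FGMod k 2}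
    (f : (localizationFunctor k (codimTwoSkeleton 2)).obj M ⟶ N) : M ⟶ sectionModule N :=
  ObjectProperty.homMk (homOfAct
    (fun d => LinearMap.codRestrict (sectionPart N d)
      (LinearMap.pi fun i => ap (LocalizedModule.Hom.app f {i} (singleton_notMem i)) _ ∘ₗ
        toLoc (locUnit k {i} M.obj) d) fun x => by
        suffices h : ∀ i, restr N i d (ap (LocalizedModule.Hom.app f {i} (singleton_notMem i)) _
            (toLoc (locUnit k {i} M.obj) d x)) =
            ap (LocalizedModule.Hom.app f Finset.univ univ_notMem) _
              (toLoc (locUnit k Finset.univ M.obj) d x) from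
          fun i j => (h i).trans (h j).symm
        intro i
        have h₁ := LinearMap.congr_fun (congrArg ModuleCat.Hom.hom (NatTrans.congr_app
          (LocalizedModule.Hom.comm f (singleton_notMem i) univ_notMem (Finset.subset_univ _))
          ((natIncl {i}).obj d))) (toLoc (locUnit k {i} M.obj) d x)
        refine h₁.symm.trans ?_
        exact congrArg (ap (LocalizedModule.Hom.app f Finset.univ univ_notMem) _)
          (LinearMap.congr_fun (congrArg ModuleCat.Hom.hom
            (locUnit_locTrans k (Finset.subset_univ {i}) M.obj d)) x))
    fun {d e} h x => by
      refine Subtype.ext (funext fun i => ?_)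
      exact (congrArg (ap (LocalizedModule.Hom.app f {i} (singleton_notMem i)) _)
        (toLoc_act (locUnit k {i} M.obj) h x)).trans
          (ap_act (LocalizedModule.Hom.app f {i} (singleton_notMem i)) _ _))

theorem sectionProj_toSections {M : FGMod k 2}
    (f : (localizationFunctor k (codimTwoSkeleton 2)).obj M ⟶ N) (i : Fin 2) (d : Fin 2 →₀ ℕ)
    (x : M.obj.obj d) : ap (sectionProj N i) d (ap (toSections f).hom d x) =
      ap (LocalizedModule.Hom.app f {i} (singleton_notMem i)) _
        (toLoc (locUnit k {i} M.obj) d x) := rfl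

theorem locUnit_app {M : FGMod k 2}
    (f : (localizationFunctor k (codimTwoSkeleton 2)).obj M ⟶ N)
    {i : Fin 2} (hi : {i} ⊆ σ) (d : Fin 2 →₀ ℕ) (x : M.obj.obj d) :
    ap (LocalizedModule.Hom.app f σ hσ) _ (toLoc (locUnit k σ M.obj) d x) =
      toLoc (chartTo N hσ hi (toSections f).hom) d x := by
  have h₁ := LinearMap.congr_fun (congrArg ModuleCat.Hom.hom (NatTrans.congr_app
    (LocalizedModule.Hom.comm f (singleton_notMem i) hσ hi) ((natIncl {i}).obj d)))
    (toLoc (locUnit k {i} M.obj) d x)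
  refine Eq.trans ?_ h₁
  exact (congrArg (ap (LocalizedModule.Hom.app f σ hσ) _)
    (LinearMap.congr_fun (congrArg ModuleCat.Hom.hom (locUnit_locTrans k hi M.obj d)) x)).symm

theorem toSections_bijective (M : FGMod k 2) : Function.Bijective
    (toSections : ((localizationFunctor k (codimTwoSkeleton 2)).obj M ⟶ N) → _) := by
  refine ⟨fun f g hfg => ?_, fun g => ?_⟩
  · apply LocalizedModule.Hom.ext
    funext σ hσ
    obtain ⟨i, hi⟩ := notMem_codimTwoSkeleton_iff.1 hσ
    refine locObj_hom_ext k fun d => ?_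
    ext x
    have h₁ := locUnit_app N hσ f (Finset.singleton_subset_iff.2 hi) d x
    have h₂ := locUnit_app N hσ g (Finset.singleton_subset_iff.2 hi) d x
    rw [hfg] at h₁
    exact h₁.trans h₂.symm
  · choose i hi using fun (σ : Finset (Fin 2)) (hσ : σ ∉ codimTwoSkeleton 2) =>
      notMem_codimTwoSkeleton_iff.1 hσ
    let c (σ : Finset (Fin 2)) (hσ : σ ∉ codimTwoSkeleton 2) :
        M.obj ⟶ natIncl σ ⋙ N.obj σ hσ :=
      chartTo N hσ (Finset.singleton_subset_iff.2 (hi σ hσ)) g.hom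
    let a (σ : Finset (Fin 2)) (hσ : σ ∉ codimTwoSkeleton 2) : locObj k σ M.obj ⟶ N.obj σ hσ :=
      (locObj k σ M.obj).descOfIsLeftKanExtension (locUnit k σ M.obj) (N.obj σ hσ) (c σ hσ)
    have ha (σ : Finset (Fin 2)) (hσ : σ ∉ codimTwoSkeleton 2) (d : Fin 2 →₀ ℕ) (x : M.obj.obj d) :
        ap (a σ hσ) _ (toLoc (locUnit k σ M.obj) d x) = toLoc (c σ hσ) d x :=
      LinearMap.congr_fun (congrArg ModuleCat.Hom.hom
        ((locObj k σ M.obj).descOfIsLeftKanExtension_fac_app (locUnit k σ M.obj) _ (c σ hσ) d)) x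
    let f : (localizationFunctor k (codimTwoSkeleton 2)).obj M ⟶ N :=
      { app := a
        comm := fun {σ τ} hσ hτ h => by
          refine locObj_hom_ext k fun d => ?_
          ext x
          have h₁ : toLoc (locTrans k h M.obj) _ (toLoc (locUnit k σ M.obj) d x) =
              toLoc (locUnit k τ M.obj) d x :=
            LinearMap.congr_fun (congrArg ModuleCat.Hom.hom (locUnit_locTrans k h M.obj d)) x
          refine (congrArg (ap (a τ hτ) ((natIncl τ).obj d)) h₁).trans ?_
          refine (ha τ hτ d x).trans ?_
          refine Eq.trans ?_ (congrArg (toLoc (N.φ hσ hτ h) ((natIncl σ).obj d)) (ha σ hσ d x)).symm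
          have h₂ : c τ hτ = chartTo N hτ
              ((Finset.singleton_subset_iff.2 (hi σ hσ)).trans h) g.hom := chartTo_eq N hτ _ _ _
          rw [h₂]
          exact (LinearMap.congr_fun (congrArg ModuleCat.Hom.hom
            (N.φ_trans (singleton_notMem (i σ hσ)) hσ hτ (Finset.singleton_subset_iff.2 (hi σ hσ))
              h ((natIncl {i σ hσ}).obj d))) _).symm }
    refine ⟨f, ?_⟩
    refine ObjectProperty.hom_ext _ (hom_ext_ap fun d x => ?_)
    have hproj (l : Fin 2) : ap (sectionProj N l) d (ap (toSections f).hom d x) =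
        ap (sectionProj N l) d (ap g.hom d x) := by
      refine (sectionProj_toSections N f l d x).trans ((ha {l} (singleton_notMem l) d x).trans ?_)
      have h₂ : c {l} (singleton_notMem l) =
        chartTo N (singleton_notMem l) subset_rfl g.hom := chartTo_eq N _ _ _ _
      refine (congrArg (fun q : M.obj ⟶ chart N l => toLoc q d x) h₂).trans ?_
      exact LinearMap.congr_fun (congrArg ModuleCat.Hom.hom
        (N.φ_refl (singleton_notMem l) ((natIncl {l}).obj d))) _
    exact section_ext (i := 0) (j := 1) (by decide) (hproj 0) (hproj 1)

theorem toSections_comp {M M' : FGMod k 2} (g : M ⟶ M')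
    (f : (localizationFunctor k (codimTwoSkeleton 2)).obj M' ⟶ N) :
    toSections ((localizationFunctor k (codimTwoSkeleton 2)).map g ≫ f) = g ≫ toSections f := by
  refine ObjectProperty.hom_ext _ (hom_ext_ap fun d x => ?_)
  have hproj (l : Fin 2) : ap (sectionProj N l) d (ap (toSections
        ((localizationFunctor k (codimTwoSkeleton 2)).map g ≫ f)).hom d x) =
      ap (sectionProj N l) d (ap (g ≫ toSections f).hom d x) := by
    refine (sectionProj_toSections N _ l d x).trans ?_
    exact congrArg (ap (LocalizedModule.Hom.app f {l} (singleton_notMem l)) _)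
      (LinearMap.congr_fun (congrArg ModuleCat.Hom.hom (locUnit_locMap k {l} g.hom d)) x)
  exact section_ext (i := 0) (j := 1) (by decide) (hproj 0) (hproj 1)

variable (k)

/-- The bijection between maps out of the localizations of `M` and maps from `M` to the sections. -/
noncomputable def sectionEquiv (M : FGMod k 2) (N : LocalizedModule k (codimTwoSkeleton 2)) :
    ((localizationFunctor k (codimTwoSkeleton 2)).obj M ⟶ N) ≃ (M ⟶ sectionModule N) :=
  Equiv.ofBijective _ (toSections_bijective N M)

/-- Localization is left adjoint to taking sections. -/
noncomputable def localizationAdjunction : localizationFunctor k (codimTwoSkeleton 2) ⊣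
    Adjunction.rightAdjointOfEquiv (sectionEquiv k) fun _ _ N g f => toSections_comp N g f :=
  Adjunction.adjunctionOfEquivRight _ _

instance isIso_counit : IsIso (localizationAdjunction k).counit := by
  have (N : LocalizedModule k (codimTwoSkeleton 2)) :
      IsIso ((localizationAdjunction k).counit.app N) := by
    let ε : (localizationFunctor k (codimTwoSkeleton 2)).obj (sectionModule N) ⟶ N :=
      (localizationAdjunction k).counit.app N
    have hε : toSections ε = 𝟙 (sectionModule N) := by
      have h : ε = (sectionEquiv k (sectionModule N) N).symm (𝟙 _) :=
        Adjunction.adjunctionOfEquivRight_counit_app _ _ _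
      rw [h]
      exact (sectionEquiv k (sectionModule N) N).apply_symm_apply _
    refine LocalizedModule.isIso_of_app ε fun σ hσ => ?_
    obtain ⟨i, hi⟩ := notMem_codimTwoSkeleton_iff.1 hσ
    have := isLeftKanExtension_chartTo N hσ (Finset.singleton_subset_iff.2 hi)
    have : (((localizationFunctor k (codimTwoSkeleton 2)).obj (sectionModule N)).obj σ
        hσ).IsLeftKanExtension (locUnit k σ (sectionFunctor N)) :=
      inferInstanceAs ((locObj k σ (sectionFunctor N)).IsLeftKanExtension _)
    refine (Functor.isLeftKanExtension_iff_isIso (LocalizedModule.Hom.app ε σ hσ)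
      (locUnit k σ (sectionFunctor N)) (chartTo N hσ (Finset.singleton_subset_iff.2 hi)
        (𝟙 (sectionFunctor N))) ?_).1 inferInstance
    refine hom_ext_ap fun d x => ?_
    refine (locUnit_app N hσ ε (Finset.singleton_subset_iff.2 hi) d x).trans ?_
    rw [hε]
    rfl
  exact NatIso.isIso_of_isIso_app _

theorem unit_eq_toSections (M : FGMod k 2) :
    (localizationAdjunction k).unit.app M = toSections (𝟙 _) :=
  Adjunction.adjunctionOfEquivRight_unit_app _ _ _

/-- The unit of the adjunction between localization and sections, on underlying functors. -/
noncomputable def sectionUnit (M : FGMod k 2) :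
    M.obj ⟶ sectionFunctor ((localizationFunctor k (codimTwoSkeleton 2)).obj M) :=
  (toSections (𝟙 ((localizationFunctor k (codimTwoSkeleton 2)).obj M)) :
    M ⟶ sectionModule ((localizationFunctor k (codimTwoSkeleton 2)).obj M)).hom

variable {k}

theorem sectionProj_sectionUnit {M : FGMod k 2} (i : Fin 2) (d : Fin 2 →₀ ℕ) (x : M.obj.obj d) :
    ap (sectionProj _ i) d (ap (sectionUnit k M) d x) = toLoc (locUnit k {i} M.obj) d x := rfl

theorem exists_act_eq_zero_of_sectionUnit {M : FGMod k 2} {d : Fin 2 →₀ ℕ} (x : M.obj.obj d)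
    (hx : ap (sectionUnit k M) d x = 0) (i : Fin 2) :
    ∃ (e : Fin 2 →₀ ℕ) (h : d ≤ e), (natIncl {i}).obj e ≤ (natIncl {i}).obj d ∧
      act M.obj h x = 0 := by
  have h₁ : toLoc (locUnit k {i} M.obj) d x = 0 :=
    (sectionProj_sectionUnit i d x).symm.trans
      ((congrArg (ap (sectionProj _ i) d) hx).trans (map_zero _))
  exact exists_act_eq_zero (locUnit k {i} M.obj) (isDirectedOver_natIncl _) le_rfl x
    ((act_self _ _ _).trans h₁)

theorem exists_sectionUnit_eq_act (M : FGMod k 2) {d : Fin 2 →₀ ℕ}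
    (p : (sectionFunctor ((localizationFunctor k (codimTwoSkeleton 2)).obj M)).obj d) (i : Fin 2) :
    ∃ (e : Fin 2 →₀ ℕ) (h : d ≤ e), (natIncl {i}).obj e ≤ (natIncl {i}).obj d ∧
      ∃ x, ap (sectionUnit k M) e x = act (sectionFunctor _) h p := by
  let N := (localizationFunctor k (codimTwoSkeleton 2)).obj M
  let η : M.obj ⟶ sectionFunctor N := sectionUnit k M
  have := isLeftKanExtension_sectionProj N i
  let y : (locObj k {i} M.obj).obj ((natIncl {i}).obj d) := ap (sectionProj N i) d p
  obtain ⟨e, he, x, hx⟩ := exists_toLoc_eq (locUnit k {i} M.obj) (isDirectedOver_natIncl _) _ y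
  have hd : d ≤ d ⊔ e := le_sup_left
  have hle : (natIncl {i}).obj (d ⊔ e) ≤ (natIncl {i}).obj d :=
    natIncl_le_natIncl_iff.2 fun j hj =>
      sup_le le_rfl (natIncl_le_natIncl_iff.1 he j hj)
  have hq : toLoc (sectionProj N i) (d ⊔ e)
      (act (sectionFunctor N) hd p - ap η (d ⊔ e) (act M.obj le_sup_right x)) = 0 := by
    have h₁ : toLoc (sectionProj N i) (d ⊔ e) (act (sectionFunctor N) hd p) =
        act (locObj k {i} M.obj) ((natIncl {i}).monotone hd) y :=
      toLoc_act (sectionProj N i) hd p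
    have h₂ : toLoc (locUnit k {i} M.obj) (d ⊔ e) (act M.obj le_sup_right x) =
        act (locObj k {i} M.obj) ((natIncl {i}).monotone hd) y := by
      rw [toLoc_act, ← hx, act_act]
    rw [map_sub]
    exact sub_eq_zero.2 (h₁.trans h₂.symm)
  obtain ⟨f, hef, hf, hqf⟩ := exists_act_eq_zero (sectionProj N i) (isDirectedOver_natIncl _)
    le_rfl _ ((act_self _ _ _).trans hq)
  refine ⟨f, hd.trans hef, hf.trans hle, act M.obj (le_sup_right.trans hef) x, ?_⟩
  rw [map_sub, act_act, sub_eq_zero, ← ap_act, act_act] at hqf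
  exact hqf.symm

variable (k)

theorem isoModSerre_unit (M : FGMod k 2) :
    (finiteModules k 2).isoModSerre ((localizationAdjunction k).unit.app M) := by
  rw [unit_eq_toSections]
  exact isoModSerre_of_torsion _ (fun d x hx i => exists_act_eq_zero_of_sectionUnit x hx i)
    fun d p i => exists_sectionUnit_eq_act M p i

theorem isInvertedBy_localizationFunctor :
    (finiteModules k 2).isoModSerre.IsInvertedBy
      (localizationFunctor k (codimTwoSkeleton 2)) := fun _ _ f hf =>
  LocalizedModule.isIso_of_app _ fun _ hσ => isIso_locMap f hf (notMem_codimTwoSkeleton_iff.1 hσ)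

instance isLocalization_localizationFunctor :
    (localizationFunctor k (codimTwoSkeleton 2)).IsLocalization
      (finiteModules k 2).isoModSerre :=
  have h := (localizationAdjunction k).fullyFaithfulROfIsIsoCounit
  have := h.full
  have := h.faithful
  (localizationAdjunction k).isLocalization_leftAdjoint _ (isInvertedBy_localizationFunctor k)
    (isoModSerre_unit k)

/-- The equivalence between the Serre quotient and the category of localized modules. -/
noncomputable def quotEquivalence : QuotMod k 2 ≌ LocalizedModule k (codimTwoSkeleton 2) :=
  Localization.equivalenceFromModel (localizationFunctor k (codimTwoSkeleton 2))
    (finiteModules k 2).isoModSerre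

/-- The equivalence with localized modules is compatible with the localization functor. -/
noncomputable def quotFunctorCompIso :
    quotFunctor k 2 ⋙ (quotEquivalence k).functor ≅ localizationFunctor k (codimTwoSkeleton 2) :=
  Localization.qCompEquivalenceFromModelFunctorIso _ _

end Adjunction

/-! ### Saturated modules -/

section Saturated

variable {k : Type u} [Field k]

/-- A graded `k[s, t]`-module is saturated if it is the module of sections of its localizations.
This is expressed on squares `d ≤ p, q ≤ e`, where `p` exceeds `d` in one coordinate, `q` exceeds
`d` in the other one, and `e` is the fourth corner: the degree `d` part is the fibre product of the
parts of degree `p` and `q` over the part of degree `e`. -/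
structure IsSaturated (M : (Fin 2 →₀ ℕ) ⥤ ModuleCat.{u} k) : Prop where
  eq_zero {i j : Fin 2} (hij : i ≠ j) {d p q : Fin 2 →₀ ℕ} (hdp : d ≤ p) (hdq : d ≤ q)
    (hp : (natIncl {i}).obj p ≤ (natIncl {i}).obj d)
    (hq : (natIncl {j}).obj q ≤ (natIncl {j}).obj d) (x : M.obj d)
    (hxp : act M hdp x = 0) (hxq : act M hdq x = 0) : x = 0
  exists_glue {i j : Fin 2} (hij : i ≠ j) {d p q e : Fin 2 →₀ ℕ} (hdp : d ≤ p) (hdq : d ≤ q)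
    (hpe : p ≤ e) (hqe : q ≤ e)
    (hp : (natIncl {i}).obj p ≤ (natIncl {i}).obj d)
    (hq : (natIncl {j}).obj q ≤ (natIncl {j}).obj d)
    (hp' : (natIncl {j}).obj e ≤ (natIncl {j}).obj p)
    (hq' : (natIncl {i}).obj e ≤ (natIncl {i}).obj q) (x : M.obj p) (y : M.obj q)
    (hxy : act M hpe x = act M hqe y) : ∃ z, act M hdp z = x ∧ act M hdq z = y

theorem isSaturated_sectionFunctor (N : LocalizedModule k (codimTwoSkeleton 2)) :
    IsSaturated (sectionFunctor N) where
  eq_zero {i j} hij {d p q} hdp hdq hp hq x hxp hxq := by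
    refine section_ext hij ?_ ?_
    · apply act_injective_of_le (N.obj {i} (singleton_notMem i)) ((natIncl {i}).monotone hdp) hp
      refine (ap_act (sectionProj N i) hdp x).symm.trans ?_
      rw [hxp, map_zero, map_zero, map_zero]
    · apply act_injective_of_le (N.obj {j} (singleton_notMem j)) ((natIncl {j}).monotone hdq) hq
      refine (ap_act (sectionProj N j) hdq x).symm.trans ?_
      rw [hxq, map_zero, map_zero, map_zero]
  exists_glue {i j} hij {d p q e} hdp hdq hpe hqe hp hq hp' hq' x y hxy := by
    let Ni := N.obj {i} (singleton_notMem i)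
    let Nj := N.obj {j} (singleton_notMem j)
    let u : (chart N i).obj d := act Ni hp (ap (sectionProj N i) p x)
    let v : (chart N j).obj d := act Nj hq (ap (sectionProj N j) q y)
    have hu : act (chart N i) (hdp.trans hpe) u = ap (sectionProj N i) e (act _ hpe x) := by
      rw [ap_act]
      exact act_act Ni hp ((natIncl {i}).monotone (hdp.trans hpe)) _
    have hv : act (chart N j) (hdq.trans hqe) v = ap (sectionProj N j) e (act _ hqe y) := by
      rw [ap_act]
      exact act_act Nj hq ((natIncl {j}).monotone (hdq.trans hqe)) _
    obtain ⟨z, hzi, hzj⟩ := exists_section hij u v (by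
      apply act_injective_of_le (N.obj Finset.univ univ_notMem)
        ((natIncl Finset.univ).monotone (hdp.trans hpe)) fun l hl => absurd (Finset.mem_univ l) hl
      rw [← restr_act N i (hdp.trans hpe), ← restr_act N j (hdp.trans hpe), hu, hv, ← hxy]
      exact restr_sectionProj _ i j)
    refine ⟨z, section_ext hij ?_ ?_, section_ext hij ?_ ?_⟩
    · rw [ap_act, hzi]
      exact (act_act Ni hp ((natIncl {i}).monotone hdp) _).trans (act_self Ni _ _)
    · apply act_injective_of_le Nj ((natIncl {j}).monotone hpe) hp'
      rw [ap_act, hzj]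
      refine (act_act Nj _ _ _).trans (hv.trans ?_)
      rw [← hxy, ap_act]
      rfl
    · apply act_injective_of_le Ni ((natIncl {i}).monotone hqe) hq'
      rw [ap_act, hzi]
      refine (act_act Ni _ _ _).trans (hu.trans ?_)
      rw [hxy, ap_act]
      rfl
    · rw [ap_act, hzj]
      exact (act_act Nj hq ((natIncl {j}).monotone hdq) _).trans (act_self Nj _ _)

theorem bijective_sectionUnit {M : FGMod k 2} (hM : IsSaturated M.obj) (d : Fin 2 →₀ ℕ) :
    Function.Bijective (ap (sectionUnit k M) d) := by
  have h01 : (0 : Fin 2) ≠ 1 := by decide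
  have hinj : ∀ d, Function.Injective (ap (sectionUnit k M) d) := fun d => by
    rw [injective_iff_map_eq_zero]
    intro x hx
    obtain ⟨p, hdp, hp, hxp⟩ := exists_act_eq_zero_of_sectionUnit x hx 0
    obtain ⟨q, hdq, hq, hxq⟩ := exists_act_eq_zero_of_sectionUnit x hx 1
    exact hM.eq_zero h01 hdp hdq hp hq x hxp hxq
  refine ⟨hinj d, fun s => ?_⟩
  obtain ⟨p, hdp, hp, x, hx⟩ := exists_sectionUnit_eq_act M s 0
  obtain ⟨q, hdq, hq, y, hy⟩ := exists_sectionUnit_eq_act M s 1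
  obtain ⟨z, hzx, hzy⟩ := hM.exists_glue h01 hdp hdq (le_sup_left : p ≤ p ⊔ q) le_sup_right hp hq
    (natIncl_le_natIncl_iff.2 fun l hl => sup_le le_rfl
      ((natIncl_le_natIncl_iff.1 hq l hl).trans (hdp l)))
    (natIncl_le_natIncl_iff.2 fun l hl => sup_le
      ((natIncl_le_natIncl_iff.1 hp l hl).trans (hdq l)) le_rfl) x y (hinj _ (by
        rw [ap_act, ap_act, hx, hy, act_act, act_act]))
  refine ⟨z, sub_eq_zero.1 ((isSaturated_sectionFunctor _).eq_zero h01 hdp hdq hp hq _ ?_ ?_)⟩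
  · rw [map_sub, ← ap_act, hzx, hx, sub_self]
  · rw [map_sub, ← ap_act, hzy, hy, sub_self]

theorem isIso_of_hom_bijective {m : ℕ} {M N : FGMod k m} (f : M ⟶ N)
    (h : ∀ d, Function.Bijective (ap f.hom d)) : IsIso f := by
  have : IsIso ((IsFG k (Fin m →₀ ℕ)).ι.map f) := isIso_of_bijective f.hom h
  exact isIso_of_reflects_iso f (IsFG k (Fin m →₀ ℕ)).ι

/-- Maps to a saturated module are the same in the category of graded modules and in the Serre
quotient. -/
theorem bijective_quotFunctor_map {M : FGMod k 2} (hM : IsSaturated M.obj) (L : FGMod k 2) :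
    Function.Bijective ((quotFunctor k 2).map : (L ⟶ M) → _) := by
  have hunit : IsIso ((localizationAdjunction k).unit.app M) := by
    rw [unit_eq_toSections]
    exact isIso_of_hom_bijective _ fun d => bijective_sectionUnit hM d
  have h₁ : Function.Bijective
      ((localizationFunctor k (codimTwoSkeleton 2)).map : (L ⟶ M) → _) := by
    rw [← Function.Bijective.of_comp_iff' ((localizationAdjunction k).homEquiv _ _).bijective]
    have : ((localizationAdjunction k).homEquiv L _ ∘
        ((localizationFunctor k (codimTwoSkeleton 2)).map : (L ⟶ M) → _)) =
        fun f => f ≫ (localizationAdjunction k).unit.app M := by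
      funext f
      simp [Adjunction.homEquiv_unit]
    rw [this]
    exact ⟨fun f g hfg => (cancel_mono _).1 hfg,
      fun g => ⟨g ≫ inv ((localizationAdjunction k).unit.app M), by simp⟩⟩
  let e := quotFunctorCompIso k
  have h₂ : Function.Bijective
      ((quotFunctor k 2 ⋙ (quotEquivalence k).functor).map : (L ⟶ M) → _) := by
    have : ((quotFunctor k 2 ⋙ (quotEquivalence k).functor).map : (L ⟶ M) → _) =
        (e.app L).symm.homCongr (e.app M).symm ∘
          ((localizationFunctor k (codimTwoSkeleton 2)).map : (L ⟶ M) → _) := by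
      funext f
      simp [Iso.homCongr]
    rw [this]
    exact (Equiv.bijective _).comp h₁
  exact (Function.Bijective.of_comp_iff' (Functor.FullyFaithful.map_bijective
    (Functor.FullyFaithful.ofFullyFaithful (quotEquivalence k).functor) _ _) _).1 h₂

theorem exists_isSaturated_iso (X : QuotMod k 2) :
    ∃ M : FGMod k 2, IsSaturated M.obj ∧ Nonempty (X ≅ (quotFunctor k 2).obj M) := by
  let N := (quotEquivalence k).functor.obj X
  refine ⟨sectionModule N, isSaturated_sectionFunctor N, ⟨?_⟩⟩
  exact ((quotEquivalence k).functor.preimageIso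
    ((quotFunctorCompIso k).app (sectionModule N) ≪≫
      (asIso (localizationAdjunction k).counit).app N)).symm

end Saturated

/-! ### Interval modules -/

section Interval

variable (k : Type u) [Field k] {P : Type}

open Classical in
/-- The degree `d` part of the interval module on `I`: the line `k` if `d ∈ I`, and zero
otherwise. -/
noncomputable def intervalPart (I : Set P) (d : P) : Submodule k k := if d ∈ I then ⊤ else ⊥

theorem intervalPart_eq_zero {I : Set P} {d : P} (hd : d ∉ I) (x : intervalPart k I d) :
    x.1 = 0 := by
  simpa [intervalPart, hd] using x.2

theorem mem_intervalPart {I : Set P} {d : P} (hd : d ∈ I) (c : k) : c ∈ intervalPart k I d := by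
  rw [intervalPart, if_pos hd]
  trivial

open Classical in
/-- The map from a vector space to a degree of an interval module given by a linear form, which only
matters in the degrees of the interval. -/
noncomputable def toIntervalPart {V : Type*} [AddCommGroup V] [Module k V] (I : Set P) (d : P)
    (f : V →ₗ[k] k) : V →ₗ[k] intervalPart k I d :=
  LinearMap.codRestrict _ (if d ∈ I then f else 0) fun x => by
    split_ifs with h
    · exact mem_intervalPart k h _
    · exact Submodule.zero_mem _

open Classical in
theorem coe_toIntervalPart {V : Type*} [AddCommGroup V] [Module k V] (I : Set P) (d : P)
    (f : V →ₗ[k] k) (x : V) : (toIntervalPart k I d f x).1 = if d ∈ I then f x else 0 := by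
  simp only [toIntervalPart, LinearMap.codRestrict_apply]
  split_ifs <;> rfl

variable [Preorder P]

/-- The graded module that is `k` in the degrees of an interval `I` and zero elsewhere, with
identity maps within `I`. -/
noncomputable def intervalFunctor (I : Set P) (hI : I.OrdConnected) : P ⥤ ModuleCat.{u} k where
  obj d := ModuleCat.of k (intervalPart k I d)
  map {d e} _ := ModuleCat.ofHom (toIntervalPart k I e (intervalPart k I d).subtype)
  map_id d := by
    classical
    ext x : 3
    refine (coe_toIntervalPart k I d _ x).trans ?_
    split_ifs with h
    · rfl
    · exact (intervalPart_eq_zero k h x).symm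
  map_comp {d e f} φ ψ := by
    classical
    ext x : 3
    refine (coe_toIntervalPart k I f _ x).trans
      (Eq.trans ?_ (coe_toIntervalPart k I f _ _).symm)
    split_ifs with hf
    · refine Eq.trans ?_ (coe_toIntervalPart k I e _ x).symm
      split_ifs with he
      · rfl
      · exact intervalPart_eq_zero k (fun hd => he (hI.out hd hf ⟨leOfHom φ, leOfHom ψ⟩)) x
    · rfl

variable {k}

/-- The coefficient of an element of an interval module. -/
noncomputable def coeff {I : Set P} {hI : I.OrdConnected} {d : P} :
    (intervalFunctor k I hI).obj d →ₗ[k] k :=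
  (intervalPart k I d).subtype

theorem coeff_ext {I : Set P} {hI : I.OrdConnected} {d : P} {x y : (intervalFunctor k I hI).obj d}
    (h : coeff x = coeff y) : x = y := Subtype.ext h

theorem coeff_eq_zero {I : Set P} {hI : I.OrdConnected} {d : P} (hd : d ∉ I)
    (x : (intervalFunctor k I hI).obj d) : coeff x = 0 := intervalPart_eq_zero k hd x

open Classical in
theorem coeff_act {I : Set P} {hI : I.OrdConnected} {d e : P} (h : d ≤ e)
    (x : (intervalFunctor k I hI).obj d) :
    coeff (act (intervalFunctor k I hI) h x) = if e ∈ I then coeff x else 0 :=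
  coe_toIntervalPart k I e _ x

theorem coeff_act_of_mem {I : Set P} {hI : I.OrdConnected} {d e : P} (h : d ≤ e) (he : e ∈ I)
    (x : (intervalFunctor k I hI).obj d) :
    coeff (act (intervalFunctor k I hI) h x) = coeff x := by
  rw [coeff_act, if_pos he]

/-- The basis element of an interval module in a degree of the interval. -/
noncomputable def basisElt {I : Set P} (hI : I.OrdConnected) {d : P} (hd : d ∈ I) :
    (intervalFunctor k I hI).obj d := ⟨1, mem_intervalPart k hd 1⟩

@[simp]
theorem coeff_basisElt {I : Set P} (hI : I.OrdConnected) {d : P} (hd : d ∈ I) :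
    coeff (basisElt (k := k) hI hd) = 1 := rfl

theorem eq_smul_basisElt {I : Set P} (hI : I.OrdConnected) {d : P} (hd : d ∈ I)
    (x : (intervalFunctor k I hI).obj d) : x = coeff x • basisElt hI hd :=
  coeff_ext (by rw [map_smul, coeff_basisElt, smul_eq_mul, mul_one])

theorem act_basisElt {I : Set P} (hI : I.OrdConnected) {d e : P} (h : d ≤ e) (hd : d ∈ I)
    (he : e ∈ I) : act (intervalFunctor k I hI) h (basisElt hI hd) = basisElt hI he :=
  coeff_ext (by rw [coeff_act_of_mem h he, coeff_basisElt, coeff_basisElt])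

/-- The map to an interval module given by a compatible family of linear forms. -/
noncomputable def toInterval {I : Set P} (hI : I.OrdConnected) {M : P ⥤ ModuleCat.{u} k}
    (f : ∀ d, M.obj d →ₗ[k] k)
    (hf : ∀ {d e : P} (h : d ≤ e), e ∈ I → d ∈ I → ∀ x, f e (act M h x) = f d x)
    (hf' : ∀ {d e : P} (h : d ≤ e), e ∈ I → d ∉ I → ∀ x, f e (act M h x) = 0) :
    M ⟶ intervalFunctor k I hI :=
  homOfAct (fun d => toIntervalPart k I d (f d)) fun {d e} h x => by
    classical
    apply coeff_ext
    rw [coeff_act]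
    refine (coe_toIntervalPart k I e (f e) _).trans ?_
    by_cases he : e ∈ I
    · rw [if_pos he, if_pos he]
      refine Eq.trans ?_ (coe_toIntervalPart k I d (f d) x).symm
      split_ifs with hd
      · exact hf h he hd x
      · exact hf' h he hd x
    · rw [if_neg he, if_neg he]

theorem coeff_toInterval {I : Set P} (hI : I.OrdConnected) {M : P ⥤ ModuleCat.{u} k}
    (f : ∀ d, M.obj d →ₗ[k] k)
    (hf : ∀ {d e : P} (h : d ≤ e), e ∈ I → d ∈ I → ∀ x, f e (act M h x) = f d x)
    (hf' : ∀ {d e : P} (h : d ≤ e), e ∈ I → d ∉ I → ∀ x, f e (act M h x) = 0)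
    {d : P} (hd : d ∈ I) (x : M.obj d) : coeff (ap (toInterval hI f hf hf') d x) = f d x := by
  classical
  exact (coe_toIntervalPart k I d (f d) x).trans (if_pos hd)

open Classical in
/-- The map from an interval module that sends the generator to an element annihilated by the
monomials leading out of the interval. -/
noncomputable def ofInterval {I : Set P} (hI : I.OrdConnected) {m : P} (hm : IsLeast I m)
    {M : P ⥤ ModuleCat.{u} k} (x : M.obj m)
    (hx : ∀ {d : P} (h : m ≤ d), d ∉ I → act M h x = 0) : intervalFunctor k I hI ⟶ M :=
  homOfAct (fun d => if h : m ≤ d then coeff.smulRight (act M h x) else 0) fun {d e} h y => by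
    by_cases hd : d ∈ I
    · have hmd := hm.2 hd
      rw [dif_pos hmd, dif_pos (hmd.trans h), LinearMap.smulRight_apply, LinearMap.smulRight_apply,
        coeff_act, map_smul, act_act]
      split_ifs with he
      · rfl
      · rw [hx _ he, smul_zero, smul_zero]
    · obtain rfl : y = 0 := coeff_ext ((coeff_eq_zero hd y).trans (map_zero _).symm)
      simp only [map_zero]

theorem ap_ofInterval {I : Set P} (hI : I.OrdConnected) {m : P} (hm : IsLeast I m)
    {M : P ⥤ ModuleCat.{u} k} (x : M.obj m)
    (hx : ∀ {d : P} (h : m ≤ d), d ∉ I → act M h x = 0) {d : P} (h : m ≤ d)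
    (y : (intervalFunctor k I hI).obj d) :
    ap (ofInterval hI hm x hx) d y = coeff y • act M h x := by
  classical
  have h₁ : ap (ofInterval hI hm x hx) d =
    if h : m ≤ d then coeff.smulRight (act M h x) else 0 := rfl
  rw [h₁, dif_pos h, LinearMap.smulRight_apply]

/-- An element and a compatible family of linear forms taking the value one on its multiples exhibit
an interval module as a direct summand. -/
theorem ofInterval_toInterval {I : Set P} (hI : I.OrdConnected) {m : P} (hm : IsLeast I m)
    {M : P ⥤ ModuleCat.{u} k} (x : M.obj m)
    (hx : ∀ {d : P} (h : m ≤ d), d ∉ I → act M h x = 0) (f : ∀ d, M.obj d →ₗ[k] k)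
    (hf : ∀ {d e : P} (h : d ≤ e), e ∈ I → d ∈ I → ∀ x, f e (act M h x) = f d x)
    (hf' : ∀ {d e : P} (h : d ≤ e), e ∈ I → d ∉ I → ∀ x, f e (act M h x) = 0)
    (hfx : f m x = 1) : ofInterval hI hm x hx ≫ toInterval hI f hf hf' = 𝟙 _ := by
  refine hom_ext_ap fun d y => ?_
  by_cases hd : d ∈ I
  · apply coeff_ext
    rw [ap_comp, coeff_toInterval hI f hf hf' hd, ap_ofInterval hI hm x hx (hm.2 hd), map_smul,
      hf _ hd hm.1, hfx, smul_eq_mul, mul_one, ap_id]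
  · exact coeff_ext ((coeff_eq_zero hd _).trans (coeff_eq_zero hd _).symm)

/-- The scalar by which a map of interval modules acts on the generator. -/
noncomputable def genScalar {I J : Set P} {hI : I.OrdConnected} {hJ : J.OrdConnected} {m : P}
    (hm : IsLeast I m) (f : intervalFunctor k I hI ⟶ intervalFunctor k J hJ) : k :=
  coeff (ap f m (basisElt hI hm.1))

theorem ap_basisElt {I J : Set P} {hI : I.OrdConnected} {hJ : J.OrdConnected} {m : P}
    (hm : IsLeast I m) (f : intervalFunctor k I hI ⟶ intervalFunctor k J hJ) {d : P} (hd : d ∈ I) :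
    ap f d (basisElt hI hd) = act _ (hm.2 hd) (ap f m (basisElt hI hm.1)) := by
  rw [← ap_act, act_basisElt hI _ hm.1 hd]

open Classical in
theorem coeff_ap {I J : Set P} {hI : I.OrdConnected} {hJ : J.OrdConnected} {m : P}
    (hm : IsLeast I m) (f : intervalFunctor k I hI ⟶ intervalFunctor k J hJ) {d : P} (hd : d ∈ I)
    (x : (intervalFunctor k I hI).obj d) :
    coeff (ap f d x) = coeff x * if d ∈ J then genScalar hm f else 0 := by
  conv_lhs => rw [eq_smul_basisElt hI hd x]
  rw [map_smul, map_smul, ap_basisElt hm f hd, coeff_act, smul_eq_mul]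
  rfl

theorem hom_ext_genScalar {I J : Set P} {hI : I.OrdConnected} {hJ : J.OrdConnected} {m : P}
    (hm : IsLeast I m) {f g : intervalFunctor k I hI ⟶ intervalFunctor k J hJ}
    (h : genScalar hm f = genScalar hm g) : f = g := by
  refine hom_ext_ap fun d x => ?_
  by_cases hd : d ∈ I
  · exact coeff_ext (by rw [coeff_ap hm f hd, coeff_ap hm g hd, h])
  · obtain rfl : x = 0 := coeff_ext ((coeff_eq_zero hd x).trans (map_zero _).symm)
    rw [map_zero, map_zero]

open Classical in
theorem genScalar_comp {I J L : Set P} {hI : I.OrdConnected} {hJ : J.OrdConnected}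
    {hL : L.OrdConnected} {m n : P} (hm : IsLeast I m) (hn : IsLeast J n)
    (f : intervalFunctor k I hI ⟶ intervalFunctor k J hJ)
    (g : intervalFunctor k J hJ ⟶ intervalFunctor k L hL) :
    genScalar hm (f ≫ g) = genScalar hm f * if m ∈ L then genScalar hn g else 0 := by
  by_cases h : m ∈ J
  · exact coeff_ap hn g h _
  · have h₁ : ap f m (basisElt hI hm.1) = 0 :=
      coeff_ext ((coeff_eq_zero h _).trans (map_zero _).symm)
    rw [genScalar, genScalar, ap_comp, h₁, map_zero, map_zero, map_zero, zero_mul]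

theorem genScalar_comp_self {I : Set P} {hI : I.OrdConnected} {m : P} (hm : IsLeast I m)
    (f g : intervalFunctor k I hI ⟶ intervalFunctor k I hI) :
    genScalar hm (f ≫ g) = genScalar hm f * genScalar hm g := by
  rw [genScalar_comp hm hm, if_pos hm.1]

end Interval

section PartialOrder

variable {k : Type u} [Field k] {P : Type} [PartialOrder P]

/-- A map `k_I ⟶ k_J ⟶ k_I` between interval modules vanishes unless `I = J`. -/
theorem comp_eq_zero_of_ne {I J : Set P} {hI : I.OrdConnected} {hJ : J.OrdConnected} {m n : P}
    (hm : IsLeast I m) (hn : IsLeast J n) (hIJ : I ≠ J)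
    (f : intervalFunctor k I hI ⟶ intervalFunctor k J hJ)
    (g : intervalFunctor k J hJ ⟶ intervalFunctor k I hI) : f ≫ g = 0 := by
  classical
  by_contra hfg
  have hne : genScalar hm (f ≫ g) ≠ 0 := fun h => hfg (hom_ext_genScalar hm (h.trans rfl))
  have hf : genScalar hm f ≠ 0 := fun h => hne (by rw [genScalar_comp hm hn, h, zero_mul])
  have hg : genScalar hn g ≠ 0 := fun h => hne (by rw [genScalar_comp hm hn, h, ite_self, mul_zero])
  have hIJ' : I ⊆ J := fun d hd => by
    by_contra hdJ
    have h₁ := coeff_ap hm (f ≫ g) hd (basisElt hI hd)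
    have h₂ : ap f d (basisElt hI hd) = 0 :=
      coeff_ext ((coeff_eq_zero hdJ _).trans (map_zero _).symm)
    rw [ap_comp, h₂, map_zero, map_zero, if_pos hd, coeff_basisElt, one_mul] at h₁
    exact hne h₁.symm
  have hnI : n ∈ I := by
    by_contra h
    exact hg (coeff_eq_zero h _)
  obtain rfl : m = n := le_antisymm (hm.2 hnI) (hn.2 (hIJ' hm.1))
  refine hIJ (hIJ'.antisymm fun d hd => ?_)
  by_contra hdI
  have hmd : m ≤ d := hn.2 hd
  have h₁ : act (intervalFunctor k I hI) hmd (basisElt hI hm.1) = 0 :=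
    coeff_ext ((coeff_eq_zero hdI _).trans (map_zero _).symm)
  have h₂ := congrArg coeff (ap_act f hmd (basisElt hI hm.1))
  rw [h₁, map_zero, map_zero, coeff_act_of_mem hmd hd] at h₂
  exact hf h₂.symm

end PartialOrder

/-! ### Strips and quadrants as interval modules -/

section Monomial

variable {k : Type u} [Field k] {m : ℕ} {I : Set (Fin m →₀ ℕ)} (hI : I.OrdConnected)
  {a : Fin m →₀ ℕ} (ha : IsLeast I a)

/-- The coefficient of an element of a monomial ideal, on the monomial of its degree. -/
noncomputable def idealCoeff {d : Fin m →₀ ℕ} : (monomialIdealFunctor k a).obj d →ₗ[k] k :=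
  (monomialIdealPart k a d).subtype

theorem coe_eq_zero_of_not_le {d : Fin m →₀ ℕ} (h : ¬ a ≤ d)
    (x : (monomialIdealFunctor k a).obj d) : x = 0 := by
  have h₁ : (x : monomialIdealPart k a d).1 = 0 := by
    simpa [monomialIdealPart, h] using Subtype.prop (x : monomialIdealPart k a d)
  exact Subtype.ext h₁

variable (k) in
/-- The quotient map from a monomial ideal to the interval module on an interval with the same least
element. -/
noncomputable def idealToInterval : monomialIdealFunctor k a ⟶ intervalFunctor k I hI :=
  toInterval hI (fun d => idealCoeff) (fun _ _ _ _ => rfl)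
    fun {d e} h he hd x => by
      have : x = 0 := coe_eq_zero_of_not_le (fun had => hd (hI.out ha.1 he ⟨had, h⟩)) x
      rw [this, map_zero, map_zero]

theorem coeff_idealToInterval {d : Fin m →₀ ℕ} (hd : d ∈ I)
    (x : (monomialIdealFunctor k a).obj d) :
    coeff (ap (idealToInterval k hI ha) d x) = idealCoeff x := by
  classical
  exact (coe_toIntervalPart k I d idealCoeff x).trans (if_pos hd)

theorem surjective_idealToInterval (d : Fin m →₀ ℕ) :
    Function.Surjective (ap (idealToInterval k hI ha) d) := fun y => by
  by_cases hd : d ∈ I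
  · have h : coeff y ∈ monomialIdealPart k a d := by
      rw [monomialIdealPart, if_pos (ha.2 hd)]
      trivial
    exact ⟨(⟨coeff y, h⟩ : monomialIdealPart k a d),
      coeff_ext (coeff_idealToInterval hI ha hd _)⟩
  · exact ⟨0, coeff_ext ((coeff_eq_zero hd _).trans (coeff_eq_zero hd y).symm)⟩

include ha in
theorem isFG_intervalFunctor : IsFG k _ (intervalFunctor k I hI) :=
  isFG_of_epi (idealToInterval k hI ha) (surjective_idealToInterval hI ha)
    (isFG_monomialIdealFunctor k a)

theorem nonempty_iso_cokernel_monomialIdealInclusion {b : Fin m →₀ ℕ} (hab : a ≤ b)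
    (hIab : ∀ d, d ∈ I ↔ a ≤ d ∧ ¬ b ≤ d) :
    Nonempty (cokernel (monomialIdealInclusion k hab) ≅
      (⟨intervalFunctor k I hI, isFG_intervalFunctor hI ha⟩ : FGMod k m)) := by
  let ι := monomialIdealInclusion k hab
  let q : monomialIdeal k a ⟶ (⟨intervalFunctor k I hI, isFG_intervalFunctor hI ha⟩ : FGMod k m) :=
    ObjectProperty.homMk (idealToInterval k hI ha)
  have hq : ι ≫ q = 0 := by
    refine ObjectProperty.hom_ext _ (hom_ext_ap fun d x => coeff_ext (hI := hI) ?_)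
    by_cases hd : d ∈ I
    · have hx : x = 0 := coe_eq_zero_of_not_le ((hIab d).1 hd).2 x
      rw [hx, map_zero, map_zero, map_zero, map_zero]
    · exact (coeff_eq_zero hd _).trans (coeff_eq_zero hd _).symm
  have hπ (d : Fin m →₀ ℕ) : Function.Surjective (ap (cokernel.π ι).hom d) :=
    (ModuleCat.epi_iff_surjective ((degreePart k d).map (cokernel.π ι))).1 inferInstance
  have hdesc (d : Fin m →₀ ℕ) (x : (monomialIdealFunctor k a).obj d) :
      ap (cokernel.desc ι q hq).hom d (ap (cokernel.π ι).hom d x) =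
        ap (idealToInterval k hI ha) d x :=
    congrArg (fun f : monomialIdeal k a ⟶ _ => ap f.hom d x) (cokernel.π_desc ι q hq)
  have hcond (d : Fin m →₀ ℕ) (x : (monomialIdealFunctor k b).obj d) :
      ap (cokernel.π ι).hom d (ap ι.hom d x) = 0 :=
    congrArg (fun f : monomialIdeal k b ⟶ _ => ap f.hom d x) (cokernel.condition ι)
  have : IsIso (cokernel.desc ι q hq) := isIso_of_hom_bijective _ fun d => by
    refine ⟨(injective_iff_map_eq_zero _).2 fun z hz => ?_, fun y => ?_⟩
    · obtain ⟨x, rfl⟩ := hπ d z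
      have hx := (hdesc d x).symm.trans hz
      by_cases hd : d ∈ I
      · have h₁ := (coeff_idealToInterval hI ha hd x).symm.trans (congrArg coeff hx)
        have h₂ : x = 0 := Subtype.ext (h₁.trans (map_zero coeff))
        rw [h₂, map_zero]
      · by_cases had : a ≤ d
        · have hbd : b ≤ d := by
            by_contra h
            exact hd ((hIab d).2 ⟨had, h⟩)
          have h : idealCoeff x ∈ monomialIdealPart k b d := by
            rw [monomialIdealPart, if_pos hbd]
            trivial
          exact hcond d (⟨_, h⟩ : monomialIdealPart k b d)
        · exact (congrArg (ap (cokernel.π ι).hom d) (coe_eq_zero_of_not_le had x)).trans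
            (map_zero _)
    · obtain ⟨x, hx⟩ := surjective_idealToInterval hI ha d y
      exact ⟨_, (hdesc d x).trans hx⟩
  exact ⟨asIso (cokernel.desc ι q hq)⟩

theorem nonempty_iso_stripModule {i : Fin m} {a b : ℕ} (ha : IsLeast I (Finsupp.single i a))
    (hab : a ≤ b) (hIab : ∀ d, d ∈ I ↔ a ≤ d i ∧ d i < b) : Nonempty (stripModule k i hab ≅
      (⟨intervalFunctor k I hI, isFG_intervalFunctor hI ha⟩ : FGMod k m)) :=
  nonempty_iso_cokernel_monomialIdealInclusion hI ha (Finsupp.single_le_single.2 hab) fun d => by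
    rw [hIab, Finsupp.single_le_iff, Finsupp.single_le_iff, not_le]

theorem nonempty_iso_monomialIdeal (hIa : ∀ d, d ∈ I ↔ a ≤ d) :
    Nonempty (monomialIdeal k a ≅
      (⟨intervalFunctor k I hI, isFG_intervalFunctor hI ha⟩ : FGMod k m)) := by
  let f : monomialIdeal k a ⟶ (⟨intervalFunctor k I hI, isFG_intervalFunctor hI ha⟩ : FGMod k m) :=
    ObjectProperty.homMk (idealToInterval k hI ha)
  have : IsIso f := isIso_of_hom_bijective f fun d => by
    refine ⟨(injective_iff_map_eq_zero _).2 fun z hz => ?_, surjective_idealToInterval hI ha d⟩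
    by_cases hd : d ∈ I
    · exact Subtype.ext ((coeff_idealToInterval hI ha hd z).symm.trans
        ((congrArg coeff hz).trans (map_zero coeff)))
    · exact coe_eq_zero_of_not_le (fun h => hd ((hIa d).2 h)) z
  exact ⟨asIso f⟩

end Monomial

section Label

namespace IndecLabel

/-- The degrees in which the module with a given label is nonzero. -/
def support : IndecLabel → Set (Fin 2 →₀ ℕ)
  | verticalStrip a b _ => {d | a ≤ d 0 ∧ d 0 < b}
  | horizontalStrip a b _ => {d | a ≤ d 1 ∧ d 1 < b}
  | quadrant a₁ a₂ => {d | a₁ ≤ d 0 ∧ a₂ ≤ d 1}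

/-- The degree of the generator of the module with a given label. -/
noncomputable def genDegree : IndecLabel → (Fin 2 →₀ ℕ)
  | verticalStrip a _ _ => Finsupp.single 0 a
  | horizontalStrip a _ _ => Finsupp.single 1 a
  | quadrant a₁ a₂ => Finsupp.single 0 a₁ + Finsupp.single 1 a₂

theorem le_iff {d e : Fin 2 →₀ ℕ} : d ≤ e ↔ d 0 ≤ e 0 ∧ d 1 ≤ e 1 := by
  rw [Finsupp.le_def, Fin.forall_fin_two]

theorem ordConnected_support (l : IndecLabel) : l.support.OrdConnected :=
  ⟨fun x hx y hy z hz => by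
    obtain ⟨h₁, h₂⟩ := hz
    rw [le_iff] at h₁ h₂
    cases l <;> simp only [support, Set.mem_ofPred_eq] at * <;> omega⟩

theorem isLeast_support (l : IndecLabel) : IsLeast l.support l.genDegree := by
  constructor
  · cases l <;> simp [support, genDegree] <;> omega
  · intro d hd
    rw [le_iff]
    cases l <;> simp_all [support, genDegree]

theorem support_injective : Function.Injective support := by
  intro l l' h
  have h' : ∀ x y : ℕ, Finsupp.single 0 x + Finsupp.single 1 y ∈ l.support ↔
      Finsupp.single 0 x + Finsupp.single 1 y ∈ l'.support := fun x y => by rw [h]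
  have hv : ∀ a b hab (x y : ℕ), Finsupp.single 0 x + Finsupp.single 1 y ∈
      (verticalStrip a b hab).support ↔ a ≤ x ∧ x < b := by simp [support]
  have hh : ∀ a b hab (x y : ℕ), Finsupp.single 0 x + Finsupp.single 1 y ∈
      (horizontalStrip a b hab).support ↔ a ≤ y ∧ y < b := by simp [support]
  have hq : ∀ a₁ a₂ (x y : ℕ), Finsupp.single 0 x + Finsupp.single 1 y ∈
      (quadrant a₁ a₂).support ↔ a₁ ≤ x ∧ a₂ ≤ y := by simp [support]
  cases l with
  | verticalStrip a b hab =>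
    cases l' with
    | verticalStrip a' b' hab' =>
      simp only [hv] at h'
      have := h' a 0
      have := h' a' 0
      have := h' (b - 1) 0
      have := h' (b' - 1) 0
      obtain rfl : a = a' := by omega
      obtain rfl : b = b' := by omega
      rfl
    | horizontalStrip a' b' hab' =>
      simp only [hv, hh] at h'
      have := h' a b'
      omega
    | quadrant a₁ a₂ =>
      simp only [hv, hq] at h'
      have := h' (a₁ + b) a₂
      omega
  | horizontalStrip a b hab =>
    cases l' with
    | verticalStrip a' b' hab' =>
      simp only [hv, hh] at h'
      have := h' b' a
      omega
    | horizontalStrip a' b' hab' =>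
      simp only [hh] at h'
      have := h' 0 a
      have := h' 0 a'
      have := h' 0 (b - 1)
      have := h' 0 (b' - 1)
      obtain rfl : a = a' := by omega
      obtain rfl : b = b' := by omega
      rfl
    | quadrant a₁ a₂ =>
      simp only [hh, hq] at h'
      have := h' a₁ (a₂ + b)
      omega
  | quadrant a₁ a₂ =>
    cases l' with
    | verticalStrip a b hab =>
      simp only [hv, hq] at h'
      have := h' (a₁ + b) a₂
      omega
    | horizontalStrip a b hab =>
      simp only [hh, hq] at h'
      have := h' a₁ (a₂ + b)
      omega
    | quadrant a₁' a₂' =>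
      simp only [hq] at h'
      have := h' a₁ a₂
      have := h' a₁' a₂'
      obtain rfl : a₁ = a₁' := by omega
      obtain rfl : a₂ = a₂' := by omega
      rfl

end IndecLabel

variable {k : Type u} [Field k]

/-- An interval module is saturated if the interval meets each square in a way that makes the
fibre product condition hold. -/
theorem isSaturated_intervalFunctor {I : Set (Fin 2 →₀ ℕ)} (hI : I.OrdConnected)
    (h : ∀ {i j : Fin 2}, i ≠ j → ∀ {d p q e : Fin 2 →₀ ℕ}, d ≤ p → d ≤ q → p ≤ e → q ≤ e →
      (natIncl {i}).obj p ≤ (natIncl {i}).obj d → (natIncl {j}).obj q ≤ (natIncl {j}).obj d →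
      (natIncl {j}).obj e ≤ (natIncl {j}).obj p → (natIncl {i}).obj e ≤ (natIncl {i}).obj q →
      (d ∈ I → p ∈ I ∨ q ∈ I) ∧ (p ∈ I → q ∈ I → d ∈ I ∧ e ∈ I) ∧
        (p ∈ I → d ∉ I → e ∈ I) ∧ (q ∈ I → d ∉ I → e ∈ I)) :
    IsSaturated (intervalFunctor k I hI) where
  eq_zero {i j} hij {d p q} hdp hdq hp hq x hxp hxq := by
    by_cases hd : d ∈ I
    · have h₁ := (h hij hdp hdq (le_sup_left : p ≤ p ⊔ q) le_sup_right hp hq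
        (natIncl_le_natIncl_iff.2 fun l hl => sup_le le_rfl
          ((natIncl_le_natIncl_iff.1 hq l hl).trans (hdp l)))
        (natIncl_le_natIncl_iff.2 fun l hl => sup_le
          ((natIncl_le_natIncl_iff.1 hp l hl).trans (hdq l)) le_rfl)).1 hd
      refine coeff_ext ?_
      obtain hpI | hqI := h₁
      · rw [← coeff_act_of_mem hdp hpI, hxp, map_zero, map_zero]
      · rw [← coeff_act_of_mem hdq hqI, hxq, map_zero, map_zero]
    · exact coeff_ext ((coeff_eq_zero hd x).trans (map_zero _).symm)
  exists_glue {i j} hij {d p q e} hdp hdq hpe hqe hp hq hp' hq' x y hxy := by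
    obtain ⟨h₁, h₂, h₃, h₄⟩ := h hij hdp hdq hpe hqe hp hq hp' hq'
    -- A coefficient that agrees with those of `x` and `y` in the degrees of `I`.
    suffices hc : ∃ c : k, (p ∈ I → d ∉ I → coeff x = 0) ∧ (q ∈ I → d ∉ I → coeff y = 0) ∧
        (p ∈ I → d ∈ I → coeff x = c) ∧ (q ∈ I → d ∈ I → coeff y = c) by
      obtain ⟨c, hx₀, hy₀, hx, hy⟩ := hc
      by_cases hd : d ∈ I
      · refine ⟨c • basisElt hI hd, coeff_ext ?_, coeff_ext ?_⟩
        · by_cases hpI : p ∈ I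
          · rw [coeff_act_of_mem hdp hpI, map_smul, coeff_basisElt, smul_eq_mul, mul_one,
              hx hpI hd]
          · rw [coeff_eq_zero hpI, coeff_eq_zero hpI]
        · by_cases hqI : q ∈ I
          · rw [coeff_act_of_mem hdq hqI, map_smul, coeff_basisElt, smul_eq_mul, mul_one,
              hy hqI hd]
          · rw [coeff_eq_zero hqI, coeff_eq_zero hqI]
      · refine ⟨0, coeff_ext ?_, coeff_ext ?_⟩
        · rw [map_zero, map_zero]
          by_cases hpI : p ∈ I
          · exact (hx₀ hpI hd).symm
          · exact (coeff_eq_zero hpI x).symm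
        · rw [map_zero, map_zero]
          by_cases hqI : q ∈ I
          · exact (hy₀ hqI hd).symm
          · exact (coeff_eq_zero hqI y).symm
    have hxy' : e ∈ I → coeff x = coeff y := fun he => by
      rw [← coeff_act_of_mem hpe he, hxy, coeff_act_of_mem hqe he]
    by_cases hpI : p ∈ I
    · refine ⟨coeff x, fun _ hd => ?_, fun hqI hd => absurd (h₂ hpI hqI).1 hd, fun _ _ => rfl,
        fun hqI _ => (hxy' (h₂ hpI hqI).2).symm⟩
      rw [hxy' (h₃ hpI hd)]
      exact coeff_eq_zero (fun hqI => hd (h₂ hpI hqI).1) y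
    · refine ⟨coeff y, fun hpI' => absurd hpI' hpI, fun hqI hd => ?_,
        fun hpI' => absurd hpI' hpI, fun _ _ => rfl⟩
      rw [← hxy' (h₄ hqI hd)]
      exact coeff_eq_zero hpI x

variable (k)

/-- The interval module on the support of a label. -/
noncomputable def IndecLabel.intervalModule (l : IndecLabel) : FGMod k 2 :=
  ⟨intervalFunctor k l.support l.ordConnected_support,
    isFG_intervalFunctor l.ordConnected_support l.isLeast_support⟩

theorem IndecLabel.isSaturated_intervalModule (l : IndecLabel) :
    IsSaturated (l.intervalModule k).obj := by
  refine isSaturated_intervalFunctor l.ordConnected_support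
    fun {i j} hij {d p q e} hdp hdq hpe hqe hp hq hp' hq' => ?_
  have hi : i = 0 ∧ j = 1 ∨ i = 1 ∧ j = 0 := by omega
  rw [natIncl_le_natIncl_iff] at hp hq hp' hq'
  rw [IndecLabel.le_iff] at hdp hdq hpe hqe
  obtain ⟨rfl, rfl⟩ | ⟨rfl, rfl⟩ := hi
  · have h1 := hp 1 (by decide)
    have h2 := hq 0 (by decide)
    have h3 := hp' 0 (by decide)
    have h4 := hq' 1 (by decide)
    cases l <;> simp only [support, Set.mem_ofPred_eq] <;> omega
  · have h1 := hp 0 (by decide)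
    have h2 := hq 1 (by decide)
    have h3 := hp' 1 (by decide)
    have h4 := hq' 0 (by decide)
    cases l <;> simp only [support, Set.mem_ofPred_eq] <;> omega

theorem IndecLabel.nonempty_iso (l : IndecLabel) :
    Nonempty (l.module k ≅ l.intervalModule k) := by
  cases l with
  | verticalStrip a b h =>
    exact nonempty_iso_stripModule _ (isLeast_support (verticalStrip a b h)) h.le fun _ => Iff.rfl
  | horizontalStrip a b h =>
    exact nonempty_iso_stripModule _ (isLeast_support (horizontalStrip a b h)) h.le fun _ => Iff.rfl
  | quadrant a₁ a₂ =>
    exact nonempty_iso_monomialIdeal _ (isLeast_support (quadrant a₁ a₂)) fun d => by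
      rw [le_iff]
      simp [support, genDegree]

end Label

/-! ### Splitting an interval module off a saturated module -/

section Split

variable {k : Type u} [Field k] {M : (Fin 2 →₀ ℕ) ⥤ ModuleCat.{u} k}

theorem exists_linearForm_of_notMem {V : Type*} [AddCommGroup V] [Module k V] {U : Submodule k V}
    {x : V} (hx : x ∉ U) : ∃ f : V →ₗ[k] k, f x = 1 ∧ ∀ y ∈ U, f y = 0 := by
  obtain ⟨f, hfx, hf⟩ := Submodule.exists_dual_map_eq_bot_of_notMem hx inferInstance
  refine ⟨(f x)⁻¹ • f, inv_mul_cancel₀ hfx, fun y hy => ?_⟩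
  have : f y = 0 := (Submodule.mem_bot k).1 (hf ▸ Submodule.mem_map_of_mem hy)
  rw [LinearMap.smul_apply, this, smul_zero]

theorem natIncl_singleton_le_iff {i j : Fin 2} (hij : i ≠ j) {d e : Fin 2 →₀ ℕ} :
    (natIncl {j}).obj d ≤ (natIncl {j}).obj e ↔ d i ≤ e i := by
  rw [natIncl_le_natIncl_iff]
  refine ⟨fun h => h i (by simpa using hij), fun h l hl => ?_⟩
  obtain rfl : l = i := eq_of_ne_of_ne hij.symm (by simpa using hl)
  exact h

theorem le_iff_of_ne {i j : Fin 2} (hij : i ≠ j) {d e : Fin 2 →₀ ℕ} :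
    d ≤ e ↔ d i ≤ e i ∧ d j ≤ e j := by
  refine ⟨fun h => ⟨h i, h j⟩, fun h l => ?_⟩
  by_cases hl : l = i
  · exact hl ▸ h.1
  · exact eq_of_ne_of_ne hij hl ▸ h.2

/-- In a saturated module, an element annihilated by a power of `t_i` extends, along the other
variable, to an element with the same property in degree zero with respect to that variable. -/
theorem IsSaturated.exists_torsion_lift (hM : IsSaturated M) {i j : Fin 2} (hij : i ≠ j)
    {d p : Fin 2 →₀ ℕ} (hdp : d ≤ p) (hp : p j ≤ d j) (x : M.obj d) (hx : act M hdp x = 0) :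
    ∃ z : M.obj (Finsupp.single i (d i)), act M (Finsupp.single_le_iff.2 le_rfl) z = x ∧
      act M (Finsupp.single_le_single.2 (hdp i)) z = 0 := by
  obtain ⟨z, h₁, h₂⟩ := hM.exists_glue hij (d := Finsupp.single i (d i))
    (p := Finsupp.single i (p i)) (q := d) (e := p) (Finsupp.single_le_single.2 (hdp i))
    (Finsupp.single_le_iff.2 le_rfl) (Finsupp.single_le_iff.2 le_rfl) hdp
    ((natIncl_singleton_le_iff hij.symm).2 (by simp [hij.symm]))
    ((natIncl_singleton_le_iff hij).2 (by simp))
    ((natIncl_singleton_le_iff hij).2 (by simp))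
    ((natIncl_singleton_le_iff hij.symm).2 hp) 0 x (by rw [map_zero, hx])
  exact ⟨z, h₂, h₁⟩

/-- If a saturated module has an element annihilated by a power of `t_i`, then a strip splits off:
the strip is generated by such an element in the least possible degree. -/
theorem IsSaturated.exists_strip (hM : IsSaturated M) {i j : Fin 2} (hij : i ≠ j)
    {d₀ p₀ : Fin 2 →₀ ℕ} (h₀ : d₀ ≤ p₀) (hp₀ : p₀ j ≤ d₀ j) (x₀ : M.obj d₀) (hx₀ : x₀ ≠ 0)
    (hx₀' : act M h₀ x₀ = 0) :
    ∃ (a b : ℕ) (_ : a < b) (x : M.obj (Finsupp.single i a)) (f : ∀ d, M.obj d →ₗ[k] k),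
      (∀ {d} (h : Finsupp.single i a ≤ d), b ≤ d i → act M h x = 0) ∧
      (∀ {d e} (h : d ≤ e), e i < b → ∀ y, f e (act M h y) = f d y) ∧
      (∀ {d e} (h : d ≤ e), e i < b → d i < a → ∀ y, f e (act M h y) = 0) ∧
      f (Finsupp.single i a) x = 1 := by
  classical
  let T : ℕ → Prop := fun n => ∃ z : M.obj (Finsupp.single i n), z ≠ 0 ∧
    ∃ (n' : ℕ) (h : n ≤ n'), act M (Finsupp.single_le_single.2 h) z = 0
  have hT : ∃ n, T n := by
    obtain ⟨z, hz, hz'⟩ := hM.exists_torsion_lift hij h₀ hp₀ x₀ hx₀'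
    exact ⟨d₀ i, z, fun h => hx₀ (by rw [← hz, h, map_zero]), p₀ i, h₀ i, hz'⟩
  obtain ⟨a, ha, hmin⟩ : ∃ a, T a ∧ ∀ n < a, ¬ T n :=
    ⟨Nat.find hT, Nat.find_spec hT, fun _ hn => Nat.find_min hT hn⟩
  obtain ⟨x, hx, hB⟩ := ha
  obtain ⟨b, ⟨hab, hb⟩, hbmin⟩ : ∃ b, (∃ h : a ≤ b, act M (Finsupp.single_le_single.2 h) x = 0) ∧
      ∀ n < b, ¬ ∃ h : a ≤ n, act M (Finsupp.single_le_single.2 h) x = 0 :=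
    ⟨Nat.find hB, Nat.find_spec hB, fun _ hn => Nat.find_min hB hn⟩
  have hab' : a < b := by
    rcases hab.lt_or_eq with h | rfl
    · exact h
    · rw [act_self] at hb
      exact absurd hb hx
  obtain ⟨c, rfl⟩ : ∃ c, b = c + 1 := ⟨b - 1, by omega⟩
  have hac : a ≤ c := by omega
  have hsingle (n : ℕ) : (Finsupp.single i n : Fin 2 →₀ ℕ) i = n ∧
      (Finsupp.single i n : Fin 2 →₀ ℕ) j = 0 := by simp [hij.symm]
  -- The last nonzero multiple of the generator.
  let w : Fin 2 →₀ ℕ := Finsupp.single i c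
  let u : M.obj w := act M (Finsupp.single_le_single.2 hac) x
  have hu : u ≠ 0 := fun h => hbmin c (by omega) ⟨hac, h⟩
  have hu' {e : Fin 2 →₀ ℕ} (h : w ≤ e) (he : e i ≤ c) : act M h u ≠ 0 := fun h' => by
    refine hu (hM.eq_zero hij (p := Finsupp.single i (c + 1)) (q := e)
      (Finsupp.single_le_single.2 (Nat.le_succ c)) h ?_ ?_ u ?_ h')
    · exact (natIncl_singleton_le_iff hij.symm).2 (by simp [hij.symm])
    · exact (natIncl_singleton_le_iff hij).2 (by simpa [w] using he)
    · rw [act_act, hb]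
  -- By minimality of `a`, no multiple of it by a power of `t_j` comes from smaller degrees.
  have hu'' {d e : Fin 2 →₀ ℕ} (hd : d i < a) (hde : d ≤ e) (hwe : w ≤ e) (he : e i ≤ c)
      (y : M.obj d) : act M hde y ≠ act M hwe u := fun h => by
    let d' : Fin 2 →₀ ℕ := Finsupp.single i (d i) + Finsupp.single j (e j)
    let e' : Fin 2 →₀ ℕ := Finsupp.single i (c + 1) + Finsupp.single j (e j)
    have hd' : d' i = d i ∧ d' j = e j := by simp [d', hij, hij.symm]
    have he' : e' i = c + 1 ∧ e' j = e j := by simp [e', hij, hij.symm]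
    have h₁ : d ≤ d' := (le_iff_of_ne hij).2 ⟨hd'.1.ge, hd'.2 ▸ hde j⟩
    have h₂ : d' ≤ e := (le_iff_of_ne hij).2 ⟨hd'.1 ▸ hde i, hd'.2.le⟩
    have h₃ : e ≤ e' := (le_iff_of_ne hij).2 ⟨by omega, he'.2.ge⟩
    have h₄ : Finsupp.single i (c + 1) ≤ e' := Finsupp.single_le_iff.2 he'.1.ge
    have h₅ : act M (h₂.trans h₃) (act M h₁ y) = 0 := by
      rw [act_act, ← act_act M hde h₃, h, act_act, act_act,
        ← act_act M (Finsupp.single_le_single.2 hab) h₄, hb, map_zero]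
    obtain ⟨z, hz, hz'⟩ := hM.exists_torsion_lift hij (h₂.trans h₃) (by omega) _ h₅
    have hz₀ : z = 0 := by
      by_contra hne
      exact hmin (d' i) (by omega) ⟨z, hne, e' i, (h₂.trans h₃) i, hz'⟩
    refine hu' hwe he ?_
    rw [← h, ← act_act M h₁ h₂, ← hz, hz₀, map_zero, map_zero]
  -- Inverting `t_j` leaves a module over `k[t_i]`, in whose degree `c` the linear form is chosen:
  -- it is one on `u` and zero on a subspace `U` that contains what comes from degrees below `a`.
  let F := locObj k {j} M
  let η := locUnit k {j} M
  have hη (d : Fin 2 →₀ ℕ) (hd : d i ≤ c) : (natIncl {j}).obj d ≤ (natIncl {j}).obj w :=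
    (natIncl_singleton_le_iff hij).2 (by simpa [w] using hd)
  obtain ⟨U, hU, hU'⟩ : ∃ U : Submodule k (F.obj ((natIncl {j}).obj w)), toLoc η w u ∉ U ∧
      ∀ d (hd : d i ≤ c), d i < a → ∀ y, act F (hη d hd) (toLoc η d y) ∈ U := by
    cases a with
    | zero =>
      refine ⟨⊥, fun h => ?_, fun d _ h => absurd h (Nat.not_lt_zero _)⟩
      rw [Submodule.mem_bot] at h
      obtain ⟨e, hwe, he, he'⟩ := exists_act_eq_zero η (isDirectedOver_natIncl _)
        (v := (natIncl {j}).obj w) le_rfl u (by rw [h, map_zero])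
      rw [natIncl_singleton_le_iff hij] at he
      exact hu' hwe (by simpa [w] using he) he'
    | succ n =>
      have hn : (natIncl {j}).obj (Finsupp.single i n) ≤ (natIncl {j}).obj w :=
        hη _ (by rw [(hsingle n).1]; omega)
      refine ⟨LinearMap.range (act F hn), ?_, fun d hd hdn y => ?_⟩
      · rintro ⟨v, hv⟩
        obtain ⟨d, hd, y, rfl⟩ := exists_toLoc_eq η (isDirectedOver_natIncl _) _ v
        rw [act_act] at hv
        have hdn : d i ≤ n := by simpa using (natIncl_singleton_le_iff hij).1 hd
        have h₁ : toLoc η (d ⊔ w) (act M le_sup_left y - act M le_sup_right u) = 0 := by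
          rw [map_sub, toLoc_act, toLoc_act, ← hv, act_act, sub_self]
        obtain ⟨e, he, he', h₂⟩ := exists_act_eq_zero η (isDirectedOver_natIncl _)
          (v := (natIncl {j}).obj (d ⊔ w)) le_rfl _ ((congrArg _ h₁).trans (map_zero _))
        rw [natIncl_singleton_le_iff hij] at he'
        rw [map_sub, act_act, act_act, sub_eq_zero] at h₂
        refine hu'' (by omega) (le_sup_left.trans he) (le_sup_right.trans he) (he'.trans ?_) y h₂
        have hw : w i = c := (hsingle c).1
        rw [Finsupp.sup_apply, hw]
        omega
      · have hdn' : (natIncl {j}).obj d ≤ (natIncl {j}).obj (Finsupp.single i n) :=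
          (natIncl_singleton_le_iff hij).2 (by rw [(hsingle n).1]; omega)
        exact ⟨act F hdn' (toLoc η d y), by rw [act_act]⟩
  obtain ⟨f, hfu, hf⟩ := exists_linearForm_of_notMem hU
  let g : ∀ d, M.obj d →ₗ[k] k := fun d =>
    if hd : d i ≤ c then f ∘ₗ act F (hη d hd) ∘ₗ toLoc η d else 0
  have hg (d) (hd : d i ≤ c) (y : M.obj d) : g d y = f (act F (hη d hd) (toLoc η d y)) := by
    simp only [g, dif_pos hd, LinearMap.comp_apply]
  have hgact {d e} (h : d ≤ e) (he : e i < c + 1) (y : M.obj d) : g e (act M h y) = g d y := by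
    have hec : e i ≤ c := by omega
    rw [hg e hec, hg d ((h i).trans hec), toLoc_act, act_act]
  refine ⟨a, c + 1, hab', x, g, fun {d} h hd => ?_, hgact, fun {d e} h he hd y => ?_, ?_⟩
  · rw [← act_act M (Finsupp.single_le_single.2 hab) (Finsupp.single_le_iff.2 hd), hb, map_zero]
  · have hdc : d i ≤ c := by omega
    rw [hgact h he, hg d hdc]
    exact hf _ (hU' d hdc hd y)
  · have h₁ := hgact (Finsupp.single_le_single.2 hac : (Finsupp.single i a : Fin 2 →₀ ℕ) ≤ w)
      (by rw [(hsingle c).1]; omega) x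
    rw [← h₁, hg w (by rw [(hsingle c).1])]
    rw [act_self]
    exact hfu

/-- If no monomial annihilates a nonzero element of a nonzero saturated module, then a quadrant
splits off: its generator is a nonzero element of a degree that is least for the lexicographic
order. -/
theorem IsSaturated.exists_quadrant (hM : IsSaturated M)
    (hinj : ∀ {d e : Fin 2 →₀ ℕ} (h : d ≤ e), Function.Injective (act M h))
    {d₀ : Fin 2 →₀ ℕ} (x₀ : M.obj d₀) (hx₀ : x₀ ≠ 0) :
    ∃ (a : Fin 2 →₀ ℕ) (x : M.obj a) (f : ∀ d, M.obj d →ₗ[k] k),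
      (∀ {d e} (h : d ≤ e) (y), f e (act M h y) = f d y) ∧
      (∀ {d}, ¬ a ≤ d → ∀ y, f d y = 0) ∧ f a x = 1 := by
  classical
  have h₁ : ∃ n, ∃ d : Fin 2 →₀ ℕ, d 1 = n ∧ ∃ x : M.obj d, x ≠ 0 := ⟨_, d₀, rfl, x₀, hx₀⟩
  obtain ⟨a₁, ha₁, hmin₁⟩ : ∃ a, (∃ d : Fin 2 →₀ ℕ, d 1 = a ∧ ∃ x : M.obj d, x ≠ 0) ∧
      ∀ n < a, ¬ ∃ d : Fin 2 →₀ ℕ, d 1 = n ∧ ∃ x : M.obj d, x ≠ 0 :=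
    ⟨Nat.find h₁, Nat.find_spec h₁, fun _ hn => Nat.find_min h₁ hn⟩
  have h₀ : ∃ n, ∃ d : Fin 2 →₀ ℕ, d 0 = n ∧ d 1 = a₁ ∧ ∃ x : M.obj d, x ≠ 0 :=
    let ⟨d, hd, hx⟩ := ha₁
    ⟨_, d, rfl, hd, hx⟩
  obtain ⟨a₀, ⟨a, ha, ha', x, hx⟩, hmin₀⟩ :
      ∃ a, (∃ d : Fin 2 →₀ ℕ, d 0 = a ∧ d 1 = a₁ ∧ ∃ x : M.obj d, x ≠ 0) ∧
      ∀ n < a, ¬ ∃ d : Fin 2 →₀ ℕ, d 0 = n ∧ d 1 = a₁ ∧ ∃ x : M.obj d, x ≠ 0 :=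
    ⟨Nat.find h₀, Nat.find_spec h₀, fun _ hn => Nat.find_min h₀ hn⟩
  -- All degrees embed compatibly into the degree zero part of `M[s⁻¹, t⁻¹]`, where the linear form
  -- is chosen: it is one on `x` and zero on a subspace `U` that contains the images of all degrees
  -- that are not above `a`.
  let F := locObj k Finset.univ M
  let η := locUnit k Finset.univ M
  let o : LocDeg (Finset.univ : Finset (Fin 2)) := (natIncl Finset.univ).obj 0
  have hle (v w : LocDeg (Finset.univ : Finset (Fin 2))) : v ≤ w :=
    fun l hl => absurd (Finset.mem_univ l) hl
  let g (d : Fin 2 →₀ ℕ) : M.obj d →ₗ[k] F.obj o := act F (hle _ o) ∘ₗ toLoc η d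
  have hgact {d e : Fin 2 →₀ ℕ} (h : d ≤ e) (y : M.obj d) : g e (act M h y) = g d y := by
    change act F _ (toLoc η e (act M h y)) = act F _ (toLoc η d y)
    rw [toLoc_act, act_act]
  have hginj (d : Fin 2 →₀ ℕ) (y : M.obj d) (hy : g d y = 0) : y = 0 := by
    obtain ⟨e, hde, -, he⟩ := exists_act_eq_zero η (isDirectedOver_natIncl _) _ y hy
    exact hinj hde (he.trans (map_zero _).symm)
  obtain ⟨U, hU, hU'⟩ : ∃ U : Submodule k (F.obj o), g a x ∉ U ∧
      ∀ d, ¬ a ≤ d → ∀ y, g d y ∈ U := by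
    have hzero (d : Fin 2 →₀ ℕ) (hd : d 1 < a₁) (y : M.obj d) : y = 0 := by
      by_contra hy
      exact hmin₁ _ hd ⟨d, rfl, y, hy⟩
    have hlt (d : Fin 2 →₀ ℕ) (had : ¬ a ≤ d) : d 1 < a₁ ∨ d 0 < a₀ := by
      rw [IndecLabel.le_iff] at had
      omega
    cases a₀ with
    | zero =>
      refine ⟨⊥, fun h => hx (hginj a x ((Submodule.mem_bot k).1 h)), fun d hd y => ?_⟩
      rw [hzero d (by have := hlt d hd; omega) y, map_zero]
      exact Submodule.zero_mem _
    | succ n =>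
      let c (r : ℕ) : Fin 2 →₀ ℕ := Finsupp.single 0 n + Finsupp.single 1 r
      have hc (r : ℕ) : c r 0 = n ∧ c r 1 = r := by simp [c]
      refine ⟨⨆ r, LinearMap.range (g (c r)), fun h => ?_, fun d hd y => ?_⟩
      · have hdir : Directed (· ≤ ·) fun r => LinearMap.range (g (c r)) := by
          refine Monotone.directed_le fun r s hrs => ?_
          rintro _ ⟨y, rfl⟩
          have hrs' : c r ≤ c s := IndecLabel.le_iff.2 (by simp [hc, hrs])
          exact ⟨act M hrs' y, hgact hrs' y⟩
        obtain ⟨r, y, hy⟩ := (Submodule.mem_iSup_of_directed _ hdir).1 h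
        have hcr := hc r
        have hce := hc (a₁ ⊔ r)
        have hca := hc a₁
        let e : Fin 2 →₀ ℕ := Finsupp.single 0 (n + 1) + Finsupp.single 1 (a₁ ⊔ r)
        have he : e 0 = n + 1 ∧ e 1 = a₁ ⊔ r := by simp [e]
        have hae : a ≤ e := IndecLabel.le_iff.2 (by omega)
        have hre : c r ≤ c (a₁ ⊔ r) := IndecLabel.le_iff.2 (by omega)
        have hre' : c (a₁ ⊔ r) ≤ e := IndecLabel.le_iff.2 (by omega)
        have hca' : c a₁ ≤ a := IndecLabel.le_iff.2 (by omega)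
        have hyx : act M hae x = act M hre' (act M hre y) := by
          refine sub_eq_zero.1 (hginj e _ ?_)
          rw [map_sub, hgact, hgact, hgact, hy, sub_self]
        -- If `x` came from `c r`, then glueing would divide it by `t_0`.
        obtain ⟨z, hz, -⟩ := hM.exists_glue (i := 0) (j := 1) (by decide) hca'
          (IndecLabel.le_iff.2 (by omega) : c a₁ ≤ c (a₁ ⊔ r)) hae hre'
          ((natIncl_singleton_le_iff (by decide)).2 (by omega : a 1 ≤ c a₁ 1))
          ((natIncl_singleton_le_iff (by decide)).2 (by omega : c (a₁ ⊔ r) 0 ≤ c a₁ 0))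
          ((natIncl_singleton_le_iff (by decide)).2 (by omega : e 0 ≤ a 0))
          ((natIncl_singleton_le_iff (by decide)).2 (by omega : e 1 ≤ c (a₁ ⊔ r) 1)) _ _ hyx
        refine hmin₀ n (by omega) ⟨c a₁, hca.1, hca.2, z, fun h => hx ?_⟩
        rw [← hz, h, map_zero]
      · obtain h | h := hlt d hd
        · rw [hzero d h y, map_zero]
          exact Submodule.zero_mem _
        · have hcd := hc (d 1)
          have hd' : d ≤ c (d 1) := IndecLabel.le_iff.2 (by omega)
          exact Submodule.mem_iSup_of_mem (d 1) ⟨act M hd' y, hgact hd' y⟩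
  obtain ⟨f, hfx, hf⟩ := exists_linearForm_of_notMem hU
  exact ⟨a, x, fun d => f ∘ₗ g d, fun h y => congrArg f (hgact h y),
    fun hd y => hf _ (hU' _ hd y), hfx⟩

/-- A nonzero saturated module has a strip or a quadrant as a direct summand. -/
theorem IsSaturated.exists_retract (hM : IsSaturated M) {d₀ : Fin 2 →₀ ℕ} (x₀ : M.obj d₀)
    (hx₀ : x₀ ≠ 0) : ∃ (l : IndecLabel) (ι : intervalFunctor k l.support l.ordConnected_support ⟶ M)
      (ρ : M ⟶ intervalFunctor k l.support l.ordConnected_support), ι ≫ ρ = 𝟙 _ := by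
  by_cases h₀ : ∃ (d p : Fin 2 →₀ ℕ) (h : d ≤ p) (x : M.obj d), p 1 ≤ d 1 ∧ x ≠ 0 ∧ act M h x = 0
  · obtain ⟨d, p, h, x, hp, hx, hx'⟩ := h₀
    obtain ⟨a, b, hab, x, f, h₁, h₂, h₃, h₄⟩ :=
      hM.exists_strip (i := 0) (j := 1) (by decide) h hp x hx hx'
    let l := IndecLabel.verticalStrip a b hab
    refine ⟨l, _, _, ofInterval_toInterval l.ordConnected_support l.isLeast_support x
      (fun {d} h hd => h₁ h ?_) f (fun h he _ y => h₂ h he.2 y)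
      (fun {d e} h he hd y => h₃ h he.2 ?_ y) h₄⟩
    · by_contra hb
      exact hd ⟨Finsupp.single_le_iff.1 h, not_le.1 hb⟩
    · by_contra ha
      exact hd ⟨not_lt.1 ha, (h 0).trans_lt he.2⟩
  by_cases h₁ : ∃ (d p : Fin 2 →₀ ℕ) (h : d ≤ p) (x : M.obj d), p 0 ≤ d 0 ∧ x ≠ 0 ∧ act M h x = 0
  · obtain ⟨d, p, h, x, hp, hx, hx'⟩ := h₁
    obtain ⟨a, b, hab, x, f, h₁, h₂, h₃, h₄⟩ :=
      hM.exists_strip (i := 1) (j := 0) (by decide) h hp x hx hx'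
    let l := IndecLabel.horizontalStrip a b hab
    refine ⟨l, _, _, ofInterval_toInterval l.ordConnected_support l.isLeast_support x
      (fun {d} h hd => h₁ h ?_) f (fun h he _ y => h₂ h he.2 y)
      (fun {d e} h he hd y => h₃ h he.2 ?_ y) h₄⟩
    · by_contra hb
      exact hd ⟨Finsupp.single_le_iff.1 h, not_le.1 hb⟩
    · by_contra ha
      exact hd ⟨not_lt.1 ha, (h 1).trans_lt he.2⟩
  -- Multiplication by a monomial is multiplication by a power of `s` followed by one of `t`.
  have hinj {d e : Fin 2 →₀ ℕ} (h : d ≤ e) : Function.Injective (act M h) := by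
    rw [injective_iff_map_eq_zero]
    intro x hx
    let p : Fin 2 →₀ ℕ := Finsupp.single 0 (e 0) + Finsupp.single 1 (d 1)
    have hp : p 0 = e 0 ∧ p 1 = d 1 := by simp [p]
    have hdp : d ≤ p := IndecLabel.le_iff.2 ⟨hp.1 ▸ h 0, hp.2.ge⟩
    have hpe : p ≤ e := IndecLabel.le_iff.2 ⟨hp.1.le, hp.2 ▸ h 1⟩
    push Not at h₀ h₁
    by_contra hne
    refine h₁ p e hpe (act M hdp x) hp.1.ge (h₀ d p hdp x hp.2.le hne) ?_
    rw [act_act, hx]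
  obtain ⟨a, x, f, h₂, h₃, h₄⟩ := hM.exists_quadrant hinj x₀ hx₀
  let l := IndecLabel.quadrant (a 0) (a 1)
  have hla : l.genDegree = a := by
    ext i
    fin_cases i <;> simp [l, IndecLabel.genDegree]
  have hmem (d : Fin 2 →₀ ℕ) : d ∈ l.support ↔ a ≤ d := IndecLabel.le_iff.symm
  exact ⟨l, _, _, ofInterval_toInterval l.ordConnected_support (hla ▸ l.isLeast_support) x
    (fun {d} h hd => absurd ((hmem d).2 h) hd) f (fun h _ _ y => h₂ h y)
    (fun {d e} h _ hd y => (h₂ h y).trans (h₃ (fun h' => hd ((hmem d).2 h')) y)) h₄⟩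

end Split

/-! ### Objects with endomorphism ring a field -/

section KrullSchmidt

variable {C : Type*} [Category* C] [Preadditive C] {K : Type*} [Field K]

/-- An object whose endomorphism ring embeds into a field is indecomposable. -/
theorem indecomposable_of_injective [HasBinaryBiproducts C] {X : C} (ε : (X ⟶ X) →+ K)
    (hmul : ∀ f g, ε (f ≫ g) = ε f * ε g) (hone : ε (𝟙 X) = 1) (hε : Function.Injective ε) :
    Indecomposable X := by
  refine ⟨fun h => one_ne_zero (α := K) ?_, fun Y Z α => ?_⟩
  · rw [← hone, h.eq_of_src (𝟙 X) 0, map_zero]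
  -- The projection to `Y` along `Z` is an idempotent, hence zero or the identity.
  let e : X ⟶ X := α.hom ≫ biprod.fst ≫ biprod.inl ≫ α.inv
  have he : ε e * ε e = ε e := by
    rw [← hmul]
    congr 1
    simp [e]
  obtain h | h := IsIdempotentElem.iff_eq_zero_or_one.1 he
  · left
    rw [IsZero.iff_id_eq_zero]
    have h₁ : e = 0 := hε (h.trans (map_zero ε).symm)
    have h₂ : biprod.inl ≫ α.inv ≫ e ≫ α.hom ≫ biprod.fst = 𝟙 Y := by simp [e]
    rw [← h₂, h₁]
    simp
  · right
    rw [IsZero.iff_id_eq_zero]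
    have h₁ : e = 𝟙 X := hε (h.trans hone.symm)
    have h₂ : biprod.inr ≫ α.inv ≫ e ≫ α.hom ≫ biprod.snd = (0 : Z ⟶ Z) := by simp [e]
    rw [← h₂, h₁]
    simp

theorem indecomposable_of_iso [HasBinaryBiproducts C] {X Y : C} (e : X ≅ Y)
    (hY : Indecomposable Y) : Indecomposable X :=
  ⟨fun h => hY.1 (h.of_iso e.symm), fun A B α => hY.2 A B (e.symm ≪≫ α)⟩

variable {L : Type*} {X : L → C} [HasFiniteBiproducts C]

open Classical in
/-- The components of an isomorphism of biproducts between the summands `X l` form an invertible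
matrix over `K`. -/
theorem card_fiber_eq (ε : ∀ l, (X l ⟶ X l) →+ K)
    (hmul : ∀ l f g, ε l (f ≫ g) = ε l f * ε l g) (hone : ∀ l, ε l (𝟙 _) = 1)
    (hX : ∀ {l l'}, l ≠ l' → ∀ (f : X l ⟶ X l') (g : X l' ⟶ X l), f ≫ g = 0)
    {n n' : ℕ} {f : Fin n → L} {f' : Fin n' → L}
    (α : (⨁ fun i => X (f i)) ≅ ⨁ fun i => X (f' i)) (l : L) :
    Fintype.card {i // f i = l} = Fintype.card {i // f' i = l} := by
  let incl {n : ℕ} (f : Fin n → L) (i : {i // f i = l}) : X l ⟶ ⨁ fun i => X (f i) :=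
    eqToHom (by rw [i.2]) ≫ biproduct.ι (fun i => X (f i)) i.1
  let proj {n : ℕ} (f : Fin n → L) (i : {i // f i = l}) : (⨁ fun i => X (f i)) ⟶ X l :=
    biproduct.π (fun i => X (f i)) i.1 ≫ eqToHom (by rw [i.2])
  have incl_proj {n : ℕ} (f : Fin n → L) (i j : {i // f i = l}) :
      ε l (incl f i ≫ proj f j) = (1 : Matrix {i // f i = l} {i // f i = l} K) i j := by
    by_cases hij : i = j
    · subst hij
      simp [incl, proj, hone]
    · have : i.1 ≠ j.1 := fun h => hij (Subtype.ext h)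
      simp [incl, proj, hij, biproduct.ι_π_ne_assoc _ this]
  have proj_incl {n : ℕ} (f : Fin n → L) (i : {i // f i = l}) :
      proj f i ≫ incl f i =
        biproduct.π (fun i => X (f i)) i.1 ≫ biproduct.ι (fun i => X (f i)) i.1 := by
    simp [incl, proj]
  -- Only the summands `X l` contribute to a composite `X l ⟶ ⨁ X (f i) ⟶ X l`, by `hX`.
  have sum_eq {n : ℕ} (f : Fin n → L) {p : X l ⟶ ⨁ fun i => X (f i)}
      {q : (⨁ fun i => X (f i)) ⟶ X l} :
      ∑ i : {i // f i = l}, ε l (p ≫ proj f i) * ε l (incl f i ≫ q) = ε l (p ≫ q) := by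
    have h₁ (i : {i // f i = l}) : ε l (p ≫ proj f i) * ε l (incl f i ≫ q) =
        ε l (p ≫ biproduct.π (fun i => X (f i)) i.1 ≫ biproduct.ι (fun i => X (f i)) i.1 ≫ q) := by
      rw [← hmul, Category.assoc, ← Category.assoc (proj f i), proj_incl, Category.assoc]
    have h₂ : p ≫ q = ∑ i,
        p ≫ biproduct.π (fun i => X (f i)) i ≫ biproduct.ι (fun i => X (f i)) i ≫ q := by
      conv_lhs => rw [← Category.id_comp q, ← biproduct.total, Preadditive.sum_comp,
        Preadditive.comp_sum]
      simp
    rw [h₂, map_sum, Finset.sum_congr rfl fun i _ => h₁ i]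
    rw [← Finset.sum_subtype (Finset.univ.filter fun i => f i = l) (by simp) fun i => ε l
      (p ≫ biproduct.π (fun i => X (f i)) i ≫ biproduct.ι (fun i => X (f i)) i ≫ q)]
    refine Finset.sum_filter_of_ne fun i _ hi => ?_
    by_contra hil
    rw [← Category.assoc, hX (Ne.symm hil), map_zero] at hi
    exact hi rfl
  let A : Matrix {i // f i = l} {i // f' i = l} K := fun i j => ε l (incl f i ≫ α.hom ≫ proj f' j)
  let B : Matrix {i // f' i = l} {i // f i = l} K := fun j i => ε l (incl f' j ≫ α.inv ≫ proj f i)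
  refine Matrix.square_of_invertible A B ?_ ?_
  · ext i i'
    rw [← incl_proj, Matrix.mul_apply]
    refine Eq.trans ?_ ((sum_eq f' (p := incl f i ≫ α.hom) (q := α.inv ≫ proj f i')).trans ?_)
    · simp [A, B]
    · simp
  · ext i i'
    rw [← incl_proj, Matrix.mul_apply]
    refine Eq.trans ?_ ((sum_eq f (p := incl f' i ≫ α.inv) (q := α.hom ≫ proj f' i')).trans ?_)
    · simp [A, B]
    · simp

/-- Decompositions into a family of objects, each of which has a field-valued character on its
endomorphisms and none of which has a nonzero endomorphism factoring through another one, are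
unique. -/
theorem exists_equiv_of_biproduct_iso (ε : ∀ l, (X l ⟶ X l) →+ K)
    (hmul : ∀ l f g, ε l (f ≫ g) = ε l f * ε l g) (hone : ∀ l, ε l (𝟙 _) = 1)
    (hX : ∀ {l l'}, l ≠ l' → ∀ (f : X l ⟶ X l') (g : X l' ⟶ X l), f ≫ g = 0)
    {n n' : ℕ} {f : Fin n → L} {f' : Fin n' → L}
    (α : (⨁ fun i => X (f i)) ≅ ⨁ fun i => X (f' i)) :
    ∃ e : Fin n ≃ Fin n', ∀ i, f' (e i) = f i := by
  classical
  have h (l : L) : Nonempty ({i // f i = l} ≃ {i // f' i = l}) :=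
    ⟨Fintype.equivOfCardEq (card_fiber_eq ε hmul hone hX α l)⟩
  exact ⟨Equiv.ofFiberEquiv fun l => (h l).some, fun i => Equiv.ofFiberEquiv_map _ i⟩

/-- Splitting the first summand off a biproduct. -/
noncomputable def biproductSuccIso [HasBinaryBiproducts C] {n : ℕ} (g : Fin (n + 1) → C) :
    (g 0 ⊞ ⨁ fun i : Fin n => g i.succ) ≅ ⨁ g where
  hom := biprod.desc (biproduct.ι g 0) (biproduct.desc fun i => biproduct.ι g i.succ)
  inv := biproduct.desc (Fin.cases biprod.inl
    fun i => biproduct.ι (fun i : Fin n => g i.succ) i ≫ biprod.inr)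
  hom_inv_id := by
    apply biprod.hom_ext'
    · simp
    · apply biproduct.hom_ext'
      simp
  inv_hom_id := by
    apply biproduct.hom_ext'
    intro i
    cases i using Fin.cases <;> simp

end KrullSchmidt

/-! ### Decomposition of saturated modules -/

section Decomposition

variable (k : Type u) [Field k]

/-- The scalar by which an endomorphism of a strip or quadrant acts. -/
noncomputable def intervalScalar (l : IndecLabel) :
    (l.intervalModule k ⟶ l.intervalModule k) →+ k where
  toFun f := genScalar (hI := l.ordConnected_support) (hJ := l.ordConnected_support)
    l.isLeast_support f.hom
  map_zero' := rfl
  map_add' _ _ := rfl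

variable {k}

theorem intervalScalar_id (l : IndecLabel) : intervalScalar k l (𝟙 _) = 1 := rfl

theorem intervalScalar_comp {l : IndecLabel} (f g : l.intervalModule k ⟶ l.intervalModule k) :
    intervalScalar k l (f ≫ g) = intervalScalar k l f * intervalScalar k l g :=
  genScalar_comp_self (hI := l.ordConnected_support) l.isLeast_support f.hom g.hom

theorem intervalScalar_injective (l : IndecLabel) : Function.Injective (intervalScalar k l) :=
  fun _ _ h => ObjectProperty.hom_ext _ (hom_ext_genScalar (hI := l.ordConnected_support)
    (hJ := l.ordConnected_support) l.isLeast_support h)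

theorem intervalModule_comp_eq_zero {l l' : IndecLabel} (h : l ≠ l')
    (f : l.intervalModule k ⟶ l'.intervalModule k)
    (g : l'.intervalModule k ⟶ l.intervalModule k) : f ≫ g = 0 :=
  ObjectProperty.hom_ext _ (comp_eq_zero_of_ne
    (hI := l.ordConnected_support) (hJ := l'.ordConnected_support) l.isLeast_support
    l'.isLeast_support (fun h' => h (IndecLabel.support_injective h')) f.hom g.hom)

theorem hasFiniteBiproducts_fgMod (m : ℕ) : HasFiniteBiproducts (FGMod k m) :=
  Abelian.hasFiniteBiproducts

attribute [local instance] hasFiniteBiproducts_fgMod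

theorem IsSaturated.of_retract {M N : (Fin 2 →₀ ℕ) ⥤ ModuleCat.{u} k} (hM : IsSaturated M)
    (i : N ⟶ M) (r : M ⟶ N) (hir : i ≫ r = 𝟙 N) : IsSaturated N where
  eq_zero {a b} hab {d p q} hdp hdq hp hq x hxp hxq := by
    have h := hM.eq_zero hab hdp hdq hp hq (ap i d x) (by rw [← ap_act, hxp, map_zero])
      (by rw [← ap_act, hxq, map_zero])
    rw [← ap_id d x, ← hir, ap_comp, h, map_zero]
  exists_glue {a b} hab {d p q e} hdp hdq hpe hqe hp hq hp' hq' x y hxy := by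
    obtain ⟨z, hzx, hzy⟩ := hM.exists_glue hab hdp hdq hpe hqe hp hq hp' hq' (ap i p x) (ap i q y)
      (by rw [← ap_act, ← ap_act, hxy])
    refine ⟨ap r d z, ?_, ?_⟩
    · rw [← ap_act, hzx, ← ap_comp, hir, ap_id]
    · rw [← ap_act, hzy, ← ap_comp, hir, ap_id]

theorem finite_of_isFG {m : ℕ} (M : FGMod k m) (d : Fin m →₀ ℕ) :
    Module.Finite k (M.obj.obj d) := by
  obtain ⟨S, hS, h⟩ := M.property
  refine ⟨?_⟩
  rw [← h d, genSpan]
  refine Submodule.fg_span ((hS.biUnion (t := fun g => {y | ∃ h : g.1 ≤ d,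
    y = (M.obj.map (homOfLE h)).hom g.2}) fun g _ => Set.Subsingleton.finite ?_).subset ?_)
  · rintro _ ⟨_, rfl⟩ _ ⟨_, rfl⟩
    rfl
  · rintro y ⟨g, hg, hy⟩
    exact Set.mem_biUnion hg hy

/-- A finitely generated module is generated in finitely many degrees, so maps out of it are
detected in these degrees. -/
theorem exists_finset_detecting {m : ℕ} (M : FGMod k m) : ∃ T : Finset (Fin m →₀ ℕ),
    ∀ {N : FGMod k m} (f : M ⟶ N), (∀ d ∈ T, ∀ x, ap f.hom d x = 0) → f = 0 := by
  classical
  obtain ⟨S, hS, h⟩ := M.property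
  refine ⟨hS.toFinset.image Sigma.fst, fun {N} f hf => ObjectProperty.hom_ext _
    (hom_ext_ap fun d x => ?_)⟩
  refine genSpan_le M.obj (S := S) (fun d => LinearMap.ker (ap f.hom d)) (fun {d e} φ x hx => ?_)
    (fun g hg => hf g.1 (Finset.mem_image_of_mem _ (hS.mem_toFinset.2 hg)) g.2) d
    (by rw [h d]; trivial : x ∈ genSpan M.obj S d)
  rw [LinearMap.mem_ker] at hx ⊢
  rw [map_eq_act, ap_act, hx, map_zero]

/-- A saturated module is a finite direct sum of strips and quadrants. The induction is on the total
dimension of the module in finitely many degrees that detect maps out of it. -/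
theorem IsSaturated.exists_iso_biproduct (T : Finset (Fin 2 →₀ ℕ)) (M : FGMod k 2)
    (hM : IsSaturated M.obj) (hT : ∀ {N : FGMod k 2} (f : M ⟶ N),
      (∀ d ∈ T, ∀ x, ap f.hom d x = 0) → f = 0) :
    ∃ (n : ℕ) (f : Fin n → IndecLabel), Nonempty (M ≅ ⨁ fun i => (f i).intervalModule k) := by
  induction hN : ∑ d ∈ T, Module.finrank k (M.obj.obj d) using Nat.strong_induction_on
    generalizing M with
  | _ N ih =>
  by_cases h₀ : ∀ d (x : M.obj.obj d), x = 0
  · have hM₀ : IsZero M := (IsZero.iff_id_eq_zero M).2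
      (ObjectProperty.hom_ext _ (hom_ext_ap fun d x => h₀ d x))
    refine ⟨0, Fin.elim0, ⟨hM₀.iso ?_⟩⟩
    rw [IsZero.iff_id_eq_zero]
    exact biproduct.hom_ext' _ _ fun i => Fin.elim0 i
  push Not at h₀
  obtain ⟨d₀, x₀, hx₀⟩ := h₀
  obtain ⟨l, ι', ρ', h⟩ := hM.exists_retract x₀ hx₀
  let ι : l.intervalModule k ⟶ M := ObjectProperty.homMk ι'
  let ρ : M ⟶ l.intervalModule k := ObjectProperty.homMk ρ'
  have hιρ : ι ≫ ρ = 𝟙 _ := ObjectProperty.hom_ext _ h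
  let i : kernel ρ ⟶ M := kernel.ι ρ
  have hiρ : i ≫ ρ = 0 := kernel.condition ρ
  -- The projection of `M` to the complement of the summand.
  let r : M ⟶ kernel ρ := kernel.lift ρ (𝟙 M - ρ ≫ ι) (by simp [hιρ])
  have hri : r ≫ i = 𝟙 M - ρ ≫ ι := kernel.lift_ι _ _ _
  have hir : i ≫ r = 𝟙 _ := by
    rw [← cancel_mono i, Category.assoc, hri]
    simp [reassoc_of% hiρ]
  have hιr : ι ≫ r = 0 := by
    rw [← cancel_mono i, Category.assoc, hri]
    simp [reassoc_of% hιρ]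
  let e : M ≅ l.intervalModule k ⊞ kernel ρ :=
    { hom := biprod.lift ρ r
      inv := biprod.desc ι i
      hom_inv_id := by rw [biprod.lift_desc, hri]; abel
      inv_hom_id := by
        apply biprod.hom_ext' <;> apply biprod.hom_ext <;> simp [hιρ, hiρ, hir, hιr] }
  have hinj (d : Fin 2 →₀ ℕ) : Function.Injective (ap i.hom d) :=
    Function.LeftInverse.injective (g := ap r.hom d) fun x =>
      congrArg (fun f : kernel ρ ⟶ kernel ρ => ap f.hom d x) hir
  have hle (d : Fin 2 →₀ ℕ) :
      Module.finrank k ((kernel ρ).obj.obj d) ≤ Module.finrank k (M.obj.obj d) :=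
    have := finite_of_isFG M d
    LinearMap.finrank_le_finrank_of_injective (hinj d)
  -- Otherwise `i` would be surjective in the degrees of `T`, so that `ρ` would vanish.
  have hlt : ∃ d ∈ T, Module.finrank k ((kernel ρ).obj.obj d) < Module.finrank k (M.obj.obj d) := by
    by_contra! hcon
    have hρ : ρ = 0 := hT ρ fun d hd x => by
      have := finite_of_isFG M d
      have := finite_of_isFG (kernel ρ) d
      obtain ⟨y, rfl⟩ := (LinearMap.injective_iff_surjective_of_finrank_eq_finrank
        ((hle d).antisymm (hcon d hd))).1 (hinj d) x
      exact congrArg (fun f : kernel ρ ⟶ _ => ap f.hom d y) hiρ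
    rw [hρ, comp_zero] at hιρ
    have h₁ := congrArg (intervalScalar k l) hιρ
    rw [map_zero, intervalScalar_id] at h₁
    exact zero_ne_one h₁
  -- The property `hT` passes to the quotient `kernel ρ` of `M`.
  obtain ⟨n, f, ⟨α⟩⟩ := ih _ (hN ▸ Finset.sum_lt_sum (fun d _ => hle d) hlt) (kernel ρ)
    (hM.of_retract i.hom r.hom (congrArg (·.hom) hir))
    (fun {N} g hg => by
      rw [← cancel_epi (𝟙 _), ← hir, Category.assoc, hT (r ≫ g) fun d hd x => hg d hd _]
      simp) rfl
  exact ⟨n + 1, Fin.cons l f, ⟨e ≪≫ biprod.mapIso (Iso.refl _) α ≪≫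
    biproductSuccIso fun i => ((Fin.cons l f : Fin (n + 1) → IndecLabel) i).intervalModule k⟩⟩

end Decomposition

/-! ### The indecomposables of the Serre quotient -/

section Quotient

variable (k : Type u) [Field k]

theorem additive_quotFunctor (m : ℕ) : (quotFunctor k m).Additive :=
  inferInstanceAs ((finiteModules k m).isoModSerre.Q.Additive)

attribute [local instance] hasFiniteBiproducts_fgMod additive_quotFunctor

/-- The scalar by which an endomorphism of a strip or quadrant in the Serre quotient acts. -/
noncomputable def endScalar (l : IndecLabel) :
    ((quotFunctor k 2).obj (l.intervalModule k) ⟶ (quotFunctor k 2).obj (l.intervalModule k)) →+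
      k :=
  (intervalScalar k l).comp
    (AddEquiv.ofBijective (quotFunctor k 2).mapAddHom
      (bijective_quotFunctor_map (l.isSaturated_intervalModule k) _)).symm.toAddMonoidHom

theorem endScalar_map {l : IndecLabel} (f : l.intervalModule k ⟶ l.intervalModule k) :
    endScalar k l ((quotFunctor k 2).map f) = intervalScalar k l f :=
  congrArg (intervalScalar k l)
    ((AddEquiv.ofBijective (quotFunctor k 2).mapAddHom
      (bijective_quotFunctor_map (l.isSaturated_intervalModule k) _)).symm_apply_apply f)

theorem exists_map_eq {L : FGMod k 2} {l : IndecLabel}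
    (f : (quotFunctor k 2).obj L ⟶ (quotFunctor k 2).obj (l.intervalModule k)) :
    ∃ g, (quotFunctor k 2).map g = f :=
  (bijective_quotFunctor_map (l.isSaturated_intervalModule k) L).2 f

theorem endScalar_comp (l : IndecLabel)
    (f g : (quotFunctor k 2).obj (l.intervalModule k) ⟶
      (quotFunctor k 2).obj (l.intervalModule k)) :
    endScalar k l (f ≫ g) = endScalar k l f * endScalar k l g := by
  obtain ⟨f, rfl⟩ := exists_map_eq k f
  obtain ⟨g, rfl⟩ := exists_map_eq k g
  rw [← Functor.map_comp, endScalar_map, endScalar_map, endScalar_map, intervalScalar_comp]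

theorem endScalar_id (l : IndecLabel) : endScalar k l (𝟙 _) = 1 := by
  rw [← CategoryTheory.Functor.map_id, endScalar_map, intervalScalar_id]

theorem endScalar_injective (l : IndecLabel) : Function.Injective (endScalar k l) := fun f g h => by
  obtain ⟨f, rfl⟩ := exists_map_eq k f
  obtain ⟨g, rfl⟩ := exists_map_eq k g
  rw [endScalar_map, endScalar_map] at h
  rw [intervalScalar_injective l h]

theorem quotFunctor_comp_eq_zero {l l' : IndecLabel} (h : l ≠ l')
    (f : (quotFunctor k 2).obj (l.intervalModule k) ⟶ (quotFunctor k 2).obj (l'.intervalModule k))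
    (g : (quotFunctor k 2).obj (l'.intervalModule k) ⟶
      (quotFunctor k 2).obj (l.intervalModule k)) : f ≫ g = 0 := by
  obtain ⟨f, rfl⟩ := exists_map_eq k f
  obtain ⟨g, rfl⟩ := exists_map_eq k g
  rw [← Functor.map_comp, intervalModule_comp_eq_zero h, Functor.map_zero]

theorem nonempty_biproduct_iso {n : ℕ} (f : Fin n → IndecLabel) :
    Nonempty ((⨁ fun i => (quotFunctor k 2).obj ((f i).module k)) ≅
      ⨁ fun i => (quotFunctor k 2).obj ((f i).intervalModule k)) :=
  ⟨biproduct.mapIso fun i => (quotFunctor k 2).mapIso ((f i).nonempty_iso k).some⟩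

theorem exists_iso_biproduct (X : QuotMod k 2) : ∃ (n : ℕ) (f : Fin n → IndecLabel),
    Nonempty (X ≅ ⨁ fun i => (quotFunctor k 2).obj ((f i).module k)) := by
  obtain ⟨M, hM, ⟨e⟩⟩ := exists_isSaturated_iso X
  obtain ⟨T, hT⟩ := exists_finset_detecting M
  obtain ⟨n, f, ⟨α⟩⟩ := hM.exists_iso_biproduct T M hT
  obtain ⟨β⟩ := nonempty_biproduct_iso k f
  exact ⟨n, f, ⟨e ≪≫ (quotFunctor k 2).mapIso α ≪≫ 
    (quotFunctor k 2).mapBiproduct (fun i => (f i).intervalModule k) ≪≫ β.symm⟩⟩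

end Quotient

end PersistenceModule

theorem theoremA(k : Type u) [Field k] :
    (∃ E : QuotMod k 2 ≌ LocalizedModule k (codimTwoSkeleton 2),
      Nonempty (quotFunctor k 2 ⋙ E.functor ≅ localizationFunctor k (codimTwoSkeleton 2))) ∧
    (∀ l : IndecLabel, Indecomposable ((quotFunctor k 2).obj (l.module k))) ∧
    (∀ X : QuotMod k 2, ∃ (n : ℕ) (f : Fin n → IndecLabel),
      Nonempty (X ≅ ⨁ fun i => (quotFunctor k 2).obj ((f i).module k)) ∧
      ∀ (n' : ℕ) (f' : Fin n' → IndecLabel),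
        Nonempty (X ≅ ⨁ fun i => (quotFunctor k 2).obj ((f' i).module k)) →
        ∃ e : Fin n ≃ Fin n', ∀ i, f' (e i) = f i) := by
  refine ⟨⟨quotEquivalence k, ⟨quotFunctorCompIso k⟩⟩, fun l => ?_, fun X => ?_⟩
  · exact indecomposable_of_iso ((quotFunctor k 2).mapIso (l.nonempty_iso k).some)
      (indecomposable_of_injective (endScalar k l) (endScalar_comp k l) (endScalar_id k l)
        (endScalar_injective k l))
  · obtain ⟨n, f, ⟨α⟩⟩ := exists_iso_biproduct k X
    refine ⟨n, f, ⟨α⟩, fun n' f' ⟨β⟩ => ?_⟩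
    obtain ⟨γ⟩ := nonempty_biproduct_iso k f
    obtain ⟨γ'⟩ := nonempty_biproduct_iso k f'
    exact exists_equiv_of_biproduct_iso (endScalar k) (endScalar_comp k) (endScalar_id k)
      (quotFunctor_comp_eq_zero k) (γ.symm ≪≫ α.symm ≪≫ β ≪≫ γ')
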